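/- **Setting.** Let $T\ge 0$, let $U,V$ be nonempty compact metric spaces and, for $i=1,2$, let $$L^i_t[u,v]\varphi(x)=\tfrac12\langle G^i\nabla,\nabla\rangle\varphi(x)+\langle f^i,\nabla\varphi(x)\rangle+\int_{\mathbb R^d}\bigl[\varphi(x+y)-\varphi(x)-\langle y,\nabla\varphi(x)\rangle \mathbf 1_{B_1}(y)\bigr]\nu^i(t,x,u,v,dy)$$ be generators of Lévy–Khintchine type ($B_1$ the open unit ball; $G^i,f^i$ evaluated at $(t,x,u,v)$, $t\in[0,T]$): $G^i$ is symmetric nonnegative, $\nu^i(\{0\})=0$, $\int\min(1,\|y\|^2)\,\nu^i(dy)<\infty$. Put $\Sigma^i=\operatorname{tr}G^i+\int\|y\|^2\nu^i(dy)$ and $b^i=f^i+\int_{\mathbb R^d\setminus B_1}y\,\nu^i(dy)$. Assume for $i=1,2$ and all $t,s\in[0,T]$, $x,y\in\mathbb R^d$, $u\in U$, $v\in V$: * $G^i,f^i$ are continuous on $[0,T]\times\mathbb R^d\times U\times V$ and $\nu^i$ is weakly continuous (i.e. $\int h\,d\nu^i$ is continuous in $(t,x,u,v)$ for each bounded continuous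 $h$ vanishing near $0$); * $\|b^i(t,x,u,v)-b^i(s,x,u,v)\|^2\le\alpha^i(t-s)$ for some $\alpha^i:\mathbb R\to[0,\infty)$ with $\alpha^i(\delta)\to0$ as $\delta\to0$; * $\int\|y\|^2\,\nu^i(dy)<\infty$, $|\Sigma^i|\le M_0^i$, $\|b^i\|\le M_1^i$, and $\|b^i(t,x,u,v)-b^i(t,y,u,v)\|\le K^i\|x-y\|$; * $g:\mathbb R^d\to\mathbb R$ is Lipschitz with constant $R$; * (Isaacs) for $j=1$ or for $j=2$: $\inf_{u}\sup_{v}\langle\xi,b^j(t,x,u,v)\rangle=\sup_{v}\inf_{u}\langle\xi,b^j(t,x,u,v)\rangle$ for all $t\in[0,T]$, $x,\xi\in\mathbb R^d$. Let $\mathcal D^i\subset C^2(\mathbb R^d)$ contain $C^2_b(\mathbb R^d)$ and all functions $x\mapsto\|x-a\|^2$, $a\in\mathbb R^d$, with $L^i\varphi$ well defined for $\varphi\in\mathcal D^i$. **Strategies, motions, lower value.** Let $\mathbb D_{t_0}=D([t_0,T],\mathbb R^d)$ with $\mathbb F_{t_0,s}=\sigma(x(r):r\in[t_0,s])$. A strategy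 of the first player on $[t_0,T]$ is a filtered space $(\Omega^U,\mathcal F^U,\{\mathcal F^U_s\})$ together with, for each $x(\cdot)\in\mathbb D_{t_0}$, a progressively measurable $U$-valued process $u_{x(\cdot)}$ and a probability $P^U_{x(\cdot)}$ on $\mathcal F^U$ depending measurably on $x(\cdot)$, such that: if $x=y$ on $[t_0,t]$ then $P^U_{x(\cdot)}=P^U_{y(\cdot)}$ on $\mathcal F^U_t$ and $u_{x(\cdot)}(s)=u_{y(\cdot)}(s)$ $P^U_{x(\cdot)}$-a.s. for each $s\in[t_0,t]$; and for each $t$ the map $(x(\cdot),s,\omega)\mapsto u_{x(\cdot)}(s,\omega)$, $s\in[t_0,t]$, is measurable with respect to $\mathbb F_{t_0,t}\otimes\mathcal B([t_0,t])\otimes\mathcal F^U_t$. Strategies $\mathfrak v=(\Omega^V,\mathcal F^V,\{\mathcal F^V_s\},v_{x(\cdot)},P^V_{x(\cdot)})$ of the second player are defined in the same way with values in $V$. A realization of the motion generated by $\mathfrak u,\mathfrak v$ and $(t_0,x_0)$ consists of a filtered space $(\Omega^X,\mathcal F^X,\{\mathcal F^X_s\})$, a probability $P$ on $\Omega=\Omega^X\times\Omega^U\times\Omega^V$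 with filtration $\mathcal F_s=\mathcal F^X_s\otimes\mathcal F^U_s\otimes\mathcal F^V_s$, and an $\{\mathcal F_s\}$-adapted process $X$ on $\Omega$ with paths in $\mathbb D_{t_0}$ such that $X(t_0)=x_0$ a.s.; for every $\varphi\in\mathcal D^1$ the process $\varphi(X(t))-\int_{t_0}^tL^1_\tau[u_{X(\cdot)}(\tau,\omega^U),v_{X(\cdot)}(\tau,\omega^V)]\varphi(X(\tau))\,d\tau$ is an $\{\mathcal F_t\}$-martingale; and the conditional law of $\omega^U$ (respectively $\omega^V$) given the whole path $X(\cdot)$ is $P^U_{X(\cdot)}$ (respectively $P^V_{X(\cdot)}$). Put $$J_*(t_0,x_0,\mathfrak u,\mathfrak v)=\inf\mathbb E\,g(X(T))\ \text{ over all realizations}\quad(\inf\varnothing=+\infty),\qquad \mathrm{Val}_-(t_0,x_0)=\sup_{\mathfrak v}\inf_{\mathfrak u}J_*(t_0,x_0,\mathfrak u,\mathfrak v).$$ **$v$-stability.** A function $c_-:[0,T]\times\mathbb R^d\to\mathbb R$, Borel in $x$, is $v$-stable with respect to $L^2$ if $c_-(T,\cdot)=g$ and for all $0\le t<\theta\le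 T$ there is a filtered space $(\overline\Omega,\overline{\mathcal F},\{\overline{\mathcal F}_s\}_{s\in[t,\theta]})$ and, for all $\xi\in\mathbb R^d$, $u\in U$, a probability $\overline P_{\xi,u}$ on it depending measurably on $(\xi,u)$, a progressively measurable process $\mu_{\xi,u}$ on $[t,\theta]$ with values in the Borel probabilities on $V$, and a progressively measurable $\mathbb R^d$-valued process $Y_{\xi,u}$ such that $Y_{\xi,u}(t)=\xi$ a.s.; for every $\varphi\in\mathcal D^2$ the process $\varphi(Y_{\xi,u}(s))-\int_t^s\int_VL^2_\tau[u,w]\varphi(Y_{\xi,u}(\tau))\,\mu_{\xi,u}(\tau,dw)\,d\tau$ is a martingale under $\overline P_{\xi,u}$ and $(\xi,u,s)\mapsto\overline{\mathbb E}_{\xi,u}\varphi(Y_{\xi,u}(s))$ is measurable; and $c_-(\theta,Y_{\xi,u}(\theta))$ is integrable with $c_-(t,\xi)\le\overline{\mathbb E}_{\xi,u}\,c_-(\theta,Y_{\xi,u}(\theta))$. **Statement.** Let $$\Theta=\sup_{t\in[0,T],x,u,v}\|b^1(t,x,u,v)-b^2(t,x,u,v)\|^2+M_0^1+M_0^2,\qquad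 \beta=2+2K^i,\qquad C=\sqrt{Te^{\beta T}},$$ where $i=1$ if the Isaacs condition holds for $b^1$ and $i=2$ otherwise. If $c_-$ is $v$-stable with respect to $L^2$, then for all $(t_0,x_0)\in[0,T]\times\mathbb R^d$ $$c_-(t_0,x_0)-R\cdot C\sqrt{\Theta}\le\mathrm{Val}_-(t_0,x_0).$$ -/

import Mathlib

open MeasureTheory ProbabilityTheory Set Filter Topology
open scoped NNReal

universe w

noncomputable section

namespace StochGame

/-- The state space `ℝ^d` with its Euclidean structure. -/
abbrev E (d : ℕ) : Type := EuclideanSpace ℝ (Fin d)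

/-! ### Generators of Lévy-Khintchine type -/

/-- Coefficients `G`, `f`, `ν` of a controlled generator of Lévy-Khintchine type,
as functions of time, state and the controls of the two players. -/
structure Generator (d : ℕ) (U V : Type*) where
  G : ℝ → E d → U → V → Matrix (Fin d) (Fin d) ℝ
  f : ℝ → E d → U → V → E d
  ν : ℝ → E d → U → V → Measure (E d)

namespace Generator

variable {d : ℕ} {U V : Type*}

/-- The integrand `φ (x + y) - φ x - ⟨y, ∇φ x⟩ 1_{B_1}(y)` of the jump part. -/
def jumpIntegrand (φ : E d → ℝ) (x y : E d) : ℝ :=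
  φ (x + y) - φ x - (Metric.ball (0 : E d) 1).indicator (fun z => fderiv ℝ φ x z) y

/-- `L_t[u,v] φ (x)`. -/
def apply (L : Generator d U V) (t : ℝ) (u : U) (v : V) (φ : E d → ℝ) (x : E d) : ℝ :=
  (1 / 2) * (∑ i, ∑ j, L.G t x u v i j *
      fderiv ℝ (fderiv ℝ φ) x (EuclideanSpace.single i 1) (EuclideanSpace.single j 1))
    + fderiv ℝ φ x (L.f t x u v)
    + ∫ y, jumpIntegrand φ x y ∂(L.ν t x u v)

/-- `Σ (t,x,u,v) = ∑_j G_jj + ∫ ‖y‖² ν(dy)`. -/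
def Sig (L : Generator d U V) (t : ℝ) (x : E d) (u : U) (v : V) : ℝ :=
  ∑ j, L.G t x u v j j + ∫ y, ‖y‖ ^ 2 ∂(L.ν t x u v)

/-- `b (t,x,u,v) = f + ∫_{ℝ^d ∖ B_1} y ν(dy)`. -/
def b (L : Generator d U V) (t : ℝ) (x : E d) (u : U) (v : V) : E d :=
  L.f t x u v + ∫ y in (Metric.ball (0 : E d) 1)ᶜ, y ∂(L.ν t x u v)

/-- The standing assumptions on one generator on the time interval `[0,T]`, with bounds
`M₀` on `Σ`, `M₁` on `b` and Lipschitz constant `K` of `x ↦ b`. -/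
structure Regular [TopologicalSpace U] [TopologicalSpace V]
    (L : Generator d U V) (T M₀ M₁ : ℝ) (K : ℝ≥0) : Prop where
  posSemidef : ∀ t ∈ Icc 0 T, ∀ x u v, (L.G t x u v).PosSemidef
  ν_zero : ∀ t ∈ Icc 0 T, ∀ x u v, L.ν t x u v {0} = 0
  ν_levy : ∀ t ∈ Icc 0 T, ∀ x u v, Integrable (fun y => min 1 (‖y‖ ^ 2)) (L.ν t x u v)
  continuous_G : ContinuousOn (fun p : ℝ × E d × U × V => L.G p.1 p.2.1 p.2.2.1 p.2.2.2)
    (Icc 0 T ×ˢ univ)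
  continuous_f : ContinuousOn (fun p : ℝ × E d × U × V => L.f p.1 p.2.1 p.2.2.1 p.2.2.2)
    (Icc 0 T ×ˢ univ)
  /-- Weak continuity of the Lévy measures: they are tested against bounded continuous
  functions that vanish near the origin, where the measures may have infinite mass. -/
  continuous_ν : ∀ h : E d → ℝ, Continuous h → (∃ B, ∀ y, |h y| ≤ B) → (∀ᶠ y in 𝓝 0, h y = 0) →
    ContinuousOn (fun p : ℝ × E d × U × V => ∫ y, h y ∂(L.ν p.1 p.2.1 p.2.2.1 p.2.2.2))
      (Icc 0 T ×ˢ univ)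
  time_modulus : ∃ α : ℝ → ℝ, (∀ δ, 0 ≤ α δ) ∧ Tendsto α (𝓝[≠] 0) (𝓝 0) ∧
    ∀ t ∈ Icc 0 T, ∀ s ∈ Icc 0 T, ∀ x u v, ‖L.b t x u v - L.b s x u v‖ ^ 2 ≤ α (t - s)
  secondMoment : ∀ t ∈ Icc 0 T, ∀ x u v, Integrable (fun y => ‖y‖ ^ 2) (L.ν t x u v)
  bound_Sig : ∀ t ∈ Icc 0 T, ∀ x u v, |L.Sig t x u v| ≤ M₀
  bound_b : ∀ t ∈ Icc 0 T, ∀ x u v, ‖L.b t x u v‖ ≤ M₁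
  lipschitz_b : ∀ t ∈ Icc 0 T, ∀ u v, LipschitzWith K (fun x => L.b t x u v)

/-- Isaacs condition for the drift `b`. -/
def Isaacs (L : Generator d U V) (T : ℝ) : Prop :=
  ∀ t ∈ Icc 0 T, ∀ x ξ : E d,
    (⨅ u : U, ⨆ v : V, inner ℝ ξ (L.b t x u v)) = ⨆ v : V, ⨅ u : U, inner ℝ ξ (L.b t x u v)

end Generator

/-- `φ ∈ C_b²`: twice continuously differentiable, bounded together with its derivatives up to
order two. -/
def IsCb2 {d : ℕ} (φ : E d → ℝ) : Prop :=
  ContDiff ℝ 2 φ ∧ ∃ B : ℝ, ∀ x, |φ x| ≤ B ∧ ‖fderiv ℝ φ x‖ ≤ B ∧ ‖fderiv ℝ (fderiv ℝ φ) x‖ ≤ B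

/-- A class `𝒟` of test functions for the generator `L`: it lies in `C²`, contains `C_b²` and all
the functions `x ↦ ‖x - a‖²`, and `L φ` is well defined for its members. -/
structure IsTestClass {d : ℕ} {U V : Type*} (L : Generator d U V) (T : ℝ)
    (D : Set (E d → ℝ)) : Prop where
  contDiff : ∀ φ ∈ D, ContDiff ℝ 2 φ
  cb2_mem : ∀ φ, IsCb2 φ → φ ∈ D
  quadratic_mem : ∀ a : E d, (fun x => ‖x - a‖ ^ 2) ∈ D
  integrable : ∀ φ ∈ D, ∀ t ∈ Icc 0 T, ∀ x u v,
    Integrable (Generator.jumpIntegrand φ x) (L.ν t x u v)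

/-! ### Paths, filtrations, strategies -/

/-- The Skorokhod space `D([a,T], ℝ^d)` of right-continuous functions with left limits. -/
def CadlagPath (d : ℕ) (a T : ℝ) : Type :=
  {x : Icc a T → E d // ∀ t, ContinuousWithinAt x (Ici t) t ∧ ∃ l, Tendsto x (𝓝[<] t) (𝓝 l)}

instance {d : ℕ} {a T : ℝ} : CoeFun (CadlagPath d a T) (fun _ => Icc a T → E d) := ⟨Subtype.val⟩

/-- The `σ`-algebra generated by the evaluations; it is the Borel `σ`-algebra of the Skorokhod
topology. -/
instance CadlagPath.measurableSpace {d : ℕ} {a T : ℝ} : MeasurableSpace (CadlagPath d a T) :=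
  ⨆ r : Icc a T, MeasurableSpace.comap (fun x : CadlagPath d a T => x r) inferInstance

/-- The canonical filtration `s ↦ 𝔽_{a,s}`, generated by the evaluations at times `r ≤ s`. -/
def CadlagPath.filtration (d : ℕ) (a T : ℝ) :
    Filtration (Icc a T) (CadlagPath.measurableSpace (d := d) (a := a) (T := T)) where
  seq s := ⨆ r : Icc a T, ⨆ _ : r ≤ s,
    MeasurableSpace.comap (fun x : CadlagPath d a T => x r) inferInstance
  mono' _ _ hst := iSup_mono fun _ => iSup_le fun hr => le_iSup_of_le (hr.trans hst) le_rfl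
  le' _ := iSup_mono fun _ => iSup_le fun _ => le_rfl

/-- Progressive measurability of a process with values in a measurable space. -/
def IsProgressive {ι Ω β : Type*} [Preorder ι] [MeasurableSpace ι] [MeasurableSpace β]
    {m : MeasurableSpace Ω} (ℱ : Filtration ι m) (X : ι → Ω → β) : Prop :=
  ∀ s : ι, Measurable[MeasurableSpace.prod (inferInstance : MeasurableSpace (Iic s)) (ℱ s)]
    (fun p : Iic s × Ω => X p.1 p.2)

/-- A (randomized, with memory) strategy on `[a,T]` with controls in `A`. -/
structure Strategy (d : ℕ) (a T : ℝ) (A : Type*) [MeasurableSpace A] where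
  Ω : Type w
  [mΩ : MeasurableSpace Ω]
  ℱ : Filtration (Icc a T) mΩ
  control : CadlagPath d a T → Icc a T → Ω → A
  P : Kernel (CadlagPath d a T) Ω
  [isMarkov : IsMarkovKernel P]
  progressive : ∀ x, IsProgressive ℱ (control x)
  prob_nonanticipative : ∀ (t : Icc a T) (x y : CadlagPath d a T), (∀ s ≤ t, y s = x s) →
    ∀ B, MeasurableSet[ℱ t] B → P x B = P y B
  control_nonanticipative : ∀ (t : Icc a T) (x y : CadlagPath d a T), (∀ s ≤ t, y s = x s) →
    ∀ s ≤ t, ∀ᵐ ω ∂(P x), control x s ω = control y s ω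
  measurable_control : ∀ t : Icc a T,
    Measurable[MeasurableSpace.prod (CadlagPath.filtration d a T t)
        (MeasurableSpace.prod (inferInstance : MeasurableSpace (Iic t)) (ℱ t))]
      (fun q : CadlagPath d a T × Iic t × Ω => control q.1 q.2.1 q.2.2)

attribute [instance] Strategy.mΩ Strategy.isMarkov

/-- The filtration `s ↦ ℱ₁ s ⊗ ℱ₂ s ⊗ ℱ₃ s` on a product of three filtered spaces. -/
def prodFiltration {ι Ω₁ Ω₂ Ω₃ : Type*} [Preorder ι] {m₁ : MeasurableSpace Ω₁}
    {m₂ : MeasurableSpace Ω₂} {m₃ : MeasurableSpace Ω₃}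
    (ℱ₁ : Filtration ι m₁) (ℱ₂ : Filtration ι m₂) (ℱ₃ : Filtration ι m₃) :
    Filtration ι (m₁.prod (m₂.prod m₃)) where
  seq s := (ℱ₁ s).prod ((ℱ₂ s).prod (ℱ₃ s))
  mono' _ _ h := sup_le_sup (MeasurableSpace.comap_mono (ℱ₁.mono h))
    (MeasurableSpace.comap_mono (sup_le_sup (MeasurableSpace.comap_mono (ℱ₂.mono h))
      (MeasurableSpace.comap_mono (ℱ₃.mono h))))
  le' s := sup_le_sup (MeasurableSpace.comap_mono (ℱ₁.le s))
    (MeasurableSpace.comap_mono (sup_le_sup (MeasurableSpace.comap_mono (ℱ₂.le s))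
      (MeasurableSpace.comap_mono (ℱ₃.le s))))

/-- Lebesgue measure on the time interval `[a,T]`. -/
def timeMeasure (a T : ℝ) : Measure (Icc a T) := (volume : Measure ℝ).comap Subtype.val

/-- The process `φ(X(s)) - ∫_a^s A_τ dτ`, `s ∈ [a,T]`, is well defined and a martingale. -/
def IsDynkinMartingale {d : ℕ} {a T : ℝ} {Ω : Type*} {m : MeasurableSpace Ω}
    (ℱ : Filtration (Icc a T) m) (P : Measure Ω) (φ : E d → ℝ)
    (X : Icc a T → Ω → E d) (A : Icc a T → Ω → ℝ) : Prop :=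
  (∀ᵐ ω ∂P, Integrable (fun τ => A τ ω) (timeMeasure a T)) ∧
    Martingale (fun s ω => φ (X s ω) - ∫ τ in Iic s, A τ ω ∂(timeMeasure a T)) ℱ P

section Motion

variable {d : ℕ} {U V : Type*} [MeasurableSpace U] [MeasurableSpace V]

/-- A realization of the motion generated by the strategies `𝔲`, `𝔳` and the initial position
`(t₀,x₀)` in the game with generator `L` and test functions `D`. -/
structure Realization (L : Generator d U V) (D : Set (E d → ℝ)) {t₀ T : ℝ} (ht₀ : t₀ ≤ T)
    (x₀ : E d) (𝔲 : Strategy.{w} d t₀ T U) (𝔳 : Strategy.{w} d t₀ T V) where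
  Ω : Type w
  [mΩ : MeasurableSpace Ω]
  ℱ : Filtration (Icc t₀ T) mΩ
  P : Measure (Ω × 𝔲.Ω × 𝔳.Ω)
  [isProb : IsProbabilityMeasure P]
  X : Ω × 𝔲.Ω × 𝔳.Ω → CadlagPath d t₀ T
  adapted : ∀ s, Measurable[prodFiltration ℱ 𝔲.ℱ 𝔳.ℱ s] (fun ω => X ω s)
  initial : ∀ᵐ ω ∂P, X ω ⟨t₀, left_mem_Icc.2 ht₀⟩ = x₀
  dynkin : ∀ φ ∈ D, IsDynkinMartingale (prodFiltration ℱ 𝔲.ℱ 𝔳.ℱ) P φ (fun s ω => X ω s)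
    (fun τ ω => L.apply τ (𝔲.control (X ω) τ ω.2.1) (𝔳.control (X ω) τ ω.2.2) φ (X ω τ))
  /-- The conditional law of `ω^U` given the path `X(·)` is `P^U_{X(·)}`. -/
  cond_u : ∀ ζ : 𝔲.Ω → ℝ, Measurable ζ → (∃ B, ∀ z, |ζ z| ≤ B) →
    P[fun ω => ζ ω.2.1 | MeasurableSpace.comap X inferInstance]
      =ᵐ[P] fun ω => ∫ z, ζ z ∂(𝔲.P (X ω))
  /-- The conditional law of `ω^V` given the path `X(·)` is `P^V_{X(·)}`. -/
  cond_v : ∀ ζ : 𝔳.Ω → ℝ, Measurable ζ → (∃ B, ∀ z, |ζ z| ≤ B) →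
    P[fun ω => ζ ω.2.2 | MeasurableSpace.comap X inferInstance]
      =ᵐ[P] fun ω => ∫ z, ζ z ∂(𝔳.P (X ω))

/-- The payoff `𝔼 g(X(T))` of a realization. -/
def Realization.payoff {L : Generator d U V} {D : Set (E d → ℝ)} {t₀ T : ℝ} {ht₀ : t₀ ≤ T}
    {x₀ : E d} {𝔲 : Strategy.{w} d t₀ T U} {𝔳 : Strategy.{w} d t₀ T V}
    (ρ : Realization L D ht₀ x₀ 𝔲 𝔳) (g : E d → ℝ) : ℝ :=
  letI := ρ.mΩ
  ∫ ω, g (ρ.X ω ⟨T, right_mem_Icc.2 ht₀⟩) ∂ρ.P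

/-- The lower outcome `J_*(t₀,x₀,𝔲,𝔳)`, the infimum over all realizations. -/
def lowerOutcome (L : Generator d U V) (D : Set (E d → ℝ)) (g : E d → ℝ) {t₀ T : ℝ}
    (ht₀ : t₀ ≤ T) (x₀ : E d) (𝔲 : Strategy.{w} d t₀ T U) (𝔳 : Strategy.{w} d t₀ T V) : EReal :=
  ⨅ ρ : Realization L D ht₀ x₀ 𝔲 𝔳, ((ρ.payoff g : ℝ) : EReal)

/-- The lower value `Val_-(t₀,x₀) = sup_𝔳 inf_𝔲 J_*(t₀,x₀,𝔲,𝔳)`. -/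
def lowerValue (L : Generator d U V) (D : Set (E d → ℝ)) (g : E d → ℝ) {t₀ T : ℝ}
    (ht₀ : t₀ ≤ T) (x₀ : E d) : EReal :=
  ⨆ 𝔳 : Strategy.{w} d t₀ T V, ⨅ 𝔲 : Strategy.{w} d t₀ T U, lowerOutcome L D g ht₀ x₀ 𝔲 𝔳

/-- The data and properties required of a `v`-stable function `c` between the times `t < θ`:
a filtered space, and for every `ξ`, `u` a probability `P (ξ,u)` (measurable in `(ξ,u)`), a
generalized control `μ ξ u` of the second player and a process `Y ξ u`. -/
structure VStableOn (L : Generator d U V) (D : Set (E d → ℝ)) (c : ℝ → E d → ℝ)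
    (t θ : ℝ) (htθ : t ≤ θ) where
  Ω : Type w
  [mΩ : MeasurableSpace Ω]
  ℱ : Filtration (Icc t θ) mΩ
  P : Kernel (E d × U) Ω
  [isMarkov : IsMarkovKernel P]
  μ : E d → U → Icc t θ → Ω → Measure V
  Y : E d → U → Icc t θ → Ω → E d
  μ_prob : ∀ ξ u τ ω, IsProbabilityMeasure (μ ξ u τ ω)
  μ_progressive : ∀ ξ u, IsProgressive ℱ (μ ξ u)
  Y_progressive : ∀ ξ u, IsProgressive ℱ (Y ξ u)
  initial : ∀ ξ u, ∀ᵐ ω ∂(P (ξ, u)), Y ξ u ⟨t, left_mem_Icc.2 htθ⟩ ω = ξ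
  integrable_control : ∀ φ ∈ D, ∀ ξ u, ∀ᵐ ω ∂(P (ξ, u)), ∀ᵐ τ : Icc t θ ∂(timeMeasure t θ),
    Integrable (fun z => L.apply τ u z φ (Y ξ u τ ω)) (μ ξ u τ ω)
  dynkin : ∀ φ ∈ D, ∀ ξ u, IsDynkinMartingale ℱ (P (ξ, u)) φ (Y ξ u)
    (fun τ ω => ∫ z, L.apply τ u z φ (Y ξ u τ ω) ∂(μ ξ u τ ω))
  integrable : ∀ ξ u, Integrable (fun ω => c θ (Y ξ u ⟨θ, right_mem_Icc.2 htθ⟩ ω)) (P (ξ, u))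
  le_expectation : ∀ ξ u,
    c t ξ ≤ ∫ ω, c θ (Y ξ u ⟨θ, right_mem_Icc.2 htθ⟩ ω) ∂(P (ξ, u))
  measurable_expectation : ∀ φ ∈ D,
    Measurable (fun q : E d × U × Icc t θ => ∫ ω, φ (Y q.1 q.2.1 q.2.2 ω) ∂(P (q.1, q.2.1)))

/-- `c : [0,T] × ℝ^d → ℝ` (Borel in the state) is `v`-stable with respect to `L`, for the
terminal payoff `g` and the class `D` of test functions. -/
structure VStable (L : Generator d U V) (D : Set (E d → ℝ)) (g : E d → ℝ) (T : ℝ)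
    (c : ℝ → E d → ℝ) : Prop where
  measurable : ∀ t ∈ Icc 0 T, Measurable (c t)
  terminal : ∀ x, c T x = g x
  step : ∀ t θ : ℝ, 0 ≤ t → θ ≤ T → ∀ htθ : t < θ, Nonempty (VStableOn.{w} L D c t θ htθ.le)

end Motion

/-! ### The constants of the estimate -/

section Constants

variable {d : ℕ} {U V : Type*}

/-- `ϰ = sup ‖b¹ - b²‖²` over `[0,T] × ℝ^d × U × V`. -/
def kappa (L₁ L₂ : Generator d U V) (T : ℝ) : ℝ :=
  sSup {r | ∃ t ∈ Icc 0 T, ∃ x u v, r = ‖L₁.b t x u v - L₂.b t x u v‖ ^ 2}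

/-- `Θ = ϰ + M₀¹ + M₀²`. -/
def Theta (L₁ L₂ : Generator d U V) (T M₀₁ M₀₂ : ℝ) : ℝ := kappa L₁ L₂ T + M₀₁ + M₀₂

open Classical in
/-- `β = 2 + 2 Kⁱ`, with `i = 1` if the Isaacs condition holds for `b¹` and `i = 2` otherwise. -/
def betaConst (L₁ : Generator d U V) (T : ℝ) (K₁ K₂ : ℝ≥0) : ℝ :=
  2 + 2 * (if L₁.Isaacs T then (K₁ : ℝ) else (K₂ : ℝ))

/-- `C = √(T e^{βT})`. -/
def CConst (L₁ : Generator d U V) (T : ℝ) (K₁ K₂ : ℝ≥0) : ℝ :=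
  √(T * Real.exp (betaConst L₁ T K₁ K₂ * T))

end Constants

end StochGame

end

open StochGame

/-! ### The generator on squared distances -/

namespace StochGame

variable {d : ℕ}

/-! The second player steers by a stochastic guide (extremal shift). The guide is a Markov chain on
a fine time grid. Its one-step kernel `Q` is the law of the process supplied by `v`-stability
(`VStableOn.stepKernel`), so the expectation of `c` along the guide does not decrease: `c t₀ x₀` is
at most the mean of `g` at the final guide position (`GuideData.le_integral_terminal`). Since `g` is
Lipschitz, it remains to keep the motion `X` close to the guide `Y` in mean square.

At a grid time, with `X` at `x` and `Y` at `y`, an approximate saddle point `(u*, v*)` of `⟨x - y,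
b⟩` is chosen, for the drift satisfying the Isaacs condition. The player applies `v*` to the motion
until the next grid time and feeds `u*` to the guide. Whatever the opponent and the relaxed control
inside the guide do, `⟨x - y, b¹ - b²⟩` is at most `K ‖x - y‖² + ‖x - y‖ √ϰ` up to small errors
(`exists_extremal_shift`).

On `‖x - a‖²` the generator equals `Σ + 2⟨x - a, b⟩`, so the squared distance gains at most `M₀¹ +
M₀²` per unit time from the noise and twice the above from the drift. The cross term of the two
increments is of smaller order than the step: given the whole path of `X`, the guide's step has law
`Q`, whose mean is of the order of the step. With `2‖x - y‖√ϰ ≤ ‖x - y‖² + ϰ` this yields the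
recursion `e_{k+1} ≤ (1 + βδ) e_k + (Θ + ε) δ` (`meanSqDist_succ_le`). The second unit in `β = 2 +
2K` absorbs the discretization errors. A discrete Gronwall argument gives mean-square distance at
most `T e^{βT} (Θ + ε)` at time `T` (`meanSqDist_le`), uniformly over opponents and realizations.
Finally `ε → 0`.

The analytic input on both processes is extracted once, from squared distances alone, in
`DriftProcess`: coordinates arise by polarization. -/

theorem fderiv_normSq_sub (a x : E d) :
    fderiv ℝ (fun x : E d => ‖x - a‖ ^ 2) x = (2 : ℝ) • innerSL ℝ (x - a) := by
  have h : HasFDerivAt (fun x : E d => ‖x - a‖ ^ 2) _ x :=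
    ((hasFDerivAt_id x).sub_const a).norm_sq
  rw [h.fderiv]
  ext v
  simp

theorem fderiv_fderiv_normSq_sub (a x v w : E d) :
    fderiv ℝ (fderiv ℝ (fun x : E d => ‖x - a‖ ^ 2)) x v w = 2 * inner ℝ v w := by
  have h0 : fderiv ℝ (fun x : E d => ‖x - a‖ ^ 2) = fun x => (2 : ℝ) • innerSL ℝ (x - a) :=
    funext fun x => fderiv_normSq_sub a x
  have h : HasFDerivAt (fun x : E d => (2 : ℝ) • innerSL ℝ (x - a))
      ((2 : ℝ) • (innerSL ℝ (E := E d)).comp (ContinuousLinearMap.id ℝ (E d))) x :=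
    ((innerSL ℝ (E := E d)).hasFDerivAt.comp x ((hasFDerivAt_id x).sub_const a)).const_smul (2 : ℝ)
  rw [h0, h.fderiv]
  simp only [ContinuousLinearMap.comp_id, smul_apply, smul_eq_mul]
  rfl

/-- The compensator removes the linear term only inside the unit ball. What survives outside is the
large-jump mean that turns `f` into `b`. -/
theorem jumpIntegrand_normSq_sub (a x y : E d) :
    Generator.jumpIntegrand (fun x : E d => ‖x - a‖ ^ 2) x y =
      ‖y‖ ^ 2 + 2 * inner ℝ (x - a) ((Metric.ball (0 : E d) 1)ᶜ.indicator (fun z => z) y) := by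
  have hs : ‖x + y - a‖ ^ 2 = ‖x - a‖ ^ 2 + 2 * inner ℝ (x - a) y + ‖y‖ ^ 2 := by
    rw [← norm_add_sq_real]; congr 2; abel
  unfold Generator.jumpIntegrand
  by_cases hy : y ∈ Metric.ball (0 : E d) 1
  · rw [indicator_of_mem hy, indicator_of_notMem (by simpa using hy), fderiv_normSq_sub]
    simp only [hs]
    simp [inner_sub_left]
    ring
  · rw [indicator_of_notMem hy, indicator_of_mem (by simpa using hy)]
    simp only [hs]
    ring

/-- Outside the unit ball `‖y‖ ≤ ‖y‖²`. -/
theorem integrable_indicator_compl_ball {ν : Measure (E d)}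
    (h : Integrable (fun y => ‖y‖ ^ 2) ν) :
    Integrable ((Metric.ball (0 : E d) 1)ᶜ.indicator (fun z : E d => z)) ν := by
  refine h.mono ?_ (ae_of_all _ fun y => ?_)
  · exact (measurable_id.indicator Metric.isOpen_ball.measurableSet.compl).aestronglyMeasurable
  · by_cases hy : y ∈ Metric.ball (0 : E d) 1
    · rw [indicator_of_notMem (by simpa using hy)]
      simp
    · rw [indicator_of_mem (by simpa using hy)]
      have : 1 ≤ ‖y‖ := by simpa using hy
      rw [norm_pow, norm_norm]
      nlinarith

/-- The value of a Lévy-Khintchine generator at the functions `x ↦ ‖x - a‖²`. -/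
theorem Generator.apply_normSq_sub {U V : Type*} (L : Generator d U V) {t : ℝ} {x : E d} {u : U}
    {v : V} (h : Integrable (fun y => ‖y‖ ^ 2) (L.ν t x u v)) (a : E d) :
    L.apply t u v (fun x => ‖x - a‖ ^ 2) x
      = L.Sig t x u v + 2 * inner ℝ (x - a) (L.b t x u v) := by
  have hi := integrable_indicator_compl_ball h
  have hj : ∫ y, jumpIntegrand (fun x : E d => ‖x - a‖ ^ 2) x y ∂(L.ν t x u v)
      = ∫ y, ‖y‖ ^ 2 ∂(L.ν t x u v)
        + 2 * inner ℝ (x - a) (∫ y in (Metric.ball (0 : E d) 1)ᶜ, y ∂(L.ν t x u v)) := by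
    simp_rw [jumpIntegrand_normSq_sub]
    rw [integral_add h ((hi.const_inner (x - a)).const_mul 2), integral_const_mul,
      integral_inner hi, integral_indicator Metric.isOpen_ball.measurableSet.compl]
  unfold Generator.apply Generator.Sig Generator.b
  rw [hj, fderiv_normSq_sub, inner_add_right]
  -- The Hessian is twice the identity, so the second-order part reduces to the trace of `G`.
  have hG : ∀ i j, L.G t x u v i j * fderiv ℝ (fderiv ℝ (fun x : E d => ‖x - a‖ ^ 2)) x
      (EuclideanSpace.single i 1) (EuclideanSpace.single j 1)
      = if i = j then 2 * L.G t x u v i j else 0 := by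
    intro i j
    rw [fderiv_fderiv_normSq_sub]
    by_cases hij : i = j
    · subst hij; simp; ring
    · simp [hij, EuclideanSpace.inner_single_left]
  simp_rw [hG]
  simp [← Finset.mul_sum, inner_sub_left]
  ring

end StochGame

/-! ### Processes with bounded rate and drift: moments -/

namespace StochGame

section TimeMeasure

variable {a T : ℝ}

theorem timeMeasure_Ioc (r s : Icc a T) :
    timeMeasure a T (Ioc r s) = ENNReal.ofReal (s - r) := by
  unfold timeMeasure
  rw [(MeasurableEmbedding.subtype_coe measurableSet_Icc).comap_apply]
  have : (Subtype.val '' Ioc r s : Set ℝ) = Ioc (r : ℝ) s := by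
    ext x
    constructor
    · rintro ⟨y, hy, rfl⟩
      exact ⟨hy.1, hy.2⟩
    · intro hx
      exact ⟨⟨x, r.2.1.trans hx.1.le, hx.2.trans s.2.2⟩, ⟨hx.1, hx.2⟩, rfl⟩
  rw [this, Real.volume_Ioc]

theorem timeMeasure_univ : timeMeasure a T univ = ENNReal.ofReal (T - a) := by
  unfold timeMeasure
  rw [(MeasurableEmbedding.subtype_coe measurableSet_Icc).comap_apply, image_univ,
    Subtype.range_coe, Real.volume_Icc]

instance : IsFiniteMeasure (timeMeasure a T) := ⟨by rw [timeMeasure_univ]; simp⟩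

theorem timeMeasure_real_Ioc {r s : Icc a T} (h : r ≤ s) :
    (timeMeasure a T).real (Ioc r s) = s - r := by
  rw [measureReal_def, timeMeasure_Ioc, ENNReal.toReal_ofReal (sub_nonneg.2 h)]

theorem setIntegral_Iic_sub_Iic {F : Type*} [NormedAddCommGroup F] [NormedSpace ℝ F]
    {f : Icc a T → F} (hf : Integrable f (timeMeasure a T)) {r s : Icc a T} (h : r ≤ s) :
    ∫ τ in Iic s, f τ ∂(timeMeasure a T) - ∫ τ in Iic r, f τ ∂(timeMeasure a T)
      = ∫ τ in Ioc r s, f τ ∂(timeMeasure a T) := by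
  rw [← Iic_union_Ioc_eq_Iic h, setIntegral_union (Iic_disjoint_Ioc le_rfl) measurableSet_Ioc
    hf.integrableOn hf.integrableOn]
  abel

theorem integrable_prod_of_integral_abs_le {Ω : Type*} {m : MeasurableSpace Ω} {P : Measure Ω}
    [IsProbabilityMeasure P] {F : Icc a T → Ω → ℝ} {I : Set (Icc a T)} {C : ℝ}
    (hI : MeasurableSet I)
    (hF : Measurable (fun p : Icc a T × Ω => F p.1 p.2)) (hi : ∀ τ ∈ I, Integrable (F τ) P)
    (hC : ∀ τ ∈ I, ∫ ω, |F τ ω| ∂P ≤ C) :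
    Integrable (fun p : Icc a T × Ω => F p.1 p.2) (((timeMeasure a T).restrict I).prod P) := by
  rw [integrable_prod_iff hF.aestronglyMeasurable]
  refine ⟨(ae_restrict_iff' hI).2 (ae_of_all _ hi), ?_⟩
  refine Integrable.of_bound (C := C) ?_ ((ae_restrict_iff' hI).2 (ae_of_all _ fun τ hτ => ?_))
  · exact hF.norm.stronglyMeasurable.integral_prod_right.aestronglyMeasurable
  · rw [Real.norm_of_nonneg (integral_nonneg fun _ => norm_nonneg _)]
    exact hC τ hτ

theorem integral_setIntegral_Ioc_le {Ω : Type*} {m : MeasurableSpace Ω} {P : Measure Ω}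
    [IsProbabilityMeasure P] {F : Icc a T → Ω → ℝ} {r s : Icc a T} {C : ℝ} (hrs : r ≤ s)
    (hF : Measurable (fun p : Icc a T × Ω => F p.1 p.2))
    (hi : ∀ τ ∈ Ioc r s, Integrable (F τ) P)
    (hC : ∀ τ ∈ Ioc r s, ∫ ω, |F τ ω| ∂P ≤ C) :
    ∫ ω, (∫ τ in Ioc r s, F τ ω ∂(timeMeasure a T)) ∂P ≤ (s - r) * C := by
  have hint := integrable_prod_of_integral_abs_le measurableSet_Ioc hF hi hC
  rw [← integral_integral_swap hint, ← timeMeasure_real_Ioc hrs, mul_comm]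
  refine (le_abs_self _).trans ?_
  have := norm_setIntegral_le_of_norm_le_const (μ := timeMeasure a T) (s := Ioc r s)
    (f := fun τ => ∫ ω, F τ ω ∂P) (C := C) (measure_lt_top _ _) (fun τ hτ =>
      (norm_integral_le_integral_norm _).trans (hC τ hτ))
  simpa using this

end TimeMeasure

variable {d : ℕ}

theorem norm_le_sum_abs_coord (x : E d) : ‖x‖ ≤ ∑ i, |x i| := by
  rw [EuclideanSpace.norm_eq]
  refine Real.sqrt_le_iff.2 ⟨Finset.sum_nonneg fun _ _ => abs_nonneg _, ?_⟩
  simp only [Real.norm_eq_abs]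
  exact Finset.sum_sq_le_sq_sum_of_nonneg fun _ _ => abs_nonneg _

theorem integrable_of_coord {α : Type*} {m : MeasurableSpace α} {μ : Measure α} {f : α → E d}
    (h : ∀ i, Integrable (fun x => f x i) μ) : Integrable f μ := by
  have : f = fun x => ∑ i, (f x i) • EuclideanSpace.basisFun (Fin d) ℝ i := by
    ext1 x
    exact ((EuclideanSpace.basisFun (Fin d) ℝ).sum_repr (f x)).symm
  rw [this]
  exact integrable_finsetSum _ fun i _ => (h i).smul_const _

/-- A process `Z` whose squared distances to points have compensators with a bounded
rate `S` and a bounded drift `B`. -/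
structure DriftProcess {a T : ℝ} {Ω : Type*} {m : MeasurableSpace Ω}
    (ℱ : Filtration (Icc a T) m) (P : Measure Ω) (M₀ M₁ : ℝ) (Z : Icc a T → Ω → E d)
    (S : Icc a T → Ω → ℝ) (B : Icc a T → Ω → E d) : Prop where
  measurable_uncurry : Measurable (fun p : Icc a T × Ω => Z p.1 p.2)
  adapted : ∀ s, Measurable[ℱ s] (Z s)
  abs_rate_le : ∀ τ ω, |S τ ω| ≤ M₀
  norm_drift_le : ∀ τ ω, ‖B τ ω‖ ≤ M₁
  dynkin : ∀ c : E d, ∃ A, IsDynkinMartingale ℱ P (fun x => ‖x - c‖ ^ 2) Z A ∧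
    ∀ᵐ ω ∂P, ∀ᵐ τ ∂(timeMeasure a T), A τ ω = S τ ω + 2 * inner ℝ (Z τ ω - c) (B τ ω)

namespace DriftProcess

variable {a T : ℝ} {Ω : Type*} {m : MeasurableSpace Ω}
  {ℱ : Filtration (Icc a T) m} {P : Measure Ω} {M₀ M₁ : ℝ}
  {Z : Icc a T → Ω → E d} {S : Icc a T → Ω → ℝ} {B : Icc a T → Ω → E d}

theorem measurable (h : DriftProcess ℱ P M₀ M₁ Z S B) (s : Icc a T) : Measurable (Z s) :=
  (h.adapted s).mono (ℱ.le s) le_rfl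

/-- Polarization: half the difference of the squared distances to `0` and to `e` is `⟨e, x⟩ -
‖e‖²/2`, and the rates `S` cancel. No linear test function is needed. -/
theorem exists_coord_martingale (h : DriftProcess ℱ P M₀ M₁ Z S B) (e : E d) :
    (∀ᵐ ω ∂P, Integrable (fun τ => inner ℝ e (B τ ω)) (timeMeasure a T)) ∧
    ∃ N : Icc a T → Ω → ℝ, Martingale N ℱ P ∧ ∀ s, N s =ᵐ[P] fun ω =>
      inner ℝ e (Z s ω) - ‖e‖ ^ 2 / 2 - ∫ τ in Iic s, inner ℝ e (B τ ω) ∂(timeMeasure a T) := by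
  obtain ⟨A, ⟨hA, hM⟩, hAe⟩ := h.dynkin 0
  obtain ⟨A', ⟨hA', hM'⟩, hAe'⟩ := h.dynkin e
  have key : ∀ᵐ ω ∂P, (fun τ => inner ℝ e (B τ ω)) =ᵐ[timeMeasure a T]
      fun τ => (2⁻¹ : ℝ) * (A τ ω - A' τ ω) := by
    filter_upwards [hAe, hAe'] with ω h1 h2
    filter_upwards [h1, h2] with τ h1 h2
    rw [h1, h2, sub_zero, inner_sub_left]
    ring
  refine ⟨?_, (2⁻¹ : ℝ) • (fun s => _ - _), (hM.sub hM').smul 2⁻¹, fun s => ?_⟩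
  · filter_upwards [key, hA, hA'] with ω h1 h2 h3
    exact ((h2.sub h3).const_mul _).congr h1.symm
  · filter_upwards [key, hA, hA'] with ω h1 h2 h3
    rw [integral_congr_ae (ae_restrict_of_ae h1), integral_const_mul,
      integral_sub h2.integrableOn h3.integrableOn]
    have h4 : ‖Z s ω - e‖ ^ 2 = ‖Z s ω‖ ^ 2 - 2 * inner ℝ e (Z s ω) + ‖e‖ ^ 2 := by
      rw [norm_sub_sq_real, real_inner_comm]
    simp only [Pi.smul_apply, Pi.sub_apply, sub_zero, h4, smul_eq_mul]
    ring

theorem norm_setIntegral_drift_le (h : DriftProcess ℱ P M₀ M₁ Z S B) (I : Set (Icc a T)) (ω : Ω) :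
    ‖∫ τ in I, B τ ω ∂(timeMeasure a T)‖ ≤ M₁ * (timeMeasure a T).real I :=
  norm_setIntegral_le_of_norm_le_const (measure_lt_top _ _) fun τ _ => h.norm_drift_le τ ω

/-- `DriftProcess` does not ask for measurability of `B` in time. It is read off from the
compensators, coordinate by coordinate. -/
theorem ae_integrable_drift (h : DriftProcess ℱ P M₀ M₁ Z S B) :
    ∀ᵐ ω ∂P, Integrable (fun τ => B τ ω) (timeMeasure a T) := by
  have := fun i => (h.exists_coord_martingale (EuclideanSpace.single i 1)).1
  filter_upwards [ae_all_iff.2 this] with ω hω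
  refine integrable_of_coord fun i => ?_
  simpa [EuclideanSpace.inner_single_left] using hω i

theorem exists_martingale_coord (h : DriftProcess ℱ P M₀ M₁ Z S B) (i : Fin d) :
    ∃ N : Icc a T → Ω → ℝ, Martingale N ℱ P ∧ ∀ s, N s =ᵐ[P] fun ω =>
      Z s ω i - 1 / 2 - (∫ τ in Iic s, B τ ω ∂(timeMeasure a T)) i := by
  obtain ⟨-, N, hN, hNe⟩ := h.exists_coord_martingale (EuclideanSpace.single i 1)
  refine ⟨N, hN, fun s => ?_⟩
  filter_upwards [hNe s, h.ae_integrable_drift] with ω h1 h2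
  rw [h1, integral_inner h2.integrableOn]
  simp [EuclideanSpace.inner_single_left]

/-- Conditional expectation contracts the `L¹` norm. Taking `s = T` makes integrability at the final
time a bound uniform in time. -/
theorem _root_.MeasureTheory.Martingale.integral_abs_le {N : Icc a T → Ω → ℝ}
    (hN : Martingale N ℱ P) {r s : Icc a T} (hrs : r ≤ s) :
    ∫ ω, |N r ω| ∂P ≤ ∫ ω, |N s ω| ∂P := by
  have h1 : ∫ ω, |N r ω| ∂P = ∫ ω, |(P[N s | ℱ r]) ω| ∂P :=
    integral_congr_ae ((hN.2 r s hrs).symm.fun_comp (fun x => |x|))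
  rw [h1]
  exact integral_abs_condExp_le _

variable [IsProbabilityMeasure P]

theorem drift_nonneg (h : DriftProcess ℱ P M₀ M₁ Z S B) (r : Icc a T) : 0 ≤ M₁ := by
  have := P.nonempty_of_neZero
  exact (norm_nonneg _).trans (h.norm_drift_le r (Classical.arbitrary Ω))

theorem rate_nonneg (h : DriftProcess ℱ P M₀ M₁ Z S B) (r : Icc a T) : 0 ≤ M₀ := by
  have := P.nonempty_of_neZero
  exact (abs_nonneg _).trans (h.abs_rate_le r (Classical.arbitrary Ω))

/-- Each coordinate is a martingale plus a bounded drift integral plus the polarization constant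
`1/2`. The uniform bound comes from the martingales at the final time. -/
theorem integrable_norm (h : DriftProcess ℱ P M₀ M₁ Z S B) :
    ∃ C, ∀ s, Integrable (fun ω => ‖Z s ω‖) P ∧ ∫ ω, ‖Z s ω‖ ∂P ≤ C := by
  choose N hN hNe using fun i => h.exists_martingale_coord i
  by_cases haT : a ≤ T
  swap
  · exact ⟨0, fun s => (haT (s.2.1.trans s.2.2)).elim⟩
  set top : Icc a T := ⟨T, right_mem_Icc.2 haT⟩
  set c : ℝ := 1 / 2 + M₁ * (timeMeasure a T).real univ
  have hM₁ := h.drift_nonneg top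
  have hle : ∀ s, ∀ᵐ ω ∂P, ‖Z s ω‖ ≤ ∑ i, (|N i s ω| + c) := by
    intro s
    filter_upwards [ae_all_iff.2 fun i => hNe i s] with ω hω
    refine (norm_le_sum_abs_coord _).trans (Finset.sum_le_sum fun i _ => ?_)
    have h1 : Z s ω i = N i s ω + (1 / 2 + (∫ τ in Iic s, B τ ω ∂(timeMeasure a T)) i) := by
      rw [hω i]; ring
    have h2 : |(∫ τ in Iic s, B τ ω ∂(timeMeasure a T)) i|
        ≤ M₁ * (timeMeasure a T).real univ := by
      refine (PiLp.norm_apply_le _ i).trans ((h.norm_setIntegral_drift_le _ ω).trans ?_)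
      exact mul_le_mul_of_nonneg_left (measureReal_mono (subset_univ _)) hM₁
    rw [h1]
    refine (abs_add_le _ _).trans (add_le_add_right ((abs_add_le _ _).trans ?_) _)
    rw [abs_of_nonneg (by norm_num : (0 : ℝ) ≤ 1 / 2)]
    exact add_le_add_right h2 _
  have hint : ∀ s, Integrable (fun ω => ∑ i, (|N i s ω| + c)) P := fun s =>
    integrable_finsetSum _ fun i _ => ((hN i).integrable s).abs.add (integrable_const _)
  refine ⟨∑ i, (∫ ω, |N i top ω| ∂P + c), fun s => ⟨?_, ?_⟩⟩
  · refine (hint s).mono (h.measurable s).norm.aestronglyMeasurable ?_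
    filter_upwards [hle s] with ω hω
    rw [norm_norm]
    exact hω.trans (le_abs_self _)
  · refine (integral_mono_of_nonneg (ae_of_all _ fun _ => norm_nonneg _) (hint s)
      (hle s)).trans ?_
    have hci : ∀ i, Integrable (fun ω => |N i s ω| + c) P :=
      fun i => ((hN i).integrable s).abs.add (integrable_const _)
    rw [integral_finsetSum _ fun i _ => hci i]
    refine Finset.sum_le_sum fun i _ => ?_
    rw [integral_add ((hN i).integrable s).abs (integrable_const _)]
    simpa using (hN i).integral_abs_le (s := top) s.2.2

theorem integrable_prod_norm (h : DriftProcess ℱ P M₀ M₁ Z S B) :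
    Integrable (fun p : Icc a T × Ω => ‖Z p.1 p.2‖) ((timeMeasure a T).prod P) := by
  obtain ⟨C, hC⟩ := h.integrable_norm
  have := integrable_prod_of_integral_abs_le (P := P) (F := fun τ ω => ‖Z τ ω‖) (C := C)
    MeasurableSet.univ h.measurable_uncurry.norm (fun τ _ => (hC τ).1)
    (fun τ _ => by simpa using (hC τ).2)
  simpa using this

theorem ae_integrable_path (h : DriftProcess ℱ P M₀ M₁ Z S B) :
    ∀ᵐ ω ∂P, Integrable (fun τ => Z τ ω) (timeMeasure a T) := by
  filter_upwards [h.integrable_prod_norm.prod_left_ae] with ω hω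
  rwa [integrable_norm_iff] at hω
  exact (h.measurable_uncurry.comp measurable_prodMk_right).aestronglyMeasurable

/-- Bootstrap from the first moment: the compensator of `‖Z‖²` is at most `M₀ + 2 M₁ ‖Z‖`, which is
already known to be integrable. -/
theorem integrable_sq_norm (h : DriftProcess ℱ P M₀ M₁ Z S B) :
    ∃ C, ∀ s, Integrable (fun ω => ‖Z s ω‖ ^ 2) P ∧ ∫ ω, ‖Z s ω‖ ^ 2 ∂P ≤ C := by
  by_cases haT : a ≤ T
  swap
  · exact ⟨0, fun s => (haT (s.2.1.trans s.2.2)).elim⟩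
  set top : Icc a T := ⟨T, right_mem_Icc.2 haT⟩
  have hM₁ := h.drift_nonneg top
  have hM₀ := h.rate_nonneg top
  obtain ⟨A, ⟨hA, hM⟩, hAe⟩ := h.dynkin 0
  set N : Icc a T → Ω → ℝ :=
    fun s ω => ‖Z s ω - 0‖ ^ 2 - ∫ τ in Iic s, A τ ω ∂(timeMeasure a T) with hN
  set G : Ω → ℝ := fun ω => ∫ τ, (M₀ + 2 * M₁ * ‖Z τ ω‖) ∂(timeMeasure a T) with hG
  have hGi : Integrable G P := by
    have := ((integrable_const M₀).add (h.integrable_prod_norm.const_mul (2 * M₁)))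
    exact this.integral_prod_right
  have hle : ∀ s, ∀ᵐ ω ∂P, ‖Z s ω‖ ^ 2 ≤ |N s ω| + G ω := by
    intro s
    filter_upwards [hAe, h.ae_integrable_path] with ω h1 h2
    have h3 : Integrable (fun τ => M₀ + 2 * M₁ * ‖Z τ ω‖) (timeMeasure a T) :=
      (integrable_const M₀).add (h2.norm.const_mul (2 * M₁))
    have h4 : |∫ τ in Iic s, A τ ω ∂(timeMeasure a T)| ≤ G ω := by
      rw [← Real.norm_eq_abs]
      refine (norm_integral_le_of_norm_le h3.integrableOn (ae_restrict_of_ae ?_)).trans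
        (setIntegral_le_integral h3 (ae_of_all _ fun τ => by positivity))
      filter_upwards [h1] with τ hτ
      rw [hτ, sub_zero]
      refine (norm_add_le _ _).trans (add_le_add (h.abs_rate_le τ ω) ?_)
      rw [norm_mul, Real.norm_two]
      have := norm_inner_le_norm (𝕜 := ℝ) (Z τ ω) (B τ ω)
      have := mul_le_mul_of_nonneg_left (h.norm_drift_le τ ω) (norm_nonneg (Z τ ω))
      nlinarith
    have h5 : ‖Z s ω‖ ^ 2 = N s ω + ∫ τ in Iic s, A τ ω ∂(timeMeasure a T) := by
      simp [hN]
    rw [h5]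
    exact add_le_add (le_abs_self _) ((le_abs_self _).trans h4)
  have hint : ∀ s, Integrable (fun ω => |N s ω| + G ω) P := fun s => (hM.integrable s).abs.add hGi
  refine ⟨∫ ω, |N top ω| ∂P + ∫ ω, G ω ∂P, fun s => ⟨?_, ?_⟩⟩
  · refine (hint s).mono ((h.measurable s).norm.pow_const 2).aestronglyMeasurable ?_
    filter_upwards [hle s] with ω hω
    rw [Real.norm_of_nonneg (by positivity)]
    exact hω.trans (le_abs_self _)
  · refine (integral_mono_of_nonneg (ae_of_all _ fun _ => by positivity) (hint s)
      (hle s)).trans ?_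
    rw [integral_add (hM.integrable s).abs hGi]
    exact add_le_add_left (hM.integral_abs_le (s := top) s.2.2) _

theorem memLp_two (h : DriftProcess ℱ P M₀ M₁ Z S B) (s : Icc a T) : MemLp (Z s) 2 P := by
  obtain ⟨C, hC⟩ := h.integrable_sq_norm
  rw [← memLp_norm_iff (h.measurable s).aestronglyMeasurable,
    memLp_two_iff_integrable_sq (h.measurable s).norm.aestronglyMeasurable]
  exact (hC s).1

end DriftProcess

end StochGame

/-! ### Increments tested against the past, and small-time bounds -/

namespace StochGame

theorem _root_.MeasureTheory.Martingale.integral_mul_sub_eq_zero {ι Ω : Type*} [Preorder ι]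
    {m : MeasurableSpace Ω} {ℱ : Filtration ι m} {P : Measure Ω} [IsFiniteMeasure P]
    {N : ι → Ω → ℝ} (hN : Martingale N ℱ P) {r s : ι}
    (hrs : r ≤ s) {ζ : Ω → ℝ} (hζ : Measurable[ℱ r] ζ)
    (hi : Integrable (fun ω => ζ ω * (N s ω - N r ω)) P) :
    ∫ ω, ζ ω * (N s ω - N r ω) ∂P = 0 := by
  have hd : Integrable (N s - N r) P := (hN.integrable s).sub (hN.integrable r)
  have h1 : P[ζ * (N s - N r) | ℱ r] =ᵐ[P] ζ * P[N s - N r | ℱ r] :=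
    condExp_mul_of_stronglyMeasurable_left hζ.stronglyMeasurable hi hd
  have h2 : P[N s - N r | ℱ r] =ᵐ[P] 0 := by
    refine (condExp_sub (hN.integrable s) (hN.integrable r) _).trans ?_
    filter_upwards [hN.2 r s hrs, hN.2 r r le_rfl] with ω h3 h4
    simp [h3, h4]
  have h5 : ∫ ω, (ζ * (N s - N r)) ω ∂P = 0 := by
    rw [← integral_condExp (ℱ.le r)]
    refine integral_eq_zero_of_ae (h1.trans ?_)
    filter_upwards [h2] with ω h3
    simp [h3]
  exact h5

variable {d : ℕ}

theorem integrable_inner_of_memLp {Ω : Type*} {m : MeasurableSpace Ω} {P : Measure Ω}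
    {f g : Ω → E d} (hf : MemLp f 2 P) (hg : MemLp g 2 P) :
    Integrable (fun ω => inner ℝ (f ω) (g ω)) P := by
  refine (MemLp.integrable_mul hf.norm hg.norm).mono
    (hf.aestronglyMeasurable.inner hg.aestronglyMeasurable) (ae_of_all _ fun ω => ?_)
  refine (norm_inner_le_norm _ _).trans ?_
  simp

theorem memLp_coord {Ω : Type*} {m : MeasurableSpace Ω} {P : Measure Ω} {f : Ω → E d} {p : ENNReal}
    (hf : MemLp f p P) (i : Fin d) : MemLp (fun ω => f ω i) p P :=
  hf.mono ((EuclideanSpace.proj (𝕜 := ℝ) i).continuous.comp_aestronglyMeasurable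
    hf.aestronglyMeasurable) (ae_of_all _ fun _ => PiLp.norm_apply_le _ i)

theorem integrable_norm_sq {Ω : Type*} {m : MeasurableSpace Ω} {P : Measure Ω} {f : Ω → E d}
    (hf : MemLp f 2 P) : Integrable (fun ω => ‖f ω‖ ^ 2) P :=
  hf.integrable_norm_pow two_ne_zero

namespace DriftProcess

variable {a T : ℝ} {Ω : Type*} {m : MeasurableSpace Ω}
  {ℱ : Filtration (Icc a T) m} {P : Measure Ω} {M₀ M₁ : ℝ}
  {Z : Icc a T → Ω → E d} {S : Icc a T → Ω → ℝ} {B : Icc a T → Ω → E d}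

theorem exists_martingale_increment (h : DriftProcess ℱ P M₀ M₁ Z S B) {r s : Icc a T}
    (hrs : r ≤ s) (i : Fin d) :
    ∃ N : Icc a T → Ω → ℝ, Martingale N ℱ P ∧ (fun ω => N s ω - N r ω) =ᵐ[P] fun ω =>
      (Z s ω - Z r ω - ∫ τ in Ioc r s, B τ ω ∂(timeMeasure a T)) i := by
  obtain ⟨N, hN, hNe⟩ := h.exists_martingale_coord i
  refine ⟨N, hN, ?_⟩
  filter_upwards [hNe s, hNe r, h.ae_integrable_drift] with ω h1 h2 h3
  rw [h1, h2, ← setIntegral_Iic_sub_Iic h3 hrs]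
  simp only [PiLp.sub_apply]
  ring

theorem norm_integral_drift_le (h : DriftProcess ℱ P M₀ M₁ Z S B) {r s : Icc a T} (hrs : r ≤ s)
    (ω : Ω) : ‖∫ τ in Ioc r s, B τ ω ∂(timeMeasure a T)‖ ≤ M₁ * (s - r) := by
  rw [← timeMeasure_real_Ioc hrs]
  exact h.norm_setIntegral_drift_le _ ω

theorem measurable_sub (h : DriftProcess ℱ P M₀ M₁ Z S B) (r : Icc a T) :
    Measurable (fun p : Icc a T × Ω => Z p.1 p.2 - Z r p.2) :=
  h.measurable_uncurry.sub ((h.measurable r).comp measurable_snd)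

variable [IsProbabilityMeasure P]

/-- Measurability in `ω` is obtained indirectly: each coordinate is a.s. an increment of `Z` minus a
martingale increment. Square integrability then follows from boundedness. -/
theorem memLp_integral_drift (h : DriftProcess ℱ P M₀ M₁ Z S B) {r s : Icc a T} (hrs : r ≤ s) :
    MemLp (fun ω => ∫ τ in Ioc r s, B τ ω ∂(timeMeasure a T)) 2 P := by
  have hi : Integrable (fun ω => ∫ τ in Ioc r s, B τ ω ∂(timeMeasure a T)) P := by
    refine integrable_of_coord fun i => ?_
    obtain ⟨N, hN, hNe⟩ := h.exists_martingale_increment hrs i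
    have h1 := (((memLp_coord ((h.memLp_two s).sub (h.memLp_two r)) i).integrable
      one_le_two).sub ((hN.integrable s).sub (hN.integrable r)))
    refine h1.congr ?_
    filter_upwards [hNe] with ω hω
    simp only [Pi.sub_apply]
    rw [hω]
    simp
  exact MemLp.of_bound hi.aestronglyMeasurable _ (ae_of_all _ (h.norm_integral_drift_le hrs))

/-- A vector known at time `r` sees only the drift of the increment, because coordinatewise the
remainder is a martingale increment. -/
theorem integral_inner_increment (h : DriftProcess ℱ P M₀ M₁ Z S B) {r s : Icc a T}
    (hrs : r ≤ s) {ζ : Ω → E d} (hζ : Measurable[ℱ r] ζ) (hζ2 : MemLp ζ 2 P) :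
    ∫ ω, inner ℝ (ζ ω) (Z s ω - Z r ω) ∂P
      = ∫ ω, inner ℝ (ζ ω) (∫ τ in Ioc r s, B τ ω ∂(timeMeasure a T)) ∂P := by
  have hJ := h.memLp_integral_drift hrs
  have hZ : MemLp (fun ω => Z s ω - Z r ω) 2 P := (h.memLp_two s).sub (h.memLp_two r)
  rw [← sub_eq_zero, ← integral_sub (integrable_inner_of_memLp hζ2 hZ)
    (integrable_inner_of_memLp hζ2 hJ)]
  have h1 : ∀ ω, inner ℝ (ζ ω) (Z s ω - Z r ω)
      - inner ℝ (ζ ω) (∫ τ in Ioc r s, B τ ω ∂(timeMeasure a T))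
      = ∑ i, ζ ω i * (Z s ω - Z r ω - ∫ τ in Ioc r s, B τ ω ∂(timeMeasure a T)) i := by
    intro ω
    rw [← inner_sub_right, PiLp.inner_apply]
    refine Finset.sum_congr rfl fun i _ => ?_
    simp [mul_comm]
  simp_rw [h1]
  have h2 : ∀ i, Integrable (fun ω =>
      ζ ω i * (Z s ω - Z r ω - ∫ τ in Ioc r s, B τ ω ∂(timeMeasure a T)) i) P := fun i =>
    MemLp.integrable_mul (memLp_coord hζ2 i) (memLp_coord (hZ.sub hJ) i)
  rw [integral_finsetSum _ fun i _ => h2 i]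
  refine Finset.sum_eq_zero fun i _ => ?_
  obtain ⟨N, hN, hNe⟩ := h.exists_martingale_increment hrs i
  have h3 : (fun ω => ζ ω i * (N s ω - N r ω)) =ᵐ[P] fun ω =>
      ζ ω i * (Z s ω - Z r ω - ∫ τ in Ioc r s, B τ ω ∂(timeMeasure a T)) i := by
    filter_upwards [hNe] with ω hω
    rw [hω]
  rw [← integral_congr_ae h3]
  exact hN.integral_mul_sub_eq_zero hrs
    ((EuclideanSpace.proj (𝕜 := ℝ) i).continuous.measurable.comp hζ) ((h2 i).congr h3.symm)

theorem memLp_sub (h : DriftProcess ℱ P M₀ M₁ Z S B) (r s : Icc a T) :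
    MemLp (fun ω => Z s ω - Z r ω) 2 P := (h.memLp_two s).sub (h.memLp_two r)

/-- A crude bound: it justifies Fubini and makes the supremum in `integral_sq_sub_le` finite. -/
theorem exists_integral_sq_sub_le (h : DriftProcess ℱ P M₀ M₁ Z S B) (r : Icc a T) :
    ∃ C, ∀ s, ∫ ω, ‖Z s ω - Z r ω‖ ^ 2 ∂P ≤ C := by
  obtain ⟨C, hC⟩ := h.integrable_sq_norm
  refine ⟨2 * C + 2 * C, fun s => ?_⟩
  have h1 : ∫ ω, ‖Z s ω - Z r ω‖ ^ 2 ∂P ≤ ∫ ω, (2 * ‖Z s ω‖ ^ 2 + 2 * ‖Z r ω‖ ^ 2) ∂P := by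
    refine integral_mono (integrable_norm_sq (h.memLp_sub r s))
      (((hC s).1.const_mul 2).add ((hC r).1.const_mul 2)) fun ω => ?_
    have h2 := norm_sub_le (Z s ω) (Z r ω)
    have h3 : ‖Z s ω - Z r ω‖ ^ 2 ≤ (‖Z s ω‖ + ‖Z r ω‖) ^ 2 := by gcongr
    simp only
    nlinarith [sq_nonneg (‖Z s ω‖ - ‖Z r ω‖)]
  rw [integral_add ((hC s).1.const_mul 2) ((hC r).1.const_mul 2), integral_const_mul,
    integral_const_mul] at h1
  linarith [(hC s).2, (hC r).2]

theorem integrable_integral_norm_sub (h : DriftProcess ℱ P M₀ M₁ Z S B) (r s : Icc a T) :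
    Integrable (fun ω => ∫ τ in Ioc r s, ‖Z τ ω - Z r ω‖ ^ 2 ∂(timeMeasure a T)) P := by
  obtain ⟨C, hC⟩ := h.exists_integral_sq_sub_le r
  refine (integrable_prod_of_integral_abs_le (P := P) (C := C) measurableSet_Ioc
    (F := fun τ ω => ‖Z τ ω - Z r ω‖ ^ 2)
    ((h.measurable_sub r).norm.pow_const 2) (fun τ _ => integrable_norm_sq (h.memLp_sub r τ))
    fun τ _ => ?_).integral_prod_right
  simpa using hC τ

theorem ae_integrable_sq_sub (h : DriftProcess ℱ P M₀ M₁ Z S B) (r : Icc a T) :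
    ∀ᵐ ω ∂P, Integrable (fun τ => ‖Z τ ω - Z r ω‖ ^ 2) (timeMeasure a T) := by
  obtain ⟨C, hC⟩ := h.exists_integral_sq_sub_le r
  have := (integrable_prod_of_integral_abs_le (P := P) (C := C) MeasurableSet.univ
    (F := fun τ ω => ‖Z τ ω - Z r ω‖ ^ 2)
    ((h.measurable_sub r).norm.pow_const 2) (fun τ _ => integrable_norm_sq (h.memLp_sub r τ))
    fun τ _ => by simpa using hC τ).prod_left_ae
  simpa using this

/-- Recentring at `Z r` leaves the compensator `S + 2⟨Z τ - Z r, B⟩`, and Young's inequality with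
weight `k` splits the drift term. The weight stays free because a small `k` gives the sharp leading
coefficient `M₀` that enters `Θ`. -/
theorem integral_sq_sub_le_integral (h : DriftProcess ℱ P M₀ M₁ Z S B) {r s : Icc a T}
    (hrs : r ≤ s) {k : ℝ} (hk : 0 < k) :
    ∫ ω, ‖Z s ω - Z r ω‖ ^ 2 ∂P ≤ (s - r) * (M₀ + k) +
      M₁ ^ 2 / k * ∫ ω, ∫ τ in Ioc r s, ‖Z τ ω - Z r ω‖ ^ 2 ∂(timeMeasure a T) ∂P := by
  obtain ⟨A, ⟨hA, hM⟩, hAe⟩ := h.dynkin 0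
  have hJ := h.memLp_integral_drift hrs
  have hM₁ := h.drift_nonneg r
  have hdrift := h.integral_inner_increment hrs (h.adapted r) (h.memLp_two r)
  have hi1 := integrable_norm_sq (h.memLp_two s)
  have hi2 := integrable_norm_sq (h.memLp_two r)
  have hi12 : Integrable (fun ω => ‖Z s ω‖ ^ 2 - ‖Z r ω‖ ^ 2) P := hi1.sub hi2
  have hi3 := integrable_inner_of_memLp (h.memLp_two r) (h.memLp_sub r s)
  have hi4 := integrable_inner_of_memLp (h.memLp_two r) hJ
  have hmart : ∫ ω, (‖Z s ω‖ ^ 2 - ‖Z r ω‖ ^ 2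
      - ∫ τ in Ioc r s, A τ ω ∂(timeMeasure a T)) ∂P = 0 := by
    have h1 : ∫ ω, (1 : ℝ) * _ ∂P = 0 := hM.integral_mul_sub_eq_zero hrs (ζ := fun _ => 1)
      measurable_const (by
        simp_rw [one_mul]
        exact (hM.integrable s).sub (hM.integrable r))
    rw [← h1]
    refine integral_congr_ae ?_
    filter_upwards [hA] with ω h2
    rw [← setIntegral_Iic_sub_Iic h2 hrs]
    simp only [sub_zero]
    ring
  have hAi : Integrable (fun ω => ∫ τ in Ioc r s, A τ ω ∂(timeMeasure a T)) P := by
    refine ((hi12.sub ((hM.integrable s).sub (hM.integrable r)))).congr ?_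
    filter_upwards [hA] with ω h2
    simp only [Pi.sub_apply, sub_zero]
    rw [← setIntegral_Iic_sub_Iic h2 hrs]
    ring
  rw [integral_sub hi12 hAi] at hmart
  have hexp : ∫ ω, ‖Z s ω - Z r ω‖ ^ 2 ∂P = ∫ ω, ((∫ τ in Ioc r s, A τ ω ∂(timeMeasure a T))
      - 2 * inner ℝ (Z r ω) (∫ τ in Ioc r s, B τ ω ∂(timeMeasure a T))) ∂P := by
    have h1 : ∀ ω, ‖Z s ω - Z r ω‖ ^ 2
        = ‖Z s ω‖ ^ 2 - ‖Z r ω‖ ^ 2 - 2 * inner ℝ (Z r ω) (Z s ω - Z r ω) := by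
      intro ω
      rw [norm_sub_sq_real, inner_sub_right, real_inner_self_eq_norm_sq, real_inner_comm]
      ring
    simp_rw [h1]
    rw [integral_sub hi12 (hi3.const_mul 2), integral_const_mul, hdrift,
      integral_sub hAi (hi4.const_mul 2), integral_const_mul]
    have h2 : ∫ ω, (‖Z s ω‖ ^ 2 - ‖Z r ω‖ ^ 2) ∂P
        = ∫ ω, ∫ τ in Ioc r s, A τ ω ∂(timeMeasure a T) ∂P := by
      linarith [hmart]
    rw [h2]
  have hI := h.integrable_integral_norm_sub r s
  rw [hexp]
  have hmono : ∫ ω, ((∫ τ in Ioc r s, A τ ω ∂(timeMeasure a T))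
      - 2 * inner ℝ (Z r ω) (∫ τ in Ioc r s, B τ ω ∂(timeMeasure a T))) ∂P
      ≤ ∫ ω, ((s - r) * (M₀ + k)
        + M₁ ^ 2 / k * ∫ τ in Ioc r s, ‖Z τ ω - Z r ω‖ ^ 2 ∂(timeMeasure a T)) ∂P := by
    refine integral_mono_ae (hAi.sub (hi4.const_mul 2))
      ((integrable_const _).add (hI.const_mul _)) ?_
    filter_upwards [hA, hAe, h.ae_integrable_drift, h.ae_integrable_sq_sub r] with ω h1 h2 h3 h4
    have h5 : Integrable (fun τ => 2 * inner ℝ (Z r ω) (B τ ω)) (timeMeasure a T) :=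
      (h3.const_inner _).const_mul 2
    rw [← integral_inner h3.integrableOn, ← integral_const_mul,
      ← integral_sub h1.integrableOn h5.integrableOn]
    have h6 : ∫ τ in Ioc r s, ((M₀ + k) + M₁ ^ 2 / k * ‖Z τ ω - Z r ω‖ ^ 2) ∂(timeMeasure a T)
        = (s - r) * (M₀ + k)
        + M₁ ^ 2 / k * ∫ τ in Ioc r s, ‖Z τ ω - Z r ω‖ ^ 2 ∂(timeMeasure a T) := by
      rw [integral_add (integrable_const _) (h4.integrableOn.const_mul _), integral_const_mul,
        setIntegral_const, timeMeasure_real_Ioc hrs, smul_eq_mul]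
    rw [← h6]
    refine integral_mono_ae (h1.integrableOn.sub h5.integrableOn)
      ((integrable_const _).add (h4.integrableOn.const_mul _)) (ae_restrict_of_ae ?_)
    filter_upwards [h2] with τ h7
    have h8 : A τ ω - 2 * inner ℝ (Z r ω) (B τ ω)
        = S τ ω + 2 * inner ℝ (Z τ ω - Z r ω) (B τ ω) := by
      rw [h7, sub_zero, inner_sub_left]; ring
    rw [h8]
    have h9 := (abs_le.1 (h.abs_rate_le τ ω)).2
    have h10 := real_inner_le_norm (Z τ ω - Z r ω) (B τ ω)
    have h11 := mul_le_mul_of_nonneg_left (h.norm_drift_le τ ω) (norm_nonneg (Z τ ω - Z r ω))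
    have h12 : 2 * (‖Z τ ω - Z r ω‖ * M₁) ≤ k + M₁ ^ 2 / k * ‖Z τ ω - Z r ω‖ ^ 2 := by
      have : k + M₁ ^ 2 / k * ‖Z τ ω - Z r ω‖ ^ 2 - 2 * (‖Z τ ω - Z r ω‖ * M₁)
          = (k - M₁ * ‖Z τ ω - Z r ω‖) ^ 2 / k := by field_simp; ring
      have h13 : 0 ≤ (k - M₁ * ‖Z τ ω - Z r ω‖) ^ 2 / k := by positivity
      linarith
    linarith
  refine hmono.trans_eq ?_
  rw [integral_add (integrable_const _) (hI.const_mul _), integral_const_mul, integral_const_mul]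
  simp

/-- Absorption: let `F` be the supremum of the mean squares over `Ioc r s`. With `k = 2 M₁² (s - r)`
the Young term is at most `F / 2` and moves to the left, which doubles the constants. -/
theorem integral_sq_sub_le (h : DriftProcess ℱ P M₀ M₁ Z S B) {r s : Icc a T} (hrs : r ≤ s) :
    ∫ ω, ‖Z s ω - Z r ω‖ ^ 2 ∂P ≤ 2 * M₀ * (s - r) + 4 * M₁ ^ 2 * (s - r) ^ 2 := by
  rcases hrs.eq_or_lt with rfl | hlt
  · simp
  have hL : (0 : ℝ) < s - r := sub_pos.2 hlt
  have hM₀ := h.rate_nonneg r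
  have hM₁ := h.drift_nonneg r
  set F : ℝ := ⨆ τ : Ioc r s, ∫ ω, ‖Z τ ω - Z r ω‖ ^ 2 ∂P with hF
  obtain ⟨C, hC⟩ := h.exists_integral_sq_sub_le r
  have hbdd : BddAbove (range fun τ : Ioc r s => ∫ ω, ‖Z τ ω - Z r ω‖ ^ 2 ∂P) :=
    ⟨C, by rintro _ ⟨τ, rfl⟩; exact hC τ⟩
  have hle : ∀ τ ∈ Ioc r s, ∫ ω, ‖Z τ ω - Z r ω‖ ^ 2 ∂P ≤ F := fun τ hτ =>
    le_ciSup hbdd (⟨τ, hτ⟩ : Ioc r s)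
  have hF0 : 0 ≤ F := (integral_nonneg fun _ => by positivity).trans (hle s ⟨hlt, le_rfl⟩)
  have hstep : ∀ τ ∈ Ioc r s, ∫ ω, ‖Z τ ω - Z r ω‖ ^ 2 ∂P
      ≤ (s - r) * M₀ + 2 * M₁ ^ 2 * (s - r) ^ 2 + F / 2 := by
    intro τ hτ
    have hτr : (0 : ℝ) ≤ τ - r := sub_nonneg.2 (Subtype.coe_le_coe.2 hτ.1.le)
    have hτs : (τ : ℝ) - r ≤ s - r := sub_le_sub_right (Subtype.coe_le_coe.2 hτ.2) _
    have h2 := integral_setIntegral_Ioc_le (P := P) (C := F) hτ.1.le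
      (F := fun τ ω => ‖Z τ ω - Z r ω‖ ^ 2)
      ((h.measurable_sub r).norm.pow_const 2) (fun σ _ => integrable_norm_sq (h.memLp_sub r σ))
      fun σ hσ => by simpa using hle σ ⟨hσ.1, hσ.2.trans hτ.2⟩
    -- For `M₁ = 0` that weight would vanish; the integral term is then absent and the weight is
    -- sent to `0` instead.
    rcases hM₁.eq_or_lt with h0 | hpos
    · refine le_of_forall_pos_le_add fun k hk => ?_
      have h1 := h.integral_sq_sub_le_integral hτ.1.le (k := k / (s - r)) (by positivity)
      rw [← h0] at h1 ⊢
      have h3 : ((τ : ℝ) - r) * (M₀ + k / (s - r)) ≤ (s - r) * (M₀ + k / (s - r)) := by gcongr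
      have h4 : (s - r : ℝ) * (M₀ + k / (s - r)) = (s - r) * M₀ + k := by field_simp
      simp only [ne_eq, OfNat.ofNat_ne_zero, not_false_eq_true, zero_pow, zero_div, zero_mul,
        add_zero, mul_zero] at h1 ⊢
      linarith
    · have h1 := h.integral_sq_sub_le_integral hτ.1.le (k := 2 * M₁ ^ 2 * (s - r))
        (by positivity)
      have h3 : M₁ ^ 2 / (2 * M₁ ^ 2 * (s - r))
          * ∫ ω, ∫ σ in Ioc r τ, ‖Z σ ω - Z r ω‖ ^ 2 ∂(timeMeasure a T) ∂P
          ≤ M₁ ^ 2 / (2 * M₁ ^ 2 * (s - r)) * ((s - r) * F) := by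
        refine mul_le_mul_of_nonneg_left (h2.trans ?_) (by positivity)
        gcongr
      have h4 : M₁ ^ 2 / (2 * M₁ ^ 2 * (s - r)) * ((s - r) * F) = F / 2 := by
        field_simp
      have h5 : ((τ : ℝ) - r) * (M₀ + 2 * M₁ ^ 2 * (s - r))
          ≤ (s - r) * (M₀ + 2 * M₁ ^ 2 * (s - r)) := by gcongr
      nlinarith
  have hFle : F ≤ (s - r) * M₀ + 2 * M₁ ^ 2 * (s - r) ^ 2 + F / 2 := by
    have : Nonempty (Ioc r s) := ⟨⟨s, hlt, le_rfl⟩⟩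
    exact ciSup_le fun τ => hstep τ τ.2
  have := hle s ⟨hlt, le_rfl⟩
  linarith

theorem integral_integral_sq_sub_le (h : DriftProcess ℱ P M₀ M₁ Z S B) {r s : Icc a T}
    (hrs : r ≤ s) :
    ∫ ω, ∫ τ in Ioc r s, ‖Z τ ω - Z r ω‖ ^ 2 ∂(timeMeasure a T) ∂P
      ≤ (s - r) * (2 * M₀ * (s - r) + 4 * M₁ ^ 2 * (s - r) ^ 2) := by
  have hM₀ := h.rate_nonneg r
  refine integral_setIntegral_Ioc_le (P := P) hrs
    (F := fun τ ω => ‖Z τ ω - Z r ω‖ ^ 2)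
    ((h.measurable_sub r).norm.pow_const 2) (fun σ _ => integrable_norm_sq (h.memLp_sub r σ))
    fun τ hτ => ?_
  have hτr : (0 : ℝ) ≤ τ - r := sub_nonneg.2 (Subtype.coe_le_coe.2 hτ.1.le)
  have hτs : (τ : ℝ) - r ≤ s - r := sub_le_sub_right (Subtype.coe_le_coe.2 hτ.2) _
  simp only [abs_pow, abs_norm]
  refine (h.integral_sq_sub_le hτ.1.le).trans ?_
  gcongr

end DriftProcess

end StochGame

/-! ### Measurability of the guide's transition kernel -/

namespace StochGame

theorem IsProgressive.measurable_uncurry {a T : ℝ} (haT : a ≤ T) {Ω β : Type*}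
    [MeasurableSpace β] {m : MeasurableSpace Ω} {ℱ : Filtration (Icc a T) m}
    {X : Icc a T → Ω → β} (hX : IsProgressive ℱ X) :
    Measurable (fun p : Icc a T × Ω => X p.1 p.2) := by
  have h := hX ⟨T, right_mem_Icc.2 haT⟩
  have h1 : Measurable[(inferInstance : MeasurableSpace (Icc a T)).prod m,
      (inferInstance : MeasurableSpace (Iic (⟨T, right_mem_Icc.2 haT⟩ : Icc a T))).prod
        (ℱ ⟨T, right_mem_Icc.2 haT⟩)]
      (fun p : Icc a T × Ω => ((⟨p.1, p.1.2.2⟩ : Iic (⟨T, right_mem_Icc.2 haT⟩ : Icc a T)), p.2)) :=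
    Measurable.prodMk (measurable_fst.subtype_mk)
      (measurable_snd.mono le_rfl (ℱ.le _))
  exact h.comp h1

theorem IsProgressive.measurable_slice {ι Ω β : Type*} [Preorder ι] [MeasurableSpace ι]
    [MeasurableSpace β] {m : MeasurableSpace Ω} {ℱ : Filtration ι m}
    {X : ι → Ω → β} (hX : IsProgressive ℱ X) (s : ι) : Measurable[ℱ s] (X s) := by
  have h1 : Measurable[ℱ s, (inferInstance : MeasurableSpace (Iic s)).prod (ℱ s)]
      (fun ω : Ω => ((⟨s, le_rfl⟩ : Iic s), ω)) :=
    Measurable.prodMk measurable_const measurable_id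
  exact (hX s).comp h1

variable {d : ℕ}

theorem exists_norm_fderiv_le_of_compactSupport {F G : Type*} [NormedAddCommGroup F]
    [NormedSpace ℝ F] [NormedAddCommGroup G] [NormedSpace ℝ G] {φ : F → G}
    (h : ContDiff ℝ 1 φ) (hs : HasCompactSupport φ) : ∃ C, ∀ x, ‖fderiv ℝ φ x‖ ≤ C :=
  (HasCompactSupport.fderiv ℝ hs).exists_bound_of_continuous (h.continuous_fderiv one_ne_zero)

theorem isCb2_of_compactSupport {φ : E d → ℝ} (h : ContDiff ℝ 2 φ) (hs : HasCompactSupport φ) :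
    IsCb2 φ := by
  obtain ⟨C₀, h₀⟩ := hs.exists_bound_of_continuous h.continuous
  have h1 : ContDiff ℝ 1 (fderiv ℝ φ) := h.fderiv_right (by norm_num)
  obtain ⟨C₁, h₁⟩ := exists_norm_fderiv_le_of_compactSupport (h.of_le one_le_two) hs
  obtain ⟨C₂, h₂⟩ := exists_norm_fderiv_le_of_compactSupport h1 (HasCompactSupport.fderiv ℝ hs)
  exact ⟨h, max C₀ (max C₁ C₂), fun x => ⟨(h₀ x).trans (le_max_left _ _),
    (h₁ x).trans ((le_max_left _ _).trans (le_max_right _ _)),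
    (h₂ x).trans ((le_max_right _ _).trans (le_max_right _ _))⟩⟩

/-- Take a smooth nonnegative `f` with support exactly `O` and apply a smooth step to `n f`.
Boundedness of `O` gives compact support, hence membership in `C_b²`. -/
theorem exists_isCb2_tendsto_indicator {O : Set (E d)} (hO : IsOpen O)
    (hb : Bornology.IsBounded O) :
    ∃ φ : ℕ → E d → ℝ, (∀ n, IsCb2 (φ n)) ∧ (∀ n x, |φ n x| ≤ 1) ∧
      ∀ x, Tendsto (fun n => φ n x) atTop (𝓝 (O.indicator (fun _ => 1) x)) := by
  obtain ⟨f, hf, hf2, hf3⟩ := hO.exists_contDiff_support_eq (n := 2)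
  have hf0 : ∀ x, 0 ≤ f x := fun x => (hf3 ⟨x, rfl⟩).1
  refine ⟨fun n x => Real.smoothTransition (n * f x), fun n => ?_, fun n x => ?_, fun x => ?_⟩
  · refine isCb2_of_compactSupport (Real.smoothTransition.contDiff.comp
      (contDiff_const.mul hf2)) ?_
    refine HasCompactSupport.of_support_subset_isCompact
      (Metric.isCompact_of_isClosed_isBounded isClosed_closure hb.closure) ?_
    intro x hx
    refine subset_closure ?_
    rw [← hf]
    intro h0
    apply hx
    simp [h0]
  · rw [abs_of_nonneg (Real.smoothTransition.nonneg _)]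
    exact Real.smoothTransition.le_one _
  · by_cases hx : x ∈ O
    · rw [indicator_of_mem hx]
      have hpos : 0 < f x := (hf0 x).lt_of_ne (Ne.symm (by rw [← hf] at hx; exact hx))
      obtain ⟨n₀, hn₀⟩ := exists_nat_ge (1 / f x)
      refine tendsto_const_nhds.congr' ?_
      filter_upwards [eventually_ge_atTop n₀] with n hn
      refine (Real.smoothTransition.one_of_one_le ?_).symm
      have : (n₀ : ℝ) ≤ n := by exact_mod_cast hn
      rw [← div_le_iff₀ hpos]
      linarith
    · rw [indicator_of_notMem hx]
      have h0 : f x = 0 := by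
        by_contra h0
        exact hx (hf ▸ h0)
      simp [h0]

/-- A family of probability laws on `ℝ^d` is measurable as soon as the expectations of the
functions of class `C_b²` are. -/
theorem measurable_of_measurable_integral_isCb2 {α : Type*} [MeasurableSpace α]
    {κ : α → Measure (E d)} [∀ x, IsProbabilityMeasure (κ x)]
    (h : ∀ φ, IsCb2 φ → Measurable fun x => ∫ y, φ y ∂(κ x)) : Measurable κ := by
  have hbasis : TopologicalSpace.IsTopologicalBasis
      {O : Set (E d) | IsOpen O ∧ Bornology.IsBounded O} := by
    refine TopologicalSpace.isTopologicalBasis_of_isOpen_of_nhds (fun u hu => hu.1) ?_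
    intro x u hx hu
    exact ⟨u ∩ Metric.ball x 1, ⟨hu.inter Metric.isOpen_ball,
      Metric.isBounded_ball.subset inter_subset_right⟩, ⟨hx, Metric.mem_ball_self one_pos⟩,
      inter_subset_left⟩
  -- Bounded open sets form an intersection-stable basis, so they generate the Borel sets and
  -- determine measurability of the kernel.
  refine Measurable.measure_of_isPiSystem_of_isProbabilityMeasure
    (S := {O : Set (E d) | IsOpen O ∧ Bornology.IsBounded O}) ?_ ?_ ?_
  · rw [← hbasis.borel_eq_generateFrom]
    exact BorelSpace.measurable_eq
  · intro s hs t ht _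
    exact ⟨hs.1.inter ht.1, hs.2.subset inter_subset_left⟩
  · rintro O ⟨hO, hOb⟩
    obtain ⟨φ, hφ, hφ1, hφl⟩ := exists_isCb2_tendsto_indicator hO hOb
    have hreal : Measurable fun x => (κ x).real O := by
      refine measurable_of_tendsto_metrizable (fun n => h (φ n) (hφ n)) ?_
      rw [tendsto_pi_nhds]
      intro x
      rw [← integral_indicator_one hO.measurableSet]
      refine tendsto_integral_of_dominated_convergence (fun _ => 1)
        (fun n => (hφ n).1.continuous.aestronglyMeasurable) (integrable_const _)
        (fun n => ae_of_all _ fun y => hφ1 n y) (ae_of_all _ fun y => ?_)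
      exact hφl y
    have : (fun x => κ x O) = fun x => ENNReal.ofReal ((κ x).real O) := by
      ext x
      simp
    rw [this]
    exact hreal.ennreal_ofReal

namespace VStableOn

variable {U V : Type*} [MeasurableSpace U] [MeasurableSpace V] {L : Generator d U V}
  {D : Set (E d → ℝ)} {c : ℝ → E d → ℝ} {t θ : ℝ} {htθ : t ≤ θ}

attribute [instance] VStableOn.mΩ VStableOn.isMarkov

theorem measurable_uncurry (vs : VStableOn.{w} L D c t θ htθ) (ξ : E d) (u : U) :
    Measurable (fun p : Icc t θ × vs.Ω => vs.Y ξ u p.1 p.2) :=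
  (vs.Y_progressive ξ u).measurable_uncurry htθ

theorem measurable_Y (vs : VStableOn.{w} L D c t θ htθ) (ξ : E d) (u : U) (s : Icc t θ) :
    Measurable (vs.Y ξ u s) :=
  ((vs.Y_progressive ξ u).measurable_slice s).mono (vs.ℱ.le s) le_rfl

/-- The transition kernel of the guide: the law of `Y ξ u θ` under `P (ξ, u)`. -/
noncomputable def stepKernel (vs : VStableOn.{w} L D c t θ htθ) (hD : ∀ φ, IsCb2 φ → φ ∈ D) :
    Kernel (E d × U) (E d) where
  toFun q := (vs.P q).map (vs.Y q.1 q.2 ⟨θ, right_mem_Icc.2 htθ⟩)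
  measurable' := by
    have : ∀ q : E d × U, IsProbabilityMeasure
        ((vs.P q).map (vs.Y q.1 q.2 ⟨θ, right_mem_Icc.2 htθ⟩)) := fun q =>
      Measure.isProbabilityMeasure_map (vs.measurable_Y _ _ _).aemeasurable
    refine measurable_of_measurable_integral_isCb2 fun φ hφ => ?_
    have h1 : ∀ q : E d × U, ∫ y, φ y ∂((vs.P q).map (vs.Y q.1 q.2 ⟨θ, right_mem_Icc.2 htθ⟩))
        = ∫ ω, φ (vs.Y q.1 q.2 ⟨θ, right_mem_Icc.2 htθ⟩ ω) ∂(vs.P q) := fun q =>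
      integral_map (vs.measurable_Y _ _ _).aemeasurable hφ.1.continuous.aestronglyMeasurable
    simp_rw [h1]
    exact (vs.measurable_expectation φ (hD φ hφ)).comp
      (measurable_fst.prodMk (measurable_snd.prodMk measurable_const))

theorem stepKernel_apply (vs : VStableOn.{w} L D c t θ htθ) (hD : ∀ φ, IsCb2 φ → φ ∈ D)
    (q : E d × U) :
    vs.stepKernel hD q = (vs.P q).map (vs.Y q.1 q.2 ⟨θ, right_mem_Icc.2 htθ⟩) := rfl

instance (vs : VStableOn.{w} L D c t θ htθ) (hD : ∀ φ, IsCb2 φ → φ ∈ D) :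
    IsMarkovKernel (vs.stepKernel hD) :=
  ⟨fun q => Measure.isProbabilityMeasure_map (vs.measurable_Y q.1 q.2 _).aemeasurable⟩

variable [TopologicalSpace U] [TopologicalSpace V] {T M₀ M₁ : ℝ} {K : ℝ≥0}

/-- Polarization again, now in the control variable: integrability of the generator at squared
distances centred at `0` and at the unit vectors isolates `b`, and then `Σ`. -/
theorem ae_integrable_b (vs : VStableOn.{w} L D c t θ htθ) (hL : L.Regular T M₀ M₁ K)
    (hD : IsTestClass L T D) (ht : 0 ≤ t) (hθ : θ ≤ T) (ξ : E d) (u : U) :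
    ∀ᵐ ω ∂(vs.P (ξ, u)), ∀ᵐ τ : Icc t θ ∂(timeMeasure t θ),
      Integrable (fun z => L.b τ (vs.Y ξ u τ ω) u z) (vs.μ ξ u τ ω) ∧
      Integrable (fun z => L.Sig τ (vs.Y ξ u τ ω) u z) (vs.μ ξ u τ ω) := by
  have hmem : ∀ τ : Icc t θ, (τ : ℝ) ∈ Icc 0 T := fun τ => ⟨ht.trans τ.2.1, τ.2.2.trans hθ⟩
  have hc := fun a : E d => vs.integrable_control _ (hD.quadratic_mem a) ξ u
  filter_upwards [hc 0, ae_all_iff.2 fun i => hc (EuclideanSpace.single i 1)] with ω h0 h1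
  filter_upwards [h0, ae_all_iff.2 h1] with τ h0 h1
  have happ := fun a z => L.apply_normSq_sub
    (hL.secondMoment τ (hmem τ) (vs.Y ξ u τ ω) u z) a
  simp_rw [happ] at h0 h1
  have hb : Integrable (fun z => L.b τ (vs.Y ξ u τ ω) u z) (vs.μ ξ u τ ω) := by
    refine integrable_of_coord fun i => ?_
    refine ((h0.sub (h1 i)).const_mul 2⁻¹).congr (ae_of_all _ fun z => ?_)
    simp only [Pi.sub_apply, sub_zero, inner_sub_left, EuclideanSpace.inner_single_left]
    simp only [map_one, one_mul]
    ring
  refine ⟨hb, (h0.sub ((hb.const_inner (vs.Y ξ u τ ω - 0)).const_mul 2)).congr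
    (ae_of_all _ fun z => ?_)⟩
  simp

theorem driftProcess_path (vs : VStableOn.{w} L D c t θ htθ) (hL : L.Regular T M₀ M₁ K)
    (hD : IsTestClass L T D) (ht : 0 ≤ t) (hθ : θ ≤ T) (ξ : E d) (u : U) :
    DriftProcess vs.ℱ (vs.P (ξ, u)) M₀ M₁ (vs.Y ξ u)
      (fun τ ω => ∫ z, L.Sig τ (vs.Y ξ u τ ω) u z ∂(vs.μ ξ u τ ω))
      (fun τ ω => ∫ z, L.b τ (vs.Y ξ u τ ω) u z ∂(vs.μ ξ u τ ω)) := by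
  have hmem : ∀ τ : Icc t θ, (τ : ℝ) ∈ Icc 0 T := fun τ => ⟨ht.trans τ.2.1, τ.2.2.trans hθ⟩
  have := vs.μ_prob
  refine ⟨vs.measurable_uncurry ξ u, (vs.Y_progressive ξ u).measurable_slice, fun τ ω => ?_,
    fun τ ω => ?_, fun a => ⟨_, vs.dynkin _ (hD.quadratic_mem a) ξ u, ?_⟩⟩
  · have := norm_integral_le_of_norm_le_const (μ := vs.μ ξ u τ ω)
      (f := fun z => L.Sig τ (vs.Y ξ u τ ω) u z)
      (ae_of_all _ fun z => hL.bound_Sig τ (hmem τ) (vs.Y ξ u τ ω) u z)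
    simpa using this
  · have := norm_integral_le_of_norm_le_const (μ := vs.μ ξ u τ ω)
      (ae_of_all _ fun z => hL.bound_b τ (hmem τ) (vs.Y ξ u τ ω) u z)
    simpa using this
  · filter_upwards [vs.ae_integrable_b hL hD ht hθ ξ u] with ω h1
    filter_upwards [h1] with τ h2
    have happ := fun z => L.apply_normSq_sub
      (hL.secondMoment τ (hmem τ) (vs.Y ξ u τ ω) u z) a
    simp_rw [happ]
    rw [integral_add h2.2 ((h2.1.const_inner _).const_mul 2), integral_const_mul,
      integral_inner h2.1]

end VStableOn

end StochGame

/-! ### One-step estimates for the guide -/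

namespace StochGame

variable {d : ℕ}

/-- The properties of the one-step transition kernel `Q` of the guide, for a step from `t`
to `θ`. -/
structure GuideStep {U V : Type*} [MeasurableSpace U] (L : Generator d U V) (c : ℝ → E d → ℝ)
    (M₀ M₁ : ℝ) (K : ℝ≥0) (t θ : ℝ) (Q : Kernel (E d × U) (E d)) : Prop where
  isMarkov : IsMarkovKernel Q
  memLp : ∀ q, MemLp (fun η => η - q.1) 2 (Q q)
  integral_sq_le : ∀ q, ∫ η, ‖η - q.1‖ ^ 2 ∂(Q q)
    ≤ 2 * M₀ * (θ - t) + 4 * M₁ ^ 2 * (θ - t) ^ 2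
  integral_sq_le_add : ∀ q k, 0 < k → ∫ η, ‖η - q.1‖ ^ 2 ∂(Q q) ≤ (θ - t) * (M₀ + k)
    + M₁ ^ 2 / k * ((θ - t) * (2 * M₀ * (θ - t) + 4 * M₁ ^ 2 * (θ - t) ^ 2))
  norm_mean_le : ∀ q, ‖∫ η, (η - q.1) ∂(Q q)‖ ≤ M₁ * (θ - t)
  le_inner_mean : ∀ q s lam ε k, 0 < k →
    (∀ τ ∈ Icc t θ, ∀ x u v, ‖L.b τ x u v - L.b t x u v‖ ≤ ε) →
    (∀ z, lam ≤ inner ℝ s (L.b t q.1 q.2 z)) →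
    (θ - t) * lam - ‖s‖ * ((θ - t) * (ε + K * (k
      + (2 * M₀ * (θ - t) + 4 * M₁ ^ 2 * (θ - t) ^ 2) / k)))
      ≤ inner ℝ s (∫ η, (η - q.1) ∂(Q q))
  integrable : ∀ q, Integrable (c θ) (Q q)
  le_integral : ∀ q, c t q.1 ≤ ∫ η, c θ η ∂(Q q)

theorem le_add_sq_div {x k : ℝ} (hk : 0 < k) : x ≤ k + x ^ 2 / k := by
  rw [← sub_nonneg]
  have : k + x ^ 2 / k - x = ((x - k / 2) ^ 2 + 3 / 4 * k ^ 2) / k := by field_simp; ring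
  rw [this]
  positivity

namespace DriftProcess

variable {a T : ℝ} {Ω : Type*} {m : MeasurableSpace Ω}
  {ℱ : Filtration (Icc a T) m} {P : Measure Ω} [IsProbabilityMeasure P] {M₀ M₁ : ℝ}
  {Z : Icc a T → Ω → E d} {S : Icc a T → Ω → ℝ} {B : Icc a T → Ω → E d}

end DriftProcess

namespace VStableOn

variable {U V : Type*} [MeasurableSpace U] [MeasurableSpace V] {L : Generator d U V}
  {D : Set (E d → ℝ)} {c : ℝ → E d → ℝ} {t θ : ℝ} {htθ : t ≤ θ}
  [TopologicalSpace U] [TopologicalSpace V] {T M₀ M₁ : ℝ} {K : ℝ≥0}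

theorem guideStep [Nonempty V] (vs : VStableOn.{w} L D c t θ htθ) (hL : L.Regular T M₀ M₁ K)
    (hD : IsTestClass L T D) (ht : 0 ≤ t) (hθ : θ ≤ T) (hc : Measurable (c θ)) :
    GuideStep L c M₀ M₁ K t θ (vs.stepKernel hD.cb2_mem) := by
  set a₀ : Icc t θ := ⟨t, left_mem_Icc.2 htθ⟩ with ha₀
  set b₀ : Icc t θ := ⟨θ, right_mem_Icc.2 htθ⟩ with hb₀
  have hab : a₀ ≤ b₀ := htθ
  have hmem : ∀ τ : Icc t θ, (τ : ℝ) ∈ Icc 0 T := fun τ => ⟨ht.trans τ.2.1, τ.2.2.trans hθ⟩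
  have hDP := fun q : E d × U => vs.driftProcess_path hL hD ht hθ q.1 q.2
  have hY := fun q : E d × U => vs.measurable_Y q.1 q.2 b₀
  have hQ := vs.stepKernel_apply hD.cb2_mem
  have hinit : ∀ q : E d × U, (fun ω => vs.Y q.1 q.2 b₀ ω - q.1) =ᵐ[vs.P q]
      fun ω => vs.Y q.1 q.2 b₀ ω - vs.Y q.1 q.2 a₀ ω := by
    intro q
    filter_upwards [vs.initial q.1 q.2] with ω hω
    rw [hω]
  have hsq : ∀ q, ∫ η, ‖η - q.1‖ ^ 2 ∂(vs.stepKernel hD.cb2_mem q)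
      = ∫ ω, ‖vs.Y q.1 q.2 b₀ ω - vs.Y q.1 q.2 a₀ ω‖ ^ 2 ∂(vs.P q) := by
    intro q
    rw [hQ, integral_map (hY q).aemeasurable (by fun_prop)]
    refine integral_congr_ae ?_
    filter_upwards [hinit q] with ω hω
    rw [hω]
  have hmean : ∀ q, ∫ η, (η - q.1) ∂(vs.stepKernel hD.cb2_mem q)
      = ∫ ω, (vs.Y q.1 q.2 b₀ ω - vs.Y q.1 q.2 a₀ ω) ∂(vs.P q) := by
    intro q
    rw [hQ, integral_map (hY q).aemeasurable (by fun_prop)]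
    exact integral_congr_ae (hinit q)
  have hinner : ∀ q s, inner ℝ s (∫ η, (η - q.1) ∂(vs.stepKernel hD.cb2_mem q))
      = ∫ ω, inner ℝ s (∫ τ in Ioc a₀ b₀, (∫ z, L.b τ (vs.Y q.1 q.2 τ ω) q.2 z
        ∂(vs.μ q.1 q.2 τ ω)) ∂(timeMeasure t θ)) ∂(vs.P q) := by
    intro q s
    rw [hmean, ← integral_inner (((hDP q).memLp_sub a₀ b₀).integrable one_le_two),
      (hDP q).integral_inner_increment hab (ζ := fun _ => s) measurable_const (memLp_const s)]
  refine ⟨inferInstance, fun q => ?_, fun q => ?_, fun q k hk => ?_, fun q => ?_,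
    fun q s lam ε k hk hε hlam => ?_, fun q => ?_, fun q => ?_⟩
  · rw [hQ, memLp_map_measure_iff (by fun_prop) (hY q).aemeasurable]
    exact ((hDP q).memLp_sub a₀ b₀).ae_eq (hinit q).symm
  · rw [hsq]
    exact (hDP q).integral_sq_sub_le hab
  · rw [hsq]
    refine ((hDP q).integral_sq_sub_le_integral hab hk).trans ?_
    gcongr
    exact (hDP q).integral_integral_sq_sub_le hab
  -- The mean is tested against itself, and one factor `‖m‖` is divided out.
  · set m := ∫ η, (η - q.1) ∂(vs.stepKernel hD.cb2_mem q) with hm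
    have h1 : ‖m‖ ^ 2 ≤ ‖m‖ * (M₁ * (θ - t)) := by
      rw [← real_inner_self_eq_norm_sq]
      conv_lhs => rw [hm]
      rw [hinner]
      refine (le_abs_self _).trans ?_
      rw [← Real.norm_eq_abs]
      refine (norm_integral_le_of_norm_le_const (C := ‖m‖ * (M₁ * (θ - t)))
        (ae_of_all _ fun ω => ?_)).trans_eq ?_
      swap
      · rw [probReal_univ, mul_one]
      exact (norm_inner_le_norm _ _).trans (mul_le_mul_of_nonneg_left
        ((hDP q).norm_integral_drift_le hab ω) (norm_nonneg _))
    rcases (norm_nonneg m).eq_or_lt with h0 | h0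
    · rw [← h0]
      exact mul_nonneg ((hDP q).drift_nonneg a₀) (sub_nonneg.2 htθ)
    · nlinarith
  · rw [hinner]
    have hI := (hDP q).integrable_integral_norm_sub a₀ b₀
    -- The drift along `Y` is compared with the drift frozen at `(t, ξ)`. Time costs `ε`; space
    -- costs `K ‖Y - ξ‖`, traded for `k + ‖Y - ξ‖² / k` so that only mean squares are needed. As
    -- `lam` bounds the frozen drift for every control `z`, averaging over the relaxed control is
    -- harmless.
    have hle : ∀ᵐ ω ∂(vs.P q), (θ - t) * (lam - ‖s‖ * (ε + K * k)) - ‖s‖ * K / k *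
        ∫ τ in Ioc a₀ b₀, ‖vs.Y q.1 q.2 τ ω - vs.Y q.1 q.2 a₀ ω‖ ^ 2 ∂(timeMeasure t θ)
        ≤ inner ℝ s (∫ τ in Ioc a₀ b₀, (∫ z, L.b τ (vs.Y q.1 q.2 τ ω) q.2 z
        ∂(vs.μ q.1 q.2 τ ω)) ∂(timeMeasure t θ)) := by
      filter_upwards [vs.ae_integrable_b hL hD ht hθ q.1 q.2, (hDP q).ae_integrable_drift,
        (hDP q).ae_integrable_sq_sub a₀, vs.initial q.1 q.2] with ω h1 h2 h3 h4
      rw [← integral_inner h2.integrableOn]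
      have h6 : ∫ τ in Ioc a₀ b₀, ((lam - ‖s‖ * (ε + K * k)) - ‖s‖ * K / k *
          ‖vs.Y q.1 q.2 τ ω - vs.Y q.1 q.2 a₀ ω‖ ^ 2) ∂(timeMeasure t θ)
          = (θ - t) * (lam - ‖s‖ * (ε + K * k)) - ‖s‖ * K / k *
        ∫ τ in Ioc a₀ b₀, ‖vs.Y q.1 q.2 τ ω - vs.Y q.1 q.2 a₀ ω‖ ^ 2 ∂(timeMeasure t θ) := by
        rw [integral_sub (integrable_const _) (h3.integrableOn.const_mul _), integral_const_mul,
          setIntegral_const, timeMeasure_real_Ioc hab, smul_eq_mul]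
      rw [← h6]
      refine integral_mono_ae ((integrable_const _).sub (h3.integrableOn.const_mul _))
        (h2.integrableOn.const_inner s) (ae_restrict_of_ae ?_)
      filter_upwards [h1] with τ h7
      have := vs.μ_prob q.1 q.2 τ ω
      rw [← integral_inner h7.1]
      have h8 : ∫ _, ((lam - ‖s‖ * (ε + K * k)) - ‖s‖ * K / k *
          ‖vs.Y q.1 q.2 τ ω - vs.Y q.1 q.2 a₀ ω‖ ^ 2) ∂(vs.μ q.1 q.2 τ ω)
          = ((lam - ‖s‖ * (ε + K * k)) - ‖s‖ * K / k *
          ‖vs.Y q.1 q.2 τ ω - vs.Y q.1 q.2 a₀ ω‖ ^ 2) := by simp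
      rw [← h8]
      refine integral_mono (integrable_const _) (h7.1.const_inner s) fun z => ?_
      have h9 := hlam z
      have h10 := hε τ τ.2 (vs.Y q.1 q.2 τ ω) q.2 z
      have h11 := (hL.lipschitz_b t ⟨ht, htθ.trans hθ⟩ q.2 z).dist_le_mul (vs.Y q.1 q.2 τ ω) q.1
      rw [dist_eq_norm, dist_eq_norm] at h11
      have h4' : vs.Y q.1 q.2 a₀ ω = q.1 := h4
      rw [h4']
      have h12 : inner ℝ s (L.b τ (vs.Y q.1 q.2 τ ω) q.2 z) = inner ℝ s (L.b t q.1 q.2 z)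
          + inner ℝ s (L.b τ (vs.Y q.1 q.2 τ ω) q.2 z - L.b t (vs.Y q.1 q.2 τ ω) q.2 z)
          + inner ℝ s (L.b t (vs.Y q.1 q.2 τ ω) q.2 z - L.b t q.1 q.2 z) := by
        simp only [inner_sub_right]; ring
      have h13 := (abs_le.1 (abs_real_inner_le_norm s
        (L.b τ (vs.Y q.1 q.2 τ ω) q.2 z - L.b t (vs.Y q.1 q.2 τ ω) q.2 z))).1
      have h14 := (abs_le.1 (abs_real_inner_le_norm s
        (L.b t (vs.Y q.1 q.2 τ ω) q.2 z - L.b t q.1 q.2 z))).1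
      have h15 := mul_le_mul_of_nonneg_left h10 (norm_nonneg s)
      have h16 := mul_le_mul_of_nonneg_left h11 (norm_nonneg s)
      have h17 := mul_le_mul_of_nonneg_left
        (le_add_sq_div (x := ‖vs.Y q.1 q.2 τ ω - q.1‖) hk)
        (mul_nonneg (norm_nonneg s) K.coe_nonneg)
      have h18 : ‖s‖ * K / k * ‖vs.Y q.1 q.2 τ ω - q.1‖ ^ 2
          = ‖s‖ * K * (‖vs.Y q.1 q.2 τ ω - q.1‖ ^ 2 / k) := by ring
      simp only
      rw [h12, h18]
      nlinarith
    have hJ := integrable_inner_of_memLp (memLp_const s) ((hDP q).memLp_integral_drift hab)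
    have hmono : ∫ ω, ((θ - t) * (lam - ‖s‖ * (ε + K * k)) - ‖s‖ * K / k *
        ∫ τ in Ioc a₀ b₀, ‖vs.Y q.1 q.2 τ ω - vs.Y q.1 q.2 a₀ ω‖ ^ 2 ∂(timeMeasure t θ))
        ∂(vs.P q) ≤ _ :=
      integral_mono_ae ((integrable_const _).sub (hI.const_mul _)) hJ hle
    refine le_trans ?_ hmono
    rw [integral_sub (integrable_const _) (hI.const_mul _), integral_const, integral_const_mul]
    have h20 := (hDP q).integral_integral_sq_sub_le hab
    have h21 : 0 ≤ ‖s‖ * K / k := by positivity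
    have h22 := mul_le_mul_of_nonneg_left h20 h21
    simp only [probReal_univ, one_smul]
    have h23 : (θ - t) * lam - ‖s‖ * ((θ - t) * (ε + K * (k
        + (2 * M₀ * (θ - t) + 4 * M₁ ^ 2 * (θ - t) ^ 2) / k)))
        = (θ - t) * (lam - ‖s‖ * (ε + K * k)) - ‖s‖ * K / k *
          ((θ - t) * (2 * M₀ * (θ - t) + 4 * M₁ ^ 2 * (θ - t) ^ 2)) := by ring
    rw [h23]
    exact sub_le_sub_left h22 _
  · rw [hQ, integrable_map_measure hc.aestronglyMeasurable (hY q).aemeasurable]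
    exact vs.integrable q.1 q.2
  · rw [hQ, integral_map (hY q).aemeasurable hc.aestronglyMeasurable]
    exact vs.le_expectation q.1 q.2

end VStableOn

theorem VStable.exists_guideStep {U V : Type*} [MeasurableSpace U] [MeasurableSpace V]
    [TopologicalSpace U] [TopologicalSpace V] [Nonempty V] {L : Generator d U V}
    {D : Set (E d → ℝ)} {c : ℝ → E d → ℝ} {g : E d → ℝ} {T M₀ M₁ : ℝ} {K : ℝ≥0}
    (hc : VStable.{w} L D g T c) (hL : L.Regular T M₀ M₁ K) (hD : IsTestClass L T D)
    {t θ : ℝ} (ht : 0 ≤ t) (htθ : t < θ) (hθ : θ ≤ T) :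
    ∃ Q, GuideStep L c M₀ M₁ K t θ Q := by
  obtain ⟨vs⟩ := hc.step t θ ht hθ htθ
  exact ⟨_, vs.guideStep hL hD ht hθ (hc.measurable θ ⟨ht.trans htθ.le, hθ⟩)⟩

end StochGame

/-! ### Measurable approximate saddle points and extremal shift -/

namespace StochGame

-- One value works on a whole neighbourhood of each point; by the Lindelöf property countably many
-- neighbourhoods suffice, and the first that contains `p` selects the value.
open Classical in
theorem exists_measurable_selector {X A : Type*} [TopologicalSpace X] [SecondCountableTopology X]
    [MeasurableSpace X] [OpensMeasurableSpace X] [MeasurableSpace A] [Nonempty A]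
    {R : X → A → Prop} (h : ∀ p, ∃ a, ∀ᶠ p' in 𝓝 p, R p' a) :
    ∃ f : X → A, Measurable f ∧ ∀ p, R p (f p) := by
  choose a ha using h
  have hO : ∀ p, ∃ O, (∀ p' ∈ O, R p' (a p)) ∧ IsOpen O ∧ p ∈ O := fun p =>
    eventually_nhds_iff.1 (ha p)
  choose O hOR hOo hOp using hO
  obtain ⟨S, hS, hcov⟩ := TopologicalSpace.countable_cover_nhds fun p => (hOo p).mem_nhds (hOp p)
  by_cases hX : Nonempty X
  swap
  · exact ⟨fun _ => Classical.arbitrary A, measurable_const, fun p => (hX ⟨p⟩).elim⟩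
  have hSne : S.Nonempty := by
    by_contra hne
    rw [not_nonempty_iff_eq_empty] at hne
    rw [hne, biUnion_empty] at hcov
    exact hX.elim fun x => (hcov ▸ mem_univ x : x ∈ (∅ : Set X)).elim
  obtain ⟨e, he⟩ := hS.exists_eq_range hSne
  have hex : ∀ p, ∃ n, p ∈ O (e n) := by
    intro p
    have hp : p ∈ ⋃ x ∈ S, O x := hcov ▸ mem_univ p
    rw [he] at hp
    simpa using hp
  refine ⟨fun p => a (e (Nat.find (hex p))), ?_, fun p => hOR _ _ (Nat.find_spec (hex p))⟩
  exact (measurable_of_countable fun n => a (e n)).comp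
    (measurable_find hex fun n => (hOo (e n)).measurableSet)

/-- Here `u` maximizes and `v` minimizes `F`, whereas the Isaacs condition has the opposite roles;
hence the sign in `hI`. The slack `η` makes the saddle inequality stable near `p`, so no exact
measurable selection is required. -/
theorem exists_measurable_saddle {X U V : Type*} [TopologicalSpace X] [SecondCountableTopology X]
    [MeasurableSpace X] [OpensMeasurableSpace X] [MeasurableSpace U] [Nonempty U]
    [MeasurableSpace V] [Nonempty V] {F : X → U → V → ℝ}
    (hbdd : ∀ p, ∃ M, ∀ u v, |F p u v| ≤ M)
    (hcont : ∀ p, ∀ ε > 0, ∀ᶠ p' in 𝓝 p, ∀ u v, |F p' u v - F p u v| ≤ ε)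
    (hI : ∀ p, (⨅ u, ⨆ v, -F p u v) = ⨆ v, ⨅ u, -F p u v) {η : ℝ} (hη : 0 < η) :
    ∃ f : X → U × V, Measurable f ∧ ∀ p u w, F p u (f p).2 ≤ F p (f p).1 w + η := by
  refine exists_measurable_selector (R := fun p (a : U × V) => ∀ u w, F p u a.2 ≤ F p a.1 w + η)
    fun p => ?_
  obtain ⟨M, hM⟩ := hbdd p
  set m := ⨅ u, ⨆ v, -F p u v with hm
  -- The slack is shared by four losses: near-optimality of `u₀` and of `v₀`, and the passage from
  -- `p` to `p'` on each side.
  have hη4 : 0 < η / 4 := by linarith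
  obtain ⟨u₀, hu₀⟩ := exists_lt_of_ciInf_lt (show (⨅ u, ⨆ v, -F p u v) < m + η / 4 by linarith)
  obtain ⟨v₀, hv₀⟩ := exists_lt_of_lt_ciSup
    (show m - η / 4 < ⨆ v, ⨅ u, -F p u v by rw [← hI p]; linarith)
  have h1 : ∀ w, -F p u₀ w < m + η / 4 := fun w => lt_of_le_of_lt
    (le_ciSup (f := fun v => -F p u₀ v) ⟨M, by
      rintro _ ⟨v, rfl⟩; linarith [(abs_le.1 (hM u₀ v)).1]⟩ w) hu₀
  have h2 : ∀ u, m - η / 4 < -F p u v₀ := fun u => lt_of_lt_of_le hv₀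
    (ciInf_le (f := fun u => -F p u v₀) ⟨-M, by
      rintro _ ⟨u, rfl⟩; linarith [(abs_le.1 (hM u v₀)).2]⟩ u)
  refine ⟨(u₀, v₀), ?_⟩
  filter_upwards [hcont p _ hη4] with p' hp' u w
  have h3 := (abs_le.1 (hp' u v₀)).2
  have h4 := (abs_le.1 (hp' u₀ w)).1
  linarith [h1 w, h2 u]

variable {d : ℕ} {U V : Type*} [TopologicalSpace U] [TopologicalSpace V]

theorem Generator.Regular.eventually_abs_inner_sub_le {L : Generator d U V} {T M₀ M₁ : ℝ} {K : ℝ≥0}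
    (hL : L.Regular T M₀ M₁ K) {t : ℝ} (ht : t ∈ Icc 0 T) {X : Type*} [TopologicalSpace X]
    {s z : X → E d} (hs : Continuous s) (hz : Continuous z) (p : X) {ε : ℝ} (hε : 0 < ε) :
    ∀ᶠ p' in 𝓝 p, ∀ u v,
      |inner ℝ (s p') (L.b t (z p') u v) - inner ℝ (s p) (L.b t (z p) u v)| ≤ ε := by
  have hlim : Tendsto (fun p' => ‖s p' - s p‖ * M₁ + ‖s p‖ * (K * ‖z p' - z p‖)) (𝓝 p)
      (𝓝 (‖s p - s p‖ * M₁ + ‖s p‖ * (K * ‖z p - z p‖))) := by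
    apply Continuous.tendsto (f := fun p' => ‖s p' - s p‖ * M₁ + ‖s p‖ * (K * ‖z p' - z p‖))
    fun_prop
  simp only [sub_self, norm_zero, zero_mul, mul_zero, add_zero] at hlim
  filter_upwards [hlim.eventually_lt_const hε] with p' hp' u v
  have h1 : inner ℝ (s p') (L.b t (z p') u v) - inner ℝ (s p) (L.b t (z p) u v)
      = inner ℝ (s p' - s p) (L.b t (z p') u v)
        + inner ℝ (s p) (L.b t (z p') u v - L.b t (z p) u v) := by
    rw [inner_sub_left, inner_sub_right]; ring
  rw [h1]
  have h2 := (hL.lipschitz_b t ht u v).dist_le_mul (z p') (z p)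
  rw [dist_eq_norm, dist_eq_norm] at h2
  have h3 := abs_real_inner_le_norm (s p' - s p) (L.b t (z p') u v)
  have h4 := abs_real_inner_le_norm (s p) (L.b t (z p') u v - L.b t (z p) u v)
  have h5 := mul_le_mul_of_nonneg_left (hL.bound_b t ht (z p') u v) (norm_nonneg (s p' - s p))
  have h6 := mul_le_mul_of_nonneg_left h2 (norm_nonneg (s p))
  refine (abs_add_le _ _).trans ?_
  linarith

theorem Generator.Isaacs.exists_saddle [MeasurableSpace U] [Nonempty U] [MeasurableSpace V]
    [Nonempty V] {L : Generator d U V} {T M₀ M₁ : ℝ} {K : ℝ≥0} (hI : L.Isaacs T)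
    (hL : L.Regular T M₀ M₁ K) {t : ℝ} (ht : t ∈ Icc 0 T) {X : Type*} [TopologicalSpace X]
    [SecondCountableTopology X] [MeasurableSpace X] [OpensMeasurableSpace X]
    {s z : X → E d} (hs : Continuous s) (hz : Continuous z) {η : ℝ} (hη : 0 < η) :
    ∃ f : X → U × V, Measurable f ∧ ∀ p u w, inner ℝ (s p) (L.b t (z p) u (f p).2)
      ≤ inner ℝ (s p) (L.b t (z p) (f p).1 w) + η := by
  refine exists_measurable_saddle (F := fun p u v => inner ℝ (s p) (L.b t (z p) u v))
    (fun p => ⟨‖s p‖ * M₁, fun u v => ?_⟩)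
    (fun p ε hε => hL.eventually_abs_inner_sub_le ht hs hz p hε) (fun p => ?_) hη
  · exact (abs_real_inner_le_norm _ _).trans
      (mul_le_mul_of_nonneg_left (hL.bound_b t ht _ u v) (norm_nonneg _))
  · simpa only [inner_neg_left] using hI t ht (z p) (-s p)

theorem norm_b_sub_b_le_sqrt_kappa {L₁ L₂ : Generator d U V} {T M₀₁ M₁₁ M₀₂ M₁₂ : ℝ}
    {K₁ K₂ : ℝ≥0} (hL₁ : L₁.Regular T M₀₁ M₁₁ K₁) (hL₂ : L₂.Regular T M₀₂ M₁₂ K₂) {t : ℝ}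
    (ht : t ∈ Icc 0 T) (x : E d) (u : U) (v : V) :
    ‖L₁.b t x u v - L₂.b t x u v‖ ≤ √(kappa L₁ L₂ T) := by
  refine Real.le_sqrt_of_sq_le (le_csSup ⟨(M₁₁ + M₁₂) ^ 2, ?_⟩ ⟨t, ht, x, u, v, rfl⟩)
  rintro _ ⟨t, ht, x, u, v, rfl⟩
  have h := (norm_sub_le _ _).trans (add_le_add (hL₁.bound_b t ht x u v) (hL₂.bound_b t ht x u v))
  gcongr

open Classical in
/-- Extremal shift: measurable selectors of the control of the second player for the motion and
of the control of the first player for the guide. -/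
theorem exists_extremal_shift [MeasurableSpace U] [Nonempty U] [MeasurableSpace V]
    [Nonempty V] {L₁ L₂ : Generator d U V} {T M₀₁ M₁₁ M₀₂ M₁₂ : ℝ}
    {K₁ K₂ : ℝ≥0} (hL₁ : L₁.Regular T M₀₁ M₁₁ K₁) (hL₂ : L₂.Regular T M₀₂ M₁₂ K₂)
    (hIsaacs : L₁.Isaacs T ∨ L₂.Isaacs T) {t : ℝ} (ht : t ∈ Icc 0 T) {η : ℝ} (hη : 0 < η) :
    ∃ f : E d × E d → U × V, Measurable f ∧ ∀ x y u w,
      inner ℝ (x - y) (L₁.b t x u (f (x, y)).2) ≤ inner ℝ (x - y) (L₂.b t y (f (x, y)).1 w)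
        + (if L₁.Isaacs T then (K₁ : ℝ) else (K₂ : ℝ)) * ‖x - y‖ ^ 2
        + ‖x - y‖ * √(kappa L₁ L₂ T) + η := by
  have hlip : ∀ {L : Generator d U V} {M₀ M₁ : ℝ} {K : ℝ≥0}, L.Regular T M₀ M₁ K → ∀ x y u v,
      inner ℝ (x - y) (L.b t x u v) ≤ inner ℝ (x - y) (L.b t y u v) + K * ‖x - y‖ ^ 2 := by
    intro L M₀ M₁ K hL x y u v
    have h2 := (hL.lipschitz_b t ht u v).dist_le_mul x y
    rw [dist_eq_norm, dist_eq_norm] at h2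
    have h4 := real_inner_le_norm (x - y) (L.b t x u v - L.b t y u v)
    rw [inner_sub_right] at h4
    have h6 := mul_le_mul_of_nonneg_left h2 (norm_nonneg (x - y))
    nlinarith
  have hdiff : ∀ x y z : E d, ∀ u v, inner ℝ (x - y) (L₁.b t z u v)
      ≤ inner ℝ (x - y) (L₂.b t z u v) + ‖x - y‖ * √(kappa L₁ L₂ T) := by
    intro x y z u v
    have h4 := real_inner_le_norm (x - y) (L₁.b t z u v - L₂.b t z u v)
    rw [inner_sub_right] at h4
    have h6 := mul_le_mul_of_nonneg_left (norm_b_sub_b_le_sqrt_kappa hL₁ hL₂ ht z u v)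
      (norm_nonneg (x - y))
    linarith
  have hs : Continuous fun p : E d × E d => p.1 - p.2 := continuous_fst.sub continuous_snd
  -- Under the condition for `b¹` the saddle is taken at the motion `x`, then `b¹` is moved from `x`
  -- to `y` and exchanged for `b²` at `y`. Otherwise `b¹` is first exchanged for `b²` at `x`, moved
  -- to `y`, and the saddle is taken at the guide. Either way only the Lipschitz constant of the
  -- Isaacs drift is spent.
  by_cases hI : L₁.Isaacs T
  · obtain ⟨f, hf, hfp⟩ := hI.exists_saddle hL₁ ht hs continuous_fst hη
    refine ⟨f, hf, fun x y u w => ?_⟩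
    rw [if_pos hI]
    have h1 := hfp (x, y) u w
    have h2 := hlip hL₁ x y (f (x, y)).1 w
    have h3 := hdiff x y y (f (x, y)).1 w
    simp only at h1
    linarith
  · obtain ⟨f, hf, hfp⟩ := (hIsaacs.resolve_left hI).exists_saddle hL₂ ht hs continuous_snd hη
    refine ⟨f, hf, fun x y u w => ?_⟩
    rw [if_neg hI]
    have h1 := hfp (x, y) u w
    have h2 := hlip hL₂ x y u (f (x, y)).2
    have h3 := hdiff x y x u (f (x, y)).2
    simp only at h1
    linarith

end StochGame

/-! ### The guide as a Markov chain and the resulting strategy -/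

namespace StochGame

theorem measurable_apply_natIndex {X A : Type*} {mX : MeasurableSpace X} [MeasurableSpace A]
    {n : X → ℕ} (hn : Measurable n) {H : ℕ → X → A} (hH : ∀ k, Measurable (H k)) :
    Measurable fun p => H (n p) p := by
  intro B hB
  have : (fun p => H (n p) p) ⁻¹' B = ⋃ k, n ⁻¹' {k} ∩ H k ⁻¹' B := by
    ext p
    simp
  rw [this]
  exact MeasurableSet.iUnion fun k => (hn (measurableSet_singleton k)).inter (hH k hB)

variable {d : ℕ} {t₀ T : ℝ}

theorem CadlagPath.measurable_eval (r : Icc t₀ T) :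
    Measurable (fun x : CadlagPath d t₀ T => x r) :=
  Measurable.of_comap_le (le_iSup (fun r : Icc t₀ T =>
    MeasurableSpace.comap (fun x : CadlagPath d t₀ T => x r) inferInstance) r)

theorem CadlagPath.measurable_eval_filtration {r s : Icc t₀ T} (hrs : r ≤ s) :
    Measurable[CadlagPath.filtration d t₀ T s] (fun x : CadlagPath d t₀ T => x r) :=
  Measurable.of_comap_le (le_iSup₂ (f := fun (r : Icc t₀ T) (_ : r ≤ s) =>
    MeasurableSpace.comap (fun x : CadlagPath d t₀ T => x r) inferInstance) r hrs)

/-- The positions of the guide that are known when only the indices in `I` have been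
revealed. -/
noncomputable def truncate (I : Set ℕ) (y : ℕ → E d) : ℕ → E d := I.indicator y

theorem measurable_truncate (I : Set ℕ) : Measurable (truncate (d := d) I) := by
  refine measurable_pi_iff.2 fun j => ?_
  by_cases hj : j ∈ I
  · simpa [truncate, hj] using measurable_pi_apply j
  · simp [truncate, hj]

theorem truncate_truncate {I J : Set ℕ} (h : I ⊆ J) (y : ℕ → E d) :
    truncate I (truncate J y) = truncate I y := by
  unfold truncate
  rw [indicator_indicator, inter_eq_left.2 h]

/-- The data of a stochastic guide: the correction times `τ`, the index `κ s` of the last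
correction before `s`, the selectors `f` and the transition kernels `Q` of the guide. -/
structure GuideData (d : ℕ) (t₀ T : ℝ) (U V : Type*) [MeasurableSpace U]
    [MeasurableSpace V] where
  τ : ℕ → Icc t₀ T
  τ_mono : Monotone τ
  κ : Icc t₀ T → ℕ
  measurable_κ : Measurable κ
  τ_κ_le : ∀ s, τ (κ s) ≤ s
  f : ℕ → E d × E d → U × V
  measurable_f : ∀ k, Measurable (f k)
  Q : ℕ → Kernel (E d × U) (E d)
  isMarkov_Q : ∀ k, IsMarkovKernel (Q k)
  x₀ : E d

namespace GuideData

attribute [instance] GuideData.isMarkov_Q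

variable {U V : Type*} [MeasurableSpace U] [MeasurableSpace V] (γ : GuideData d t₀ T U V)

/-- The transition kernel of the guide in terms of the path and the present position. -/
noncomputable def step (k : ℕ) : Kernel (CadlagPath d t₀ T × E d) (E d) :=
  (γ.Q k).comap (fun p => (p.2, (γ.f k (p.1 (γ.τ k), p.2)).1))
    (measurable_snd.prodMk (measurable_fst.comp ((γ.measurable_f k).comp
      (((CadlagPath.measurable_eval _).comp measurable_fst).prodMk measurable_snd))))

theorem step_apply (k : ℕ) (p : CadlagPath d t₀ T × E d) :
    γ.step k p = γ.Q k (p.2, (γ.f k (p.1 (γ.τ k), p.2)).1) := rfl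

instance (k : ℕ) : IsMarkovKernel (γ.step k) := by
  unfold step
  infer_instance

/-- The law of the first `k` positions of the guide along a given path. -/
noncomputable def chain : ℕ → Kernel (CadlagPath d t₀ T) (ℕ → E d)
  | 0 => Kernel.const _ (Measure.dirac fun _ => γ.x₀)
  | k + 1 => ((chain k) ⊗ₖ ((γ.step k).comap (fun p : CadlagPath d t₀ T × (ℕ → E d) =>
      (p.1, p.2 k)) (measurable_fst.prodMk ((measurable_pi_apply k).comp measurable_snd)))).map
      (fun q => Function.update q.1 (k + 1) q.2)

theorem measurable_update (k : ℕ) :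
    Measurable (fun q : (ℕ → E d) × E d => Function.update q.1 k q.2) := by
  refine measurable_pi_iff.2 fun j => ?_
  by_cases hj : j = k
  · subst hj
    simpa using measurable_snd
  · simpa [hj, Function.comp_def] using (measurable_pi_apply j).comp measurable_fst

instance isMarkov_chain (k : ℕ) : IsMarkovKernel (γ.chain k) := by
  induction k with
  | zero => unfold chain; infer_instance
  | succ k ih =>
    unfold chain
    exact Kernel.IsMarkovKernel.map _ (measurable_update _)

theorem chain_succ_apply (k : ℕ) (x : CadlagPath d t₀ T) {C : Set (ℕ → E d)}
    (hC : MeasurableSet C) :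
    γ.chain (k + 1) x C = ∫⁻ y, γ.step k (x, y k) {e | Function.update y (k + 1) e ∈ C}
      ∂(γ.chain k x) := by
  have h := measurable_update (d := d) (k + 1)
  rw [chain, Kernel.map_apply' _ h _ hC, Kernel.compProd_apply (h hC)]
  rfl

/-- Step `k` of the chain overwrites coordinate `k + 1` only, through a kernel of total mass one. -/
theorem chain_succ_apply_of_update_mem_iff {k : ℕ} (x : CadlagPath d t₀ T) {C : Set (ℕ → E d)}
    (hC : MeasurableSet C) (h : ∀ y e, Function.update y (k + 1) e ∈ C ↔ y ∈ C) :
    γ.chain (k + 1) x C = γ.chain k x C := by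
  rw [γ.chain_succ_apply k x hC, ← lintegral_indicator_one hC]
  refine lintegral_congr fun y => ?_
  simp only [h]
  by_cases hy : y ∈ C <;> simp [hy]

theorem chain_apply_of_le {k n : ℕ} (hkn : k ≤ n) (x : CadlagPath d t₀ T) {C : Set (ℕ → E d)}
    (hC : MeasurableSet C)
    (h : ∀ j, k < j → ∀ y e, Function.update y j e ∈ C ↔ y ∈ C) :
    γ.chain n x C = γ.chain k x C := by
  induction n, hkn using Nat.le_induction with
  | base => rfl
  | succ n hn ih =>
    rw [γ.chain_succ_apply_of_update_mem_iff x hC (h (n + 1) (Nat.lt_succ_of_le hn)), ih]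

/-- The strict bound `j < k` reflects that position `k` is drawn from the path at the preceding
correction time. -/
theorem chain_eq_of_eq (k : ℕ) {x y : CadlagPath d t₀ T} (h : ∀ j < k, x (γ.τ j) = y (γ.τ j)) :
    γ.chain k x = γ.chain k y := by
  induction k with
  | zero => rfl
  | succ k ih =>
    ext C hC
    rw [γ.chain_succ_apply k x hC, γ.chain_succ_apply k y hC,
      ih fun j hj => h j (hj.trans (Nat.lt_succ_self k))]
    simp_rw [step_apply, h k (Nat.lt_succ_self k)]

/-- Nonanticipation of the guide. If the last correction time is at most `t`, every path value
consulted agrees; otherwise the last position is erased by the truncation and does not matter. -/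
theorem chain_apply_eq_of_truncate (n : ℕ) {t : Icc t₀ T} {x y : CadlagPath d t₀ T}
    (h : ∀ s ≤ t, x s = y s) {C : Set (ℕ → E d)} (hC : MeasurableSet C) :
    γ.chain n x (truncate {j | γ.τ j ≤ t} ⁻¹' C) = γ.chain n y (truncate {j | γ.τ j ≤ t} ⁻¹' C) := by
  induction n with
  | zero => rfl
  | succ n ih =>
    by_cases hn : γ.τ (n + 1) ≤ t
    · rw [γ.chain_eq_of_eq (n + 1) fun j hj => h _ ((γ.τ_mono hj.le).trans hn)]
    · have hu : ∀ y e, Function.update y (n + 1) e ∈ truncate {j | γ.τ j ≤ t} ⁻¹' C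
          ↔ y ∈ truncate (d := d) {j | γ.τ j ≤ t} ⁻¹' C := by
        intro y e
        have : truncate {j | γ.τ j ≤ t} (Function.update y (n + 1) e)
            = truncate {j | γ.τ j ≤ t} y := by
          ext1 j
          by_cases hj : j = n + 1
          · subst hj
            simp [truncate, hn]
          · simp [truncate, indicator, hj]
        rw [mem_preimage, this, mem_preimage]
      rw [γ.chain_succ_apply_of_update_mem_iff x (measurable_truncate _ hC) hu,
        γ.chain_succ_apply_of_update_mem_iff y (measurable_truncate _ hC) hu, ih]

/-- The filtration generated by the positions of the guide. -/
noncomputable def filtration :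
    Filtration (Icc t₀ T) (inferInstance : MeasurableSpace (ULift.{w} (ℕ → E d))) where
  seq s := MeasurableSpace.comap (fun y => truncate {j | γ.τ j ≤ s} y.down) inferInstance
  mono' s t hst := by
    refine Measurable.comap_le ?_
    have h1 : (fun y : ULift.{w} (ℕ → E d) => truncate {j | γ.τ j ≤ s} y.down)
        = truncate {j | γ.τ j ≤ s} ∘ fun y => truncate {j | γ.τ j ≤ t} y.down := by
      ext1 y
      exact (truncate_truncate (fun j (hj : γ.τ j ≤ s) => hj.trans hst) _).symm
    rw [h1]
    exact (measurable_truncate _).comp (comap_measurable _)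
  le' s := ((measurable_truncate _).comp measurable_down).comap_le

theorem measurable_filtration {k : ℕ} {s : Icc t₀ T} (h : γ.τ k ≤ s) :
    Measurable[γ.filtration s] (fun y : ULift.{w} (ℕ → E d) => y.down k) := by
  have h1 : (fun y : ULift.{w} (ℕ → E d) => y.down k)
      = (fun z : ℕ → E d => z k) ∘ fun y => truncate {j | γ.τ j ≤ s} y.down := by
    ext1 y
    simp [truncate, h]
  rw [h1]
  exact (measurable_pi_apply k).comp (comap_measurable _)

/-- The control of the second player aimed at the guide. -/
noncomputable def control (x : CadlagPath d t₀ T) (s : Icc t₀ T) (y : ULift.{w} (ℕ → E d)) : V :=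
  (γ.f (γ.κ s) (x (γ.τ (γ.κ s)), y.down (γ.κ s))).2

theorem measurable_control [Nonempty V] (t : Icc t₀ T) :
    Measurable[MeasurableSpace.prod (CadlagPath.filtration d t₀ T t)
        (MeasurableSpace.prod (inferInstance : MeasurableSpace (Iic t)) (γ.filtration t))]
      (fun q : CadlagPath d t₀ T × Iic t × ULift.{w} (ℕ → E d) =>
        γ.control q.1 q.2.1 q.2.2) := by
  classical
  -- The default value is never taken, since `τ (κ s) ≤ s ≤ t`. It makes each `H k` measurable with
  -- respect to the information available at `t`.
  set H : ℕ → CadlagPath d t₀ T × Iic t × ULift.{w} (ℕ → E d) → V := fun k q =>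
    if γ.τ k ≤ t then (γ.f k (q.1 (γ.τ k), q.2.2.down k)).2 else Classical.arbitrary V with hH
  have h1 : (fun q : CadlagPath d t₀ T × Iic t × ULift.{w} (ℕ → E d) =>
        γ.control q.1 q.2.1 q.2.2) = fun q => H (γ.κ q.2.1) q := by
    ext1 q
    simp only [hH]
    rw [if_pos ((γ.τ_κ_le _).trans q.2.1.2)]
    rfl
  rw [h1]
  refine @measurable_apply_natIndex _ _ (MeasurableSpace.prod (CadlagPath.filtration d t₀ T t)
        (MeasurableSpace.prod (inferInstance : MeasurableSpace (Iic t)) (γ.filtration t))) _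
    (fun q => γ.κ q.2.1) ?_ H fun k => ?_
  · exact γ.measurable_κ.comp (measurable_subtype_coe.comp
      ((@measurable_fst _ _ _ (γ.filtration t)).comp (@measurable_snd _ _
        (CadlagPath.filtration d t₀ T t) (MeasurableSpace.prod _ (γ.filtration t)))))
  · by_cases hk : γ.τ k ≤ t
    · simp only [hH, if_pos hk]
      refine measurable_snd.comp ((γ.measurable_f k).comp (Measurable.prodMk ?_ ?_))
      · exact (CadlagPath.measurable_eval_filtration hk).comp (@measurable_fst _ _
          (CadlagPath.filtration d t₀ T t) (MeasurableSpace.prod _ (γ.filtration t)))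
      · exact (γ.measurable_filtration hk).comp
          ((@measurable_snd _ _ _ (γ.filtration t)).comp (@measurable_snd _ _
        (CadlagPath.filtration d t₀ T t) (MeasurableSpace.prod _ (γ.filtration t))))
    · simp only [hH, if_neg hk]
      exact measurable_const

/-- The strategy of the second player with `n` steps of the guide. -/
noncomputable def strategy [Nonempty V] (n : ℕ) : Strategy.{w} d t₀ T V where
  Ω := ULift.{w} (ℕ → E d)
  ℱ := γ.filtration
  control := γ.control
  P := (γ.chain n).map ULift.up
  isMarkov := Kernel.IsMarkovKernel.map _ measurable_up
  progressive x s := by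
    have h1 : Measurable[MeasurableSpace.prod (inferInstance : MeasurableSpace (Iic s))
        (γ.filtration s), MeasurableSpace.prod (CadlagPath.filtration d t₀ T s)
        (MeasurableSpace.prod (inferInstance : MeasurableSpace (Iic s)) (γ.filtration s))]
        (fun p : Iic s × ULift.{w} (ℕ → E d) => (x, p)) :=
      Measurable.prodMk measurable_const measurable_id
    exact (γ.measurable_control s).comp h1
  prob_nonanticipative t x y h B hB := by
    obtain ⟨C, hC, rfl⟩ := hB
    have hm : MeasurableSet ((fun y : ULift.{w} (ℕ → E d) =>
        truncate {j | γ.τ j ≤ t} y.down) ⁻¹' C) :=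
      (measurable_truncate _).comp measurable_down hC
    rw [Kernel.map_apply' _ measurable_up _ hm, Kernel.map_apply' _ measurable_up _ hm]
    exact γ.chain_apply_eq_of_truncate n (fun s hs => (h s hs).symm) hC
  control_nonanticipative t x y h s hs := by
    refine ae_of_all _ fun ω => ?_
    unfold control
    rw [h _ ((γ.τ_κ_le s).trans hs)]
  measurable_control := γ.measurable_control

end GuideData

end StochGame

/-! ### Joint law of the motion and the guide -/

namespace StochGame

variable {d : ℕ} {t₀ T : ℝ}

/-- By right continuity the evaluation is a limit of evaluations at grid times approaching from the
right. -/
theorem CadlagPath.measurable_eval_uncurry :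
    Measurable (fun p : Icc t₀ T × CadlagPath d t₀ T => p.2 p.1) := by
  by_cases hT : t₀ ≤ T
  swap
  · have : IsEmpty (Icc t₀ T) := ⟨fun s => hT (s.2.1.trans s.2.2)⟩
    exact measurable_of_empty _
  -- The shift `k + 1` puts the grid point to the right of `s`; the minimum keeps it in the
  -- interval.
  set r : ℕ → ℕ → Icc t₀ T := fun n k => ⟨min T (t₀ + (k + 1) / (n + 1)),
    le_min hT (le_add_of_nonneg_right (by positivity)), min_le_left _ _⟩ with hr
  set κ : ℕ → Icc t₀ T → ℕ := fun n s => ⌊((s : ℝ) - t₀) * (n + 1)⌋₊ with hκ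
  have hle : ∀ n s, s ≤ r n (κ n s) := by
    intro n s
    refine Subtype.coe_le_coe.1 (le_min s.2.2 ?_)
    have h1 := (Nat.lt_floor_add_one (((s : ℝ) - t₀) * (n + 1))).le
    rw [← sub_le_iff_le_add', le_div_iff₀ (by positivity)]
    exact h1
  have hge : ∀ n s, ((r n (κ n s) : Icc t₀ T) : ℝ) ≤ s + 1 / ((n : ℝ) + 1) := by
    intro n s
    refine (min_le_right _ _).trans ?_
    have h1 : (κ n s : ℝ) ≤ ((s : ℝ) - t₀) * (n + 1) :=
      Nat.floor_le (mul_nonneg (sub_nonneg.2 s.2.1) (by positivity))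
    rw [add_div]
    have : (κ n s : ℝ) / (n + 1) ≤ s - t₀ := by rwa [div_le_iff₀ (by positivity)]
    linarith
  refine measurable_of_tendsto_metrizable
    (f := fun n (p : Icc t₀ T × CadlagPath d t₀ T) => p.2 (r n (κ n p.1))) (fun n => ?_) ?_
  · refine measurable_apply_natIndex (n := fun p : Icc t₀ T × CadlagPath d t₀ T => κ n p.1)
      (H := fun k p => p.2 (r n k)) ?_ fun k => (CadlagPath.measurable_eval _).comp measurable_snd
    exact Nat.measurable_floor.comp
      (((measurable_subtype_coe.comp measurable_fst).sub_const _).mul_const _)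
  · rw [tendsto_pi_nhds]
    rintro ⟨s, x⟩
    refine (x.2 s).1.tendsto.comp (tendsto_nhdsWithin_iff.2
      ⟨?_, Eventually.of_forall fun n => hle n s⟩)
    rw [tendsto_subtype_rng]
    refine tendsto_of_tendsto_of_tendsto_of_le_of_le tendsto_const_nhds ?_
      (fun n => Subtype.coe_le_coe.2 (hle n s)) (fun n => hge n s)
    simpa using (tendsto_one_div_add_atTop_nhds_zero_nat (𝕜 := ℝ)).const_add (s : ℝ)

variable {U V : Type*} [MeasurableSpace U] [MeasurableSpace V]

namespace Realization

attribute [instance] Realization.mΩ Realization.isProb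

variable {L : Generator d U V} {D : Set (E d → ℝ)} {ht₀ : t₀ ≤ T} {x₀ : E d}
  {𝔲 : Strategy.{w} d t₀ T U} {𝔳 : Strategy.{w} d t₀ T V} (ρ : Realization L D ht₀ x₀ 𝔲 𝔳)

theorem measurable_X_eval (s : Icc t₀ T) : Measurable fun ω => ρ.X ω s :=
  (ρ.adapted s).mono ((prodFiltration ρ.ℱ 𝔲.ℱ 𝔳.ℱ).le s) le_rfl

theorem measurable_X : Measurable ρ.X := by
  refine Measurable.of_le_map (iSup_le fun r => ?_)
  rw [← MeasurableSpace.comap_le_iff_le_map, MeasurableSpace.comap_comp]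
  exact (ρ.measurable_X_eval r).comap_le

/-- The joint law of the path and of the random element of the second player. -/
theorem map_prod_eq :
    ρ.P.map (fun ω => (ρ.X ω, ω.2.2)) = (ρ.P.map ρ.X) ⊗ₘ 𝔳.P := by
  have hX := ρ.measurable_X
  have hm : Measurable (fun ω => (ρ.X ω, ω.2.2)) := hX.prodMk measurable_snd.snd
  have := Measure.isProbabilityMeasure_map (μ := ρ.P) hX.aemeasurable
  have := Measure.isProbabilityMeasure_map (μ := ρ.P) hm.aemeasurable
  refine Measure.ext_prod fun {s t} hs ht => ?_
  rw [Measure.map_apply hm (hs.prod ht), Measure.compProd_apply_prod hs ht,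
    setLIntegral_map hs (Kernel.measurable_coe _ ht) hX]
  -- Rectangles determine the joint law, so it suffices to test the conditional law on indicators.
  have hcond := ρ.cond_v (t.indicator 1) (measurable_one.indicator ht) ⟨1, fun z => by
    by_cases hz : z ∈ t <;> simp [hz]⟩
  have hXs : MeasurableSet[MeasurableSpace.comap ρ.X inferInstance] (ρ.X ⁻¹' s) := ⟨s, hs, rfl⟩
  have hint : Integrable (fun ω => t.indicator (1 : 𝔳.Ω → ℝ) ω.2.2) ρ.P := by
    refine Integrable.of_bound (C := 1) ?_ (ae_of_all _ fun ω => ?_)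
    · exact ((measurable_one.indicator ht).comp measurable_snd.snd).aestronglyMeasurable
    · by_cases hz : ω.2.2 ∈ t <;> simp [hz]
  have h1 := setIntegral_condExp hX.comap_le hint hXs
  rw [setIntegral_congr_ae (g := fun ω => (𝔳.P (ρ.X ω)).real t) (hX hs)
    (by filter_upwards [hcond] with ω hω _; rw [hω, integral_indicator_one ht])] at h1
  have h2 : ∫ ω in ρ.X ⁻¹' s, t.indicator (1 : 𝔳.Ω → ℝ) ω.2.2 ∂ρ.P
      = ρ.P.real ((fun ω => (ρ.X ω, ω.2.2)) ⁻¹' s ×ˢ t) := by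
    have h3 : (fun ω : ρ.Ω × 𝔲.Ω × 𝔳.Ω => t.indicator (1 : 𝔳.Ω → ℝ) ω.2.2)
        = ((fun ω : ρ.Ω × 𝔲.Ω × 𝔳.Ω => ω.2.2) ⁻¹' t).indicator 1 := rfl
    have h4 : MeasurableSet ((fun ω : ρ.Ω × 𝔲.Ω × 𝔳.Ω => ω.2.2) ⁻¹' t) := measurable_snd.snd ht
    rw [h3, integral_indicator_one h4, measureReal_restrict_apply h4, inter_comm]
    rfl
  simp only [measureReal_def (𝔳.P _)] at h1
  rw [h2, integral_toReal] at h1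
  · rw [measureReal_def, ENNReal.toReal_eq_toReal_iff'] at h1
    · exact h1.symm
    · refine ne_top_of_le_ne_top ENNReal.one_ne_top ?_
      refine (setLIntegral_le_lintegral _ _).trans
        ((lintegral_mono fun ω => prob_le_one).trans_eq ?_)
      simp
    · exact measure_ne_top _ _
  · exact ((Kernel.measurable_coe _ ht).comp hX).aemeasurable
  · exact ae_of_all _ fun ω => measure_lt_top _ _

theorem driftProcess_path [TopologicalSpace U] [TopologicalSpace V] {M₀ M₁ : ℝ} {K : ℝ≥0}
    (hL : L.Regular T M₀ M₁ K) (hD : IsTestClass L T D) (h0 : 0 ≤ t₀) :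
    DriftProcess (prodFiltration ρ.ℱ 𝔲.ℱ 𝔳.ℱ) ρ.P M₀ M₁ (fun s ω => ρ.X ω s)
      (fun τ ω => L.Sig τ (ρ.X ω τ) (𝔲.control (ρ.X ω) τ ω.2.1) (𝔳.control (ρ.X ω) τ ω.2.2))
      (fun τ ω => L.b τ (ρ.X ω τ) (𝔲.control (ρ.X ω) τ ω.2.1)
        (𝔳.control (ρ.X ω) τ ω.2.2)) := by
  have hmem : ∀ τ : Icc t₀ T, (τ : ℝ) ∈ Icc 0 T := fun τ => ⟨h0.trans τ.2.1, τ.2.2⟩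
  refine ⟨?_, ρ.adapted, fun τ ω => hL.bound_Sig τ (hmem τ) _ _ _,
    fun τ ω => hL.bound_b τ (hmem τ) _ _ _,
    fun a => ⟨_, ρ.dynkin _ (hD.quadratic_mem a), ae_of_all _ fun ω => ae_of_all _ fun τ => ?_⟩⟩
  · exact CadlagPath.measurable_eval_uncurry.comp
      (measurable_fst.prodMk (ρ.measurable_X.comp measurable_snd))
  · exact L.apply_normSq_sub (hL.secondMoment τ (hmem τ) _ _ _) a

end Realization

namespace GuideData

variable (γ : GuideData d t₀ T U V)

theorem measurable_pair (k : ℕ) : Measurable fun y : ℕ → E d => (y k, y (k + 1)) :=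
  (measurable_pi_apply k).prodMk (measurable_pi_apply (k + 1))

theorem measurableSet_pair (k : ℕ) {A : Set (E d × E d)} (hA : MeasurableSet A) :
    MeasurableSet {y : ℕ → E d | (y k, y (k + 1)) ∈ A} := measurable_pair k hA

/-- Later steps touch only later coordinates, so the pair can be read at stage `k + 1`; the law of
position `k` is likewise the same at stages `k` and `n`. -/
theorem chain_apply_pair {k n : ℕ} (hkn : k + 1 ≤ n) (x : CadlagPath d t₀ T)
    {A : Set (E d × E d)} (hA : MeasurableSet A) :
    γ.chain n x {y | (y k, y (k + 1)) ∈ A}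
      = ∫⁻ y, γ.step k (x, y k) (Prod.mk (y k) ⁻¹' A) ∂(γ.chain n x) := by
  have h1 : γ.chain n x {y | (y k, y (k + 1)) ∈ A} = γ.chain (k + 1) x {y | (y k, y (k + 1)) ∈ A} :=
    γ.chain_apply_of_le hkn x (measurableSet_pair k hA) fun j hj y e => by
      simp only [mem_ofPred_eq]
      rw [Function.update_of_ne (by omega), Function.update_of_ne (by omega)]
  have h2 : γ.chain (k + 1) x {y | (y k, y (k + 1)) ∈ A}
      = ∫⁻ y, γ.step k (x, y k) (Prod.mk (y k) ⁻¹' A) ∂(γ.chain k x) := by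
    rw [γ.chain_succ_apply k x (measurableSet_pair k hA)]
    refine lintegral_congr fun y => ?_
    congr 1
    ext e
    simp
  have h3 : (γ.chain n x).map (fun y => y k) = (γ.chain k x).map (fun y => y k) := by
    ext C hC
    rw [Measure.map_apply (measurable_pi_apply k) hC, Measure.map_apply (measurable_pi_apply k) hC]
    refine γ.chain_apply_of_le (by omega) x (measurable_pi_apply k hC) fun j hj y e => ?_
    rw [mem_preimage, Function.update_of_ne (by omega), mem_preimage]
  have h4 : Measurable fun η : E d => γ.step k (x, η) (Prod.mk η ⁻¹' A) :=
    Kernel.measurable_kernel_prodMk_left (κ := (γ.step k).comap (fun η => (x, η))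
      measurable_prodMk_left) hA
  rw [h1, h2, ← lintegral_map h4 (measurable_pi_apply k), ← h3,
    lintegral_map h4 (measurable_pi_apply k)]

theorem chain_zero_eq (n : ℕ) (x : CadlagPath d t₀ T) : ∀ᵐ y ∂(γ.chain n x), y 0 = γ.x₀ := by
  have hm : MeasurableSet {y : ℕ → E d | ¬ y 0 = γ.x₀} :=
    (measurableSet_eq_fun (measurable_pi_apply 0) measurable_const).compl
  rw [ae_iff, γ.chain_apply_of_le (Nat.zero_le n) x hm fun j hj y e => by
    rw [mem_ofPred_eq, Function.update_of_ne (by omega), mem_ofPred_eq]]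
  simp [chain, Measure.dirac_apply' _ hm]

variable [Nonempty V]

/-- The positions of the guide as a random element on the space of the strategy. -/
noncomputable def guidePath (n : ℕ) (y : (γ.strategy.{w} n).Ω) : ℕ → E d :=
  @ULift.down.{w} (ℕ → E d) y

theorem measurable_guidePath (n : ℕ) : Measurable (γ.guidePath.{w} n) :=
  measurable_down

theorem measurable_guidePath_filtration (n : ℕ) {k : ℕ} {s : Icc t₀ T} (h : γ.τ k ≤ s) :
    Measurable[(γ.strategy.{w} n).ℱ s] fun y => γ.guidePath n y k :=
  γ.measurable_filtration h

theorem strategy_P_apply (n : ℕ) (x : CadlagPath d t₀ T) {C : Set (ℕ → E d)}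
    (hC : MeasurableSet C) : (γ.strategy.{w} n).P x (γ.guidePath n ⁻¹' C) = γ.chain n x C :=
  Kernel.map_apply' _ measurable_up _ (measurable_down hC)

variable {L : Generator d U V} {D : Set (E d → ℝ)} {ht₀ : t₀ ≤ T} {x₀ : E d}
  {𝔲 : Strategy.{w} d t₀ T U} {n : ℕ}
  (ρ : Realization L D ht₀ x₀ 𝔲 (γ.strategy.{w} n))

/-- The position of the guide after `k` steps along a realization. -/
noncomputable def position (k : ℕ) (ω : ρ.Ω × 𝔲.Ω × (γ.strategy.{w} n).Ω) : E d :=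
  γ.guidePath.{w} n ω.2.2 k

theorem measurable_position (k : ℕ) : Measurable (γ.position ρ k) :=
  (measurable_pi_apply k).comp ((γ.measurable_guidePath n).comp measurable_snd.snd)

theorem map_path_guide_eq :
    ρ.P.map (fun ω => (ρ.X ω, γ.guidePath.{w} n ω.2.2))
      = (ρ.P.map ρ.X) ⊗ₘ (γ.chain n) := by
  have hX := ρ.measurable_X
  have hm : Measurable (fun ω => (ρ.X ω, ω.2.2)) := hX.prodMk measurable_snd.snd
  have hm' : Measurable (fun ω : ρ.Ω × 𝔲.Ω × (γ.strategy.{w} n).Ω =>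
      (ρ.X ω, γ.guidePath.{w} n ω.2.2)) :=
    hX.prodMk ((γ.measurable_guidePath n).comp measurable_snd.snd)
  have := Measure.isProbabilityMeasure_map (μ := ρ.P) hX.aemeasurable
  have := Measure.isProbabilityMeasure_map (μ := ρ.P) hm'.aemeasurable
  refine Measure.ext_prod fun {s t} hs ht => ?_
  have ht' := γ.measurable_guidePath.{w} n ht
  have h1 := congrArg (fun μ => μ (s ×ˢ (γ.guidePath n ⁻¹' t))) ρ.map_prod_eq
  rw [Measure.map_apply hm (hs.prod ht'), Measure.compProd_apply_prod hs ht'] at h1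
  rw [Measure.map_apply hm' (hs.prod ht), Measure.compProd_apply_prod hs ht]
  exact h1.trans (lintegral_congr fun x => γ.strategy_P_apply n x ht)

/-- The joint law of the path and of two successive positions of the guide. -/
theorem map_position_succ_eq {k : ℕ} (hk : k + 1 ≤ n) :
    ρ.P.map (fun ω => ((ρ.X ω, γ.position ρ k ω), γ.position ρ (k + 1) ω))
      = (ρ.P.map fun ω => (ρ.X ω, γ.position ρ k ω)) ⊗ₘ (γ.step k) := by
  have hX := ρ.measurable_X
  have hm1 : Measurable fun ω => (ρ.X ω, γ.position ρ k ω) :=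
    hX.prodMk (γ.measurable_position ρ k)
  have hm := hm1.prodMk (γ.measurable_position ρ (k + 1))
  have hm' : Measurable (fun ω : ρ.Ω × 𝔲.Ω × (γ.strategy.{w} n).Ω =>
      (ρ.X ω, γ.guidePath.{w} n ω.2.2)) :=
    hX.prodMk ((γ.measurable_guidePath n).comp measurable_snd.snd)
  have hp := Measure.isProbabilityMeasure_map (μ := ρ.P) hX.aemeasurable
  have hp1 := Measure.isProbabilityMeasure_map (μ := ρ.P) hm1.aemeasurable
  ext A hA
  have he : Measurable fun p : CadlagPath d t₀ T × (ℕ → E d) => ((p.1, p.2 k), p.2 (k + 1)) :=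
    (measurable_fst.prodMk ((measurable_pi_apply k).comp measurable_snd)).prodMk
      ((measurable_pi_apply (k + 1)).comp measurable_snd)
  have hstep : Measurable fun p : CadlagPath d t₀ T × E d => γ.step k p (Prod.mk p ⁻¹' A) :=
    Kernel.measurable_kernel_prodMk_left hA
  have hk' : Measurable fun p : CadlagPath d t₀ T × (ℕ → E d) => (p.1, p.2 k) :=
    measurable_fst.prodMk ((measurable_pi_apply k).comp measurable_snd)
  rw [Measure.compProd_apply hA, lintegral_map hstep hm1, Measure.map_apply hm hA]
  have h1 : ρ.P ((fun ω => ((ρ.X ω, γ.position ρ k ω), γ.position ρ (k + 1) ω)) ⁻¹' A)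
      = (ρ.P.map (fun ω => (ρ.X ω, γ.guidePath.{w} n ω.2.2)))
        ((fun p => ((p.1, p.2 k), p.2 (k + 1))) ⁻¹' A) := by
    rw [Measure.map_apply hm' (he hA)]
    rfl
  have h2 : ∫⁻ ω, γ.step k (ρ.X ω, γ.position ρ k ω) (Prod.mk (ρ.X ω, γ.position ρ k ω) ⁻¹' A) ∂ρ.P
      = ∫⁻ p, γ.step k (p.1, p.2 k) (Prod.mk (p.1, p.2 k) ⁻¹' A)
        ∂(ρ.P.map (fun ω => (ρ.X ω, γ.guidePath.{w} n ω.2.2))) := by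
    exact (lintegral_map (hstep.comp hk') hm').symm
  rw [h1, h2, γ.map_path_guide_eq ρ, Measure.compProd_apply (he hA)]
  -- The comparison is made for each fixed full path, its future included. This conditioning is what
  -- later decouples the guide's step from the motion's increment over the same interval.
  refine Eq.trans ?_ (Measure.lintegral_compProd (hstep.comp hk')).symm
  refine lintegral_congr fun x => ?_
  exact γ.chain_apply_pair hk x (A := (fun q : E d × E d => ((x, q.1), q.2)) ⁻¹' A)
    (((measurable_const.prodMk measurable_fst).prodMk measurable_snd) hA)

theorem position_zero : ∀ᵐ ω ∂ρ.P, γ.position ρ 0 ω = γ.x₀ := by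
  have hX := ρ.measurable_X
  have hm' : Measurable (fun ω : ρ.Ω × 𝔲.Ω × (γ.strategy.{w} n).Ω =>
      (ρ.X ω, γ.guidePath.{w} n ω.2.2)) :=
    hX.prodMk ((γ.measurable_guidePath n).comp measurable_snd.snd)
  have hp := Measure.isProbabilityMeasure_map (μ := ρ.P) hX.aemeasurable
  have hA : MeasurableSet {p : CadlagPath d t₀ T × (ℕ → E d) | p.2 0 = γ.x₀} :=
    measurableSet_eq_fun ((measurable_pi_apply 0).comp measurable_snd) measurable_const
  have h1 : ∀ᵐ p ∂(ρ.P.map (fun ω => (ρ.X ω, γ.guidePath.{w} n ω.2.2))),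
      p.2 0 = γ.x₀ := by
    rw [γ.map_path_guide_eq ρ, Measure.ae_compProd_iff hA]
    exact ae_of_all _ fun x => γ.chain_zero_eq n x
  exact (ae_map_iff hm'.aemeasurable hA).1 h1

end GuideData

end StochGame

/-! ### Integration over one guide step and growth of the stable function -/

namespace StochGame

variable {d : ℕ} {t₀ T : ℝ} {U V : Type*} [MeasurableSpace U]

theorem GuideStep.integral_norm_le {L : Generator d U V} {c : ℝ → E d → ℝ} {M₀ M₁ : ℝ} {K : ℝ≥0}
    {t θ : ℝ} {Q : Kernel (E d × U) (E d)} (h : GuideStep L c M₀ M₁ K t θ Q) (q : E d × U) :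
    ∫ η, ‖η - q.1‖ ∂(Q q) ≤ 1 + (2 * M₀ * (θ - t) + 4 * M₁ ^ 2 * (θ - t) ^ 2) := by
  have := h.isMarkov
  have hi := integrable_norm_sq (h.memLp q)
  have h1 : ∫ η, ‖η - q.1‖ ∂(Q q) ≤ ∫ η, (1 + ‖η - q.1‖ ^ 2) ∂(Q q) :=
    integral_mono ((h.memLp q).integrable one_le_two).norm ((integrable_const 1).add hi)
      fun η => by simpa using le_add_sq_div (x := ‖η - q.1‖) one_pos
  rw [integral_add (integrable_const 1) hi] at h1
  simp only [integral_const, probReal_univ, one_smul] at h1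
  linarith [h.integral_sq_le q]

theorem GuideStep.abs_integral_lipschitz_sub_le {L : Generator d U V} {c : ℝ → E d → ℝ}
    {M₀ M₁ : ℝ} {K : ℝ≥0}
    {t θ : ℝ} {Q : Kernel (E d × U) (E d)} (h : GuideStep L c M₀ M₁ K t θ Q) {g : E d → ℝ} {R : ℝ≥0}
    (hg : LipschitzWith R g) (q : E d × U) :
    Integrable g (Q q) ∧ |∫ η, g η ∂(Q q) - g q.1|
      ≤ R * (1 + (2 * M₀ * (θ - t) + 4 * M₁ ^ 2 * (θ - t) ^ 2)) := by
  have := h.isMarkov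
  have hn := ((h.memLp q).integrable one_le_two).norm
  have hle : ∀ η, ‖g η - g q.1‖ ≤ R * ‖η - q.1‖ := fun η => by
    simpa [dist_eq_norm] using hg.dist_le_mul η q.1
  have hd : Integrable (fun η => g η - g q.1) (Q q) :=
    (hn.const_mul (R : ℝ)).mono (hg.continuous.sub continuous_const).aestronglyMeasurable
      (ae_of_all _ fun η => (hle η).trans (le_abs_self _))
  have hgi : Integrable g (Q q) := by
    refine (hd.add (integrable_const (g q.1))).congr (ae_of_all _ fun η => ?_)
    simp
  refine ⟨hgi, ?_⟩
  have h1 : ∫ η, g η ∂(Q q) - g q.1 = ∫ η, (g η - g q.1) ∂(Q q) := by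
    rw [integral_sub hgi (integrable_const _)]; simp
  rw [h1, ← Real.norm_eq_abs]
  refine (norm_integral_le_of_norm_le (hn.const_mul (R : ℝ)) (ae_of_all _ hle)).trans ?_
  rw [integral_const_mul]
  exact mul_le_mul_of_nonneg_left (h.integral_norm_le q) R.coe_nonneg

namespace GuideData

variable [MeasurableSpace V] [Nonempty V]

variable (γ : GuideData d t₀ T U V) {L₁ L₂ : Generator d U V} {D : Set (E d → ℝ)} {ht₀ : t₀ ≤ T}
  {x₀ : E d} {𝔲 : Strategy.{w} d t₀ T U} {n : ℕ}
  (ρ : Realization L₁ D ht₀ x₀ 𝔲 (γ.strategy.{w} n))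

/-- The law of the next position of the guide, given the path and the present position. -/
noncomputable def nextLaw (k : ℕ) (ω : ρ.Ω × 𝔲.Ω × (γ.strategy.{w} n).Ω) : Measure (E d) :=
  γ.Q k (γ.position ρ k ω, (γ.f k (ρ.X ω (γ.τ k), γ.position ρ k ω)).1)

theorem integrable_and_integral_position_succ {k : ℕ} (hk : k + 1 ≤ n)
    {F : (CadlagPath d t₀ T × E d) × E d → ℝ} (hF : Measurable F)
    (hi : Integrable (fun ω => F ((ρ.X ω, γ.position ρ k ω), γ.position ρ (k + 1) ω)) ρ.P) :
    Integrable (fun ω => ∫ η, F ((ρ.X ω, γ.position ρ k ω), η) ∂(γ.nextLaw ρ k ω)) ρ.P ∧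
    ∫ ω, F ((ρ.X ω, γ.position ρ k ω), γ.position ρ (k + 1) ω) ∂ρ.P
      = ∫ ω, ∫ η, F ((ρ.X ω, γ.position ρ k ω), η) ∂(γ.nextLaw ρ k ω) ∂ρ.P := by
  have hm1 : Measurable fun ω => (ρ.X ω, γ.position ρ k ω) :=
    ρ.measurable_X.prodMk (γ.measurable_position ρ k)
  have hm := hm1.prodMk (γ.measurable_position ρ (k + 1))
  have hp1 := Measure.isProbabilityMeasure_map (μ := ρ.P) hm1.aemeasurable
  have hlaw := γ.map_position_succ_eq ρ hk
  have hi' : Integrable F (ρ.P.map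
      (fun ω => ((ρ.X ω, γ.position ρ k ω), γ.position ρ (k + 1) ω))) :=
    (integrable_map_measure hF.aestronglyMeasurable hm.aemeasurable).2 hi
  rw [← integral_map hm.aemeasurable hF.aestronglyMeasurable]
  rw [hlaw] at hi' ⊢
  have hi2 : Integrable (fun p => ∫ η, F (p, η) ∂(γ.step k p))
      (ρ.P.map fun ω => (ρ.X ω, γ.position ρ k ω)) :=
    Integrable.integral_compProd (κ := Kernel.const Unit _)
      (η := Kernel.prodMkLeft Unit (γ.step k)) (a := ()) hi'
  have hms := hi2.aestronglyMeasurable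
  rw [Measure.integral_compProd hi']
  refine ⟨(integrable_map_measure hms hm1.aemeasurable).1 hi2, ?_⟩
  rw [integral_map hm1.aemeasurable hms]
  rfl

theorem lintegral_position_succ {k : ℕ} (hk : k + 1 ≤ n)
    {F : (CadlagPath d t₀ T × E d) × E d → ENNReal} (hF : Measurable F) :
    ∫⁻ ω, F ((ρ.X ω, γ.position ρ k ω), γ.position ρ (k + 1) ω) ∂ρ.P
      = ∫⁻ ω, ∫⁻ η, F ((ρ.X ω, γ.position ρ k ω), η) ∂(γ.nextLaw ρ k ω) ∂ρ.P := by
  have hm1 : Measurable fun ω => (ρ.X ω, γ.position ρ k ω) :=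
    ρ.measurable_X.prodMk (γ.measurable_position ρ k)
  have hm := hm1.prodMk (γ.measurable_position ρ (k + 1))
  have hp1 := Measure.isProbabilityMeasure_map (μ := ρ.P) hm1.aemeasurable
  rw [← lintegral_map hF hm, γ.map_position_succ_eq ρ hk, Measure.lintegral_compProd hF,
    lintegral_map hF.lintegral_kernel_prod_right' hm1]
  rfl

variable {c : ℝ → E d → ℝ} {M₀ M₁ : ℝ} {K : ℝ≥0}

/-- Integrability is not yet known here, so the disintegration is used for nonnegative extended
integrals. -/
theorem memLp_position_sub {k : ℕ} (hk : k + 1 ≤ n)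
    (hG : GuideStep L₂ c M₀ M₁ K (γ.τ k) (γ.τ (k + 1)) (γ.Q k)) :
    MemLp (fun ω => γ.position ρ (k + 1) ω - γ.position ρ k ω) 2 ρ.P := by
  have hm := (γ.measurable_position ρ (k + 1)).sub (γ.measurable_position ρ k)
  refine ⟨hm.aestronglyMeasurable, ?_⟩
  rw [eLpNorm_lt_top_iff_lintegral_rpow_enorm_lt_top two_ne_zero (by simp)]
  have h1 := γ.lintegral_position_succ ρ hk (F := fun p => ‖p.2 - p.1.2‖ₑ ^ (2 : ENNReal).toReal)
    (by fun_prop)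
  simp only at h1
  rw [h1]
  set B := ENNReal.ofReal (2 * M₀ * (γ.τ (k + 1) - γ.τ k) + 4 * M₁ ^ 2 * (γ.τ (k + 1) - γ.τ k) ^ 2)
  refine lt_of_le_of_lt (lintegral_mono (g := fun _ => B) fun ω => ?_) (by simp [B])
  set q : E d × U := (γ.position ρ k ω, (γ.f k (ρ.X ω (γ.τ k), γ.position ρ k ω)).1)
  have h2 : ∫⁻ η, ‖η - q.1‖ₑ ^ (2 : ENNReal).toReal ∂(γ.Q k q)
      = ENNReal.ofReal (∫ η, ‖η - q.1‖ ^ 2 ∂(γ.Q k q)) := by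
    rw [ofReal_integral_eq_lintegral_ofReal (integrable_norm_sq (hG.memLp q))
      (ae_of_all _ fun _ => by positivity)]
    refine lintegral_congr fun η => ?_
    rw [ENNReal.ofReal_pow (norm_nonneg _), ofReal_norm]
    simp
  exact h2.trans_le (ENNReal.ofReal_le_ofReal (hG.integral_sq_le q))

theorem integral_sq_position_sub {k : ℕ} (hk : k + 1 ≤ n)
    (hG : GuideStep L₂ c M₀ M₁ K (γ.τ k) (γ.τ (k + 1)) (γ.Q k)) {C : ℝ}
    (hC : ∀ q, ∫ η, ‖η - q.1‖ ^ 2 ∂(γ.Q k q) ≤ C) :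
    ∫ ω, ‖γ.position ρ (k + 1) ω - γ.position ρ k ω‖ ^ 2 ∂ρ.P ≤ C := by
  obtain ⟨h1, h2⟩ := γ.integrable_and_integral_position_succ ρ hk
    (F := fun p => ‖p.2 - p.1.2‖ ^ 2) (by fun_prop)
    (integrable_norm_sq (γ.memLp_position_sub ρ hk hG))
  rw [h2]
  refine (integral_mono h1 (integrable_const C) fun ω => hC _).trans_eq (by simp)

theorem memLp_position
    (hG : ∀ k < n, GuideStep L₂ c M₀ M₁ K (γ.τ k) (γ.τ (k + 1)) (γ.Q k)) {k : ℕ} (hk : k ≤ n) :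
    MemLp (γ.position ρ k) 2 ρ.P := by
  induction k with
  | zero =>
    refine (memLp_const γ.x₀).ae_eq ?_
    filter_upwards [γ.position_zero ρ] with ω hω
    exact hω.symm
  | succ k ih =>
    have := (ih (by omega)).add (γ.memLp_position_sub ρ hk (hG k hk))
    refine this.ae_eq (ae_of_all _ fun ω => ?_)
    simp

/-- Along the guide a stable function does not decrease in the mean. -/
theorem le_integral_terminal (hG : ∀ k < n, GuideStep L₂ c M₀ M₁ K (γ.τ k) (γ.τ (k + 1)) (γ.Q k))
    {g : E d → ℝ} {R : ℝ≥0} (hg : LipschitzWith R g)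
    (hc : ∀ k ≤ n, Measurable (c (γ.τ k))) {B : ℝ} (hB : ∀ k ≤ n, ∀ ξ, c (γ.τ k) ξ ≤ g ξ + B)
    (hn : ∀ ξ, c (γ.τ n) ξ = g ξ) :
    c (γ.τ 0) γ.x₀ ≤ ∫ ω, g (γ.position ρ n ω) ∂ρ.P := by
  obtain ⟨A, hA⟩ : ∃ A, ∀ k < n,
      1 + (2 * M₀ * ((γ.τ (k + 1) : ℝ) - γ.τ k) + 4 * M₁ ^ 2 * ((γ.τ (k + 1) : ℝ) - γ.τ k) ^ 2)
        ≤ A := by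
    refine ⟨∑ k ∈ Finset.range n, |1 + (2 * M₀ * ((γ.τ (k + 1) : ℝ) - γ.τ k)
      + 4 * M₁ ^ 2 * ((γ.τ (k + 1) : ℝ) - γ.τ k) ^ 2)|, fun k hk => ?_⟩
    exact (le_abs_self _).trans (Finset.single_le_sum (f := fun k =>
      |1 + (2 * M₀ * ((γ.τ (k + 1) : ℝ) - γ.τ k)
        + 4 * M₁ ^ 2 * ((γ.τ (k + 1) : ℝ) - γ.τ k) ^ 2)|) (fun _ _ => abs_nonneg _)
      (Finset.mem_range.2 hk))
  have hmem := fun k hk => (γ.memLp_position ρ hG (k := k) hk).integrable one_le_two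
  -- `c` is bounded above by `g + B` but has no known lower bound, so it need not be integrable
  -- along the guide. The minorant `g - R A (n - k)` restores integrability. It is nondecreasing in
  -- the mean too, since one step changes the mean of `g` by at most `R A`; at `k = n` the maximum
  -- is `g`.
  set h : ℕ → E d → ℝ := fun k ξ => max (c (γ.τ k) ξ) (g ξ - R * A * ((n : ℝ) - k)) with hh
  have hhm : ∀ k ≤ n, Measurable (h k) := fun k hk =>
    (hc k hk).max (hg.continuous.measurable.sub_const _)
  have hgi : ∀ k ≤ n, Integrable (fun ω => g (γ.position ρ k ω)) ρ.P := by
    intro k hk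
    refine (((hmem k hk).norm.const_mul (R : ℝ)).add (integrable_const |g 0|)).mono
      (hg.continuous.measurable.comp (γ.measurable_position ρ k)).aestronglyMeasurable
      (ae_of_all _ fun ω => ?_)
    have h1 := hg.dist_le_mul (γ.position ρ k ω) 0
    rw [dist_zero_right, Real.dist_eq] at h1
    have h2 := abs_sub_abs_le_abs_sub (g (γ.position ρ k ω)) (g 0)
    have h3 := le_abs_self (R * ‖γ.position ρ k ω‖ + |g 0|)
    simp only [Real.norm_eq_abs, Pi.add_apply]
    linarith
  have hhi : ∀ k ≤ n, Integrable (fun ω => h k (γ.position ρ k ω)) ρ.P := by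
    intro k hk
    refine ((hgi k hk).abs.add (integrable_const (|B| + |R * A * ((n : ℝ) - k)|))).mono
      ((hhm k hk).comp (γ.measurable_position ρ k)).aestronglyMeasurable (ae_of_all _ fun ω => ?_)
    set ξ := γ.position ρ k ω
    have h1 : h k ξ ≤ g ξ + (|B| + |R * A * ((n : ℝ) - k)|) := by
      refine max_le ((hB k hk ξ).trans ?_) ?_
      · linarith [le_abs_self B, abs_nonneg (R * A * ((n : ℝ) - k))]
      · linarith [neg_le_abs (R * A * ((n : ℝ) - k)), abs_nonneg B]
    have h2 : g ξ - (|B| + |R * A * ((n : ℝ) - k)|) ≤ h k ξ := by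
      refine le_trans ?_ (le_max_right _ _)
      linarith [le_abs_self (R * A * ((n : ℝ) - k)), abs_nonneg B]
    simp only [Real.norm_eq_abs, Pi.add_apply]
    refine le_trans (abs_le.2 ⟨?_, ?_⟩) (le_abs_self _)
    · linarith [neg_abs_le (g ξ)]
    · linarith [le_abs_self (g ξ)]
  have hmono : ∀ k ≤ n, c (γ.τ 0) γ.x₀ ≤ ∫ ω, h k (γ.position ρ k ω) ∂ρ.P := by
    intro k
    induction k with
    | zero =>
      intro _
      have h1 : ∫ ω, h 0 (γ.position ρ 0 ω) ∂ρ.P = h 0 γ.x₀ := by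
        rw [integral_congr_ae (g := fun _ => h 0 γ.x₀)]
        · simp
        · filter_upwards [γ.position_zero ρ] with ω hω
          rw [hω]
      rw [h1]
      exact le_max_left _ _
    | succ k ih =>
      intro hk
      refine (ih (by omega)).trans ?_
      obtain ⟨h1, h2⟩ := γ.integrable_and_integral_position_succ ρ hk
        (F := fun p => h (k + 1) p.2) ((hhm _ hk).comp measurable_snd) (hhi _ hk)
      simp only at h1 h2
      rw [h2]
      refine integral_mono (hhi k (by omega)) h1 fun ω => ?_
      have hGk := hG k hk
      simp only [nextLaw]
      set q : E d × U := (γ.position ρ k ω, (γ.f k (ρ.X ω (γ.τ k), γ.position ρ k ω)).1) with hq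
      have hq1 : γ.position ρ k ω = q.1 := rfl
      rw [hq1]
      obtain ⟨h3, h4⟩ := hGk.abs_integral_lipschitz_sub_le hg q
      have h5 : Integrable (fun η => g η - R * A * ((n : ℝ) - (k + 1 : ℕ))) (γ.Q k q) :=
        h3.sub (integrable_const _)
      have h6 : Integrable (h (k + 1)) (γ.Q k q) := (hGk.integrable q).sup h5
      refine max_le ((hGk.le_integral q).trans
        (integral_mono (hGk.integrable q) h6 fun η => le_max_left _ _)) ?_
      refine le_trans ?_ (integral_mono h5 h6 fun η => le_max_right _ _)
      rw [integral_sub h3 (integrable_const _)]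
      simp only [integral_const, probReal_univ, one_smul]
      have h7 := mul_le_mul_of_nonneg_left (hA k hk) R.coe_nonneg
      have h8 := (abs_le.1 h4).1
      push_cast
      linarith
  refine (hmono n le_rfl).trans_eq (integral_congr_ae (ae_of_all _ fun ω => ?_))
  simp [hh, hn]

end GuideData

end StochGame

/-! ### Drift of the motion against drift of the guide -/

namespace StochGame

variable {d : ℕ} {t₀ T : ℝ} {U V : Type*} [MeasurableSpace U] [MeasurableSpace V]

theorem two_mul_le_mul_sq_add {x y a : ℝ} (ha : 0 < a) : 2 * (x * y) ≤ a * x ^ 2 + y ^ 2 / a := by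
  have : a * x ^ 2 + y ^ 2 / a - 2 * (x * y) = (a * x - y) ^ 2 / a := by field_simp; ring
  have h : 0 ≤ (a * x - y) ^ 2 / a := by positivity
  linarith

namespace GuideData

/-- The first `n` steps of the guide data are aimed, with accuracy `a`, at keeping the motion
close to the guide. -/
structure IsAimed (γ : GuideData d t₀ T U V) (n : ℕ) (L₁ L₂ : Generator d U V) (c : ℝ → E d → ℝ)
    (M₀₁ M₁₁ M₀₂ M₁₂ : ℝ) (K₂ : ℝ≥0) (k₀ κ₀ a : ℝ) : Prop where
  guideStep : ∀ k < n, GuideStep L₂ c M₀₂ M₁₂ K₂ (γ.τ k) (γ.τ (k + 1)) (γ.Q k)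
  extremal : ∀ k < n, ∀ x y u w, inner ℝ (x - y) (L₁.b (γ.τ k) x u (γ.f k (x, y)).2)
    ≤ inner ℝ (x - y) (L₂.b (γ.τ k) y (γ.f k (x, y)).1 w) + k₀ * ‖x - y‖ ^ 2
      + ‖x - y‖ * √κ₀ + a
  index : ∀ k < n, ∀ s ∈ Ioc (γ.τ k) (γ.τ (k + 1)), γ.κ s = k
  modulus₁ : ∀ k < n, ∀ σ ∈ Icc (γ.τ k : ℝ) (γ.τ (k + 1)), ∀ x u v,
    ‖L₁.b σ x u v - L₁.b (γ.τ k) x u v‖ ≤ a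
  modulus₂ : ∀ k < n, ∀ σ ∈ Icc (γ.τ k : ℝ) (γ.τ (k + 1)), ∀ x u v,
    ‖L₂.b σ x u v - L₂.b (γ.τ k) x u v‖ ≤ a
  mesh₁ : ∀ k < n, 2 * M₀₁ * ((γ.τ (k + 1) : ℝ) - γ.τ k)
    + 4 * M₁₁ ^ 2 * ((γ.τ (k + 1) : ℝ) - γ.τ k) ^ 2 ≤ a ^ 2
  mesh₂ : ∀ k < n, 2 * M₀₂ * ((γ.τ (k + 1) : ℝ) - γ.τ k)
    + 4 * M₁₂ ^ 2 * ((γ.τ (k + 1) : ℝ) - γ.τ k) ^ 2 ≤ a ^ 2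

variable (γ : GuideData d t₀ T U V) {L₁ L₂ : Generator d U V} {D : Set (E d → ℝ)} {ht₀ : t₀ ≤ T}
  {x₀ : E d} {𝔲 : Strategy.{w} d t₀ T U} {n : ℕ} [Nonempty V]
  (ρ : Realization L₁ D ht₀ x₀ 𝔲 (γ.strategy.{w} n))

theorem strategy_control_apply (x : CadlagPath d t₀ T) (s : Icc t₀ T) (y : (γ.strategy.{w} n).Ω) :
    (γ.strategy.{w} n).control x s y
      = (γ.f (γ.κ s) (x (γ.τ (γ.κ s)), γ.guidePath n y (γ.κ s))).2 := rfl

theorem measurable_position_filtration (k : ℕ) :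
    Measurable[prodFiltration ρ.ℱ 𝔲.ℱ (γ.strategy.{w} n).ℱ (γ.τ k)] (γ.position ρ k) := by
  have h1 := γ.measurable_guidePath_filtration.{w} n (le_refl (γ.τ k))
  exact h1.comp ((@measurable_snd _ _ (𝔲.ℱ (γ.τ k)) ((γ.strategy.{w} n).ℱ (γ.τ k))).comp
    (@measurable_snd _ _ (ρ.ℱ (γ.τ k)) ((𝔲.ℱ (γ.τ k)).prod ((γ.strategy.{w} n).ℱ (γ.τ k)))))

variable {c : ℝ → E d → ℝ} {M₀₁ M₁₁ M₀₂ M₁₂ : ℝ} {K₁ K₂ : ℝ≥0} {k₀ κ₀ a : ℝ}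
  [TopologicalSpace U] [TopologicalSpace V] [Nonempty U]

/-- The drift of the motion along a realization. -/
noncomputable def drift (σ : Icc t₀ T) (ω : ρ.Ω × 𝔲.Ω × (γ.strategy.{w} n).Ω) : E d :=
  L₁.b σ (ρ.X ω σ) (𝔲.control (ρ.X ω) σ ω.2.1) ((γ.strategy.{w} n).control (ρ.X ω) σ ω.2.2)

/-- Both sides are compared with one number `lam`, the supremum over `u` of the frozen drift of the
motion under `v*`. The motion stays below it whatever the opponent plays, and the guide stays above
it up to the extremal shift error, whatever its relaxed control. -/
theorem inner_drift_sub_inner_mean_le (hL : L₁.Regular T M₀₁ M₁₁ K₁)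
    (h0 : 0 ≤ t₀) (ha : 0 < a)
    (hγ : γ.IsAimed n L₁ L₂ c M₀₁ M₁₁ M₀₂ M₁₂ K₂ k₀ κ₀ a) {k : ℕ} (hk : k < n)
    (ω : ρ.Ω × 𝔲.Ω × (γ.strategy.{w} n).Ω)
    (hω1 : Integrable (fun σ => γ.drift ρ σ ω) (timeMeasure t₀ T))
    (hω2 : Integrable (fun σ => ‖ρ.X ω σ - ρ.X ω (γ.τ k)‖ ^ 2) (timeMeasure t₀ T)) :
    inner ℝ (ρ.X ω (γ.τ k) - γ.position ρ k ω)
        (∫ σ in Ioc (γ.τ k) (γ.τ (k + 1)), γ.drift ρ σ ω ∂(timeMeasure t₀ T))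
      - inner ℝ (ρ.X ω (γ.τ k) - γ.position ρ k ω)
        (∫ η, (η - γ.position ρ k ω) ∂(γ.nextLaw ρ k ω))
    ≤ ((γ.τ (k + 1) : ℝ) - γ.τ k) * (k₀ * ‖ρ.X ω (γ.τ k) - γ.position ρ k ω‖ ^ 2
        + ‖ρ.X ω (γ.τ k) - γ.position ρ k ω‖ * √κ₀ + a
        + K₁ * a * ‖ρ.X ω (γ.τ k) - γ.position ρ k ω‖ ^ 2
        + ‖ρ.X ω (γ.τ k) - γ.position ρ k ω‖ * (2 * a + 2 * K₂ * a))
      + K₁ / a * ∫ σ in Ioc (γ.τ k) (γ.τ (k + 1)), ‖ρ.X ω σ - ρ.X ω (γ.τ k)‖ ^ 2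
        ∂(timeMeasure t₀ T) := by
  set x := ρ.X ω (γ.τ k) with hx
  set y := γ.position ρ k ω with hy
  set s := x - y with hs
  have hle : γ.τ k ≤ γ.τ (k + 1) := γ.τ_mono (Nat.le_succ k)
  have hδ : 0 ≤ (γ.τ (k + 1) : ℝ) - γ.τ k := sub_nonneg.2 hle
  set δ := (γ.τ (k + 1) : ℝ) - γ.τ k with hδd
  have hmem : ∀ σ : Icc t₀ T, (σ : ℝ) ∈ Icc 0 T := fun σ => ⟨h0.trans σ.2.1, σ.2.2⟩
  set lam := ⨆ u, inner ℝ s (L₁.b (γ.τ k) x u (γ.f k (x, y)).2) with hlam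
  have hbdd : BddAbove (range fun u => inner ℝ s (L₁.b (γ.τ k) x u (γ.f k (x, y)).2)) := by
    refine ⟨‖s‖ * M₁₁, ?_⟩
    rintro _ ⟨u, rfl⟩
    exact (real_inner_le_norm _ _).trans (mul_le_mul_of_nonneg_left
      (hL.bound_b _ (hmem _) _ _ _) (norm_nonneg _))
  have hX : inner ℝ s (∫ σ in Ioc (γ.τ k) (γ.τ (k + 1)), γ.drift ρ σ ω ∂(timeMeasure t₀ T))
      ≤ δ * (lam + ‖s‖ * a + K₁ * a * ‖s‖ ^ 2)
        + K₁ / a * ∫ σ in Ioc (γ.τ k) (γ.τ (k + 1)), ‖ρ.X ω σ - x‖ ^ 2 ∂(timeMeasure t₀ T) := by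
    have h6 : ∫ σ in Ioc (γ.τ k) (γ.τ (k + 1)), ((lam + ‖s‖ * a + K₁ * a * ‖s‖ ^ 2)
          + K₁ / a * ‖ρ.X ω σ - x‖ ^ 2) ∂(timeMeasure t₀ T)
        = δ * (lam + ‖s‖ * a + K₁ * a * ‖s‖ ^ 2)
        + K₁ / a * ∫ σ in Ioc (γ.τ k) (γ.τ (k + 1)), ‖ρ.X ω σ - x‖ ^ 2 ∂(timeMeasure t₀ T) := by
      rw [integral_add (integrable_const _) (hω2.integrableOn.const_mul _), integral_const_mul,
        setIntegral_const, timeMeasure_real_Ioc hle, smul_eq_mul]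
    rw [← integral_inner hω1.integrableOn, ← h6]
    refine setIntegral_mono_on (hω1.integrableOn.const_inner s)
      ((integrable_const _).add (hω2.integrableOn.const_mul _)) measurableSet_Ioc fun σ hσ => ?_
    have hctrl : (γ.strategy.{w} n).control (ρ.X ω) σ ω.2.2 = (γ.f k (x, y)).2 := by
      rw [strategy_control_apply, hγ.index k hk σ hσ]
      rfl
    simp only [drift]
    rw [hctrl]
    set u := 𝔲.control (ρ.X ω) σ ω.2.1
    set v := (γ.f k (x, y)).2
    have h12 : inner ℝ s (L₁.b σ (ρ.X ω σ) u v) = inner ℝ s (L₁.b (γ.τ k) x u v)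
          + inner ℝ s (L₁.b σ (ρ.X ω σ) u v - L₁.b (γ.τ k) (ρ.X ω σ) u v)
          + inner ℝ s (L₁.b (γ.τ k) (ρ.X ω σ) u v - L₁.b (γ.τ k) x u v) := by
      simp only [inner_sub_right]; ring
    have h1 : inner ℝ s (L₁.b (γ.τ k) x u v) ≤ lam := le_ciSup hbdd u
    have h2 := (real_inner_le_norm s (L₁.b σ (ρ.X ω σ) u v - L₁.b (γ.τ k) (ρ.X ω σ) u v)).trans
      (mul_le_mul_of_nonneg_left (hγ.modulus₁ k hk σ ⟨hσ.1.le, hσ.2⟩ (ρ.X ω σ) u v)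
        (norm_nonneg s))
    have h3 := (hL.lipschitz_b (γ.τ k) (hmem _) u v).dist_le_mul (ρ.X ω σ) x
    rw [dist_eq_norm, dist_eq_norm] at h3
    have h4 := (real_inner_le_norm s (L₁.b (γ.τ k) (ρ.X ω σ) u v - L₁.b (γ.τ k) x u v)).trans
      (mul_le_mul_of_nonneg_left h3 (norm_nonneg s))
    have h5 := mul_le_mul_of_nonneg_left
      (two_mul_le_mul_sq_add (x := ‖s‖) (y := ‖ρ.X ω σ - x‖) ha) K₁.coe_nonneg
    have h7 : 0 ≤ ‖s‖ * (K₁ * ‖ρ.X ω σ - x‖) := by positivity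
    have h8 : (K₁ : ℝ) / a * ‖ρ.X ω σ - x‖ ^ 2 = K₁ * (‖ρ.X ω σ - x‖ ^ 2 / a) := by ring
    rw [h12, h8]
    nlinarith
  have hY := (hγ.guideStep k hk).le_inner_mean (y, (γ.f k (x, y)).1) s
    (lam - k₀ * ‖s‖ ^ 2 - ‖s‖ * √κ₀ - a) a a ha (hγ.modulus₂ k hk) fun z => by
      have : lam ≤ inner ℝ s (L₂.b (γ.τ k) y (γ.f k (x, y)).1 z) + k₀ * ‖s‖ ^ 2
          + ‖s‖ * √κ₀ + a := ciSup_le fun u => hγ.extremal k hk x y u z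
      simp only
      linarith
  have hY' : inner ℝ s (∫ η, (η - y) ∂(γ.nextLaw ρ k ω)) =
    inner ℝ s (∫ η, (η - y) ∂(γ.Q k (y, (γ.f k (x, y)).1))) := rfl
  rw [hY']
  simp only at hY
  rw [← hδd] at hY
  -- The mesh condition bounds the second moment by `a²` precisely so that division by the Young
  -- weight `a` still leaves an error `a`.
  have hm2 : (2 * M₀₂ * δ + 4 * M₁₂ ^ 2 * δ ^ 2) / a ≤ a := by
    rw [div_le_iff₀ ha, ← sq]
    exact hγ.mesh₂ k hk
  have h9 : ‖s‖ * (δ * (a + K₂ * (a + (2 * M₀₂ * δ + 4 * M₁₂ ^ 2 * δ ^ 2) / a)))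
      ≤ ‖s‖ * (δ * (a + K₂ * (a + a))) := by gcongr
  linarith

end GuideData

end StochGame

/-! ### Recursion for the mean square distance -/

namespace StochGame

variable {d : ℕ} {t₀ T : ℝ} {U V : Type*} [MeasurableSpace U] [MeasurableSpace V]

namespace GuideData

variable (γ : GuideData d t₀ T U V) {L₁ L₂ : Generator d U V} {D : Set (E d → ℝ)} {ht₀ : t₀ ≤ T}
  {x₀ : E d} {𝔲 : Strategy.{w} d t₀ T U} {n : ℕ} [Nonempty V]
  (ρ : Realization L₁ D ht₀ x₀ 𝔲 (γ.strategy.{w} n))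
  {c : ℝ → E d → ℝ} {M₀₁ M₁₁ M₀₂ M₁₂ : ℝ} {K₁ K₂ : ℝ≥0} {k₀ κ₀ a : ℝ}
  [TopologicalSpace U] [TopologicalSpace V] [Nonempty U]

/-- The mean square distance between the motion and the guide at the `k`-th correction time. -/
noncomputable def meanSqDist (k : ℕ) : ℝ :=
  ∫ ω, ‖ρ.X ω (γ.τ k) - γ.position ρ k ω‖ ^ 2 ∂ρ.P

-- The new difference is `s + Δ - Y`. The squares of `Δ` and `Y` contribute `M₀₁` and `M₀₂`, the
-- terms with `s` reduce to drifts, and `⟨Δ, Y⟩` is of smaller order than the step. The constant in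
-- `hε` adds up all errors of size `a δ`: `5 + 2 K₂` from the drift comparison and Young's
-- inequality for `⟨Δ, m⟩`; `2` from the weights in the two squares; `M₁₁² + M₁₂²` from their drift
-- parts; `2 K₁` from `I`; a second `M₁₂²` from `⟨Δ, m⟩`.
set_option maxHeartbeats 800000 in
theorem meanSqDist_succ_le (hL : L₁.Regular T M₀₁ M₁₁ K₁) (hD : IsTestClass L₁ T D)
    (h0 : 0 ≤ t₀) (ha : 0 < a) (hκ₀ : 0 ≤ κ₀)
    (hγ : γ.IsAimed n L₁ L₂ c M₀₁ M₁₁ M₀₂ M₁₂ K₂ k₀ κ₀ a) {ε : ℝ}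
    (hε1 : (7 + 2 * K₁ + 2 * K₂ + M₁₁ ^ 2 + 2 * M₁₂ ^ 2) * a ≤ 1)
    (hε : (7 + 2 * K₁ + 2 * K₂ + M₁₁ ^ 2 + 2 * M₁₂ ^ 2) * a ≤ ε) {k : ℕ} (hk : k < n) :
    γ.meanSqDist ρ (k + 1)
      ≤ (1 + (2 + 2 * k₀) * ((γ.τ (k + 1) : ℝ) - γ.τ k)) * γ.meanSqDist ρ k
        + (κ₀ + M₀₁ + M₀₂ + ε) * ((γ.τ (k + 1) : ℝ) - γ.τ k) := by
  have hDP := ρ.driftProcess_path hL hD h0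
  have hle : γ.τ k ≤ γ.τ (k + 1) := γ.τ_mono (Nat.le_succ k)
  have hδ : 0 ≤ (γ.τ (k + 1) : ℝ) - γ.τ k := sub_nonneg.2 hle
  set δ := (γ.τ (k + 1) : ℝ) - γ.τ k with hδd
  have hG := hγ.guideStep k hk
  set s := fun ω => ρ.X ω (γ.τ k) - γ.position ρ k ω with hs
  set Δ := fun ω => ρ.X ω (γ.τ (k + 1)) - ρ.X ω (γ.τ k) with hΔ
  set Y := fun ω => γ.position ρ (k + 1) ω - γ.position ρ k ω with hY
  set m := fun ω => ∫ η, (η - γ.position ρ k ω) ∂(γ.nextLaw ρ k ω) with hm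
  set J := fun ω => ∫ σ in Ioc (γ.τ k) (γ.τ (k + 1)), γ.drift ρ σ ω ∂(timeMeasure t₀ T) with hJ
  set I := fun ω => ∫ σ in Ioc (γ.τ k) (γ.τ (k + 1)), ‖ρ.X ω σ - ρ.X ω (γ.τ k)‖ ^ 2
        ∂(timeMeasure t₀ T) with hI
  have hs2 : MemLp s 2 ρ.P :=
    (hDP.memLp_two (γ.τ k)).sub (γ.memLp_position ρ hγ.guideStep hk.le)
  have hΔ2 : MemLp Δ 2 ρ.P := hDP.memLp_sub (γ.τ k) (γ.τ (k + 1))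
  have hY2 : MemLp Y 2 ρ.P := γ.memLp_position_sub ρ hk hG
  have hJ2 : MemLp J 2 ρ.P := hDP.memLp_integral_drift hle
  have hIi : Integrable I ρ.P := hDP.integrable_integral_norm_sub (γ.τ k) (γ.τ (k + 1))
  have hsm : Measurable[prodFiltration ρ.ℱ 𝔲.ℱ (γ.strategy.{w} n).ℱ (γ.τ k)] s :=
    (ρ.adapted (γ.τ k)).sub (γ.measurable_position_filtration ρ k)
  have hX : ∫ ω, inner ℝ (s ω) (Δ ω) ∂ρ.P = ∫ ω, inner ℝ (s ω) (J ω) ∂ρ.P :=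
    hDP.integral_inner_increment hle hsm hs2
  have hev := fun j => CadlagPath.measurable_eval (d := d) (γ.τ j)
  have hmean : ∀ ω (v : E d), ∫ η, inner ℝ v (η - γ.position ρ k ω) ∂(γ.nextLaw ρ k ω)
      = inner ℝ v (m ω) := by
    intro ω v
    have := hG.isMarkov
    exact integral_inner ((hG.memLp _).integrable one_le_two) v
  have hF1 := γ.integrable_and_integral_position_succ ρ hk
    (F := fun p => inner ℝ (p.1.1 (γ.τ k) - p.1.2) (p.2 - p.1.2))
    ((((hev k).comp (measurable_fst.comp measurable_fst)).sub
      (measurable_snd.comp measurable_fst)).inner (measurable_snd.sub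
      (measurable_snd.comp measurable_fst))) (integrable_inner_of_memLp hs2 hY2)
  -- `Δ` lies in the future of `τ k`, yet it may be held fixed because the next guide position is
  -- conditioned on the entire path. Hence `Y` may be replaced by its mean `m`, of norm at most `M₁₂
  -- δ`.
  have hF2 := γ.integrable_and_integral_position_succ ρ hk
    (F := fun p => inner ℝ (p.1.1 (γ.τ (k + 1)) - p.1.1 (γ.τ k)) (p.2 - p.1.2))
    ((((hev (k + 1)).comp (measurable_fst.comp measurable_fst)).sub
      ((hev k).comp (measurable_fst.comp measurable_fst))).inner (measurable_snd.sub
      (measurable_snd.comp measurable_fst))) (integrable_inner_of_memLp hΔ2 hY2)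
  simp only [hmean] at hF1 hF2
  obtain ⟨hi1, he1⟩ := hF1
  obtain ⟨hi2, he2⟩ := hF2
  have he1' : ∫ ω, inner ℝ (s ω) (Y ω) ∂ρ.P = ∫ ω, inner ℝ (s ω) (m ω) ∂ρ.P := he1
  have he2' : ∫ ω, inner ℝ (Δ ω) (Y ω) ∂ρ.P = ∫ ω, inner ℝ (Δ ω) (m ω) ∂ρ.P := he2
  have hi1' : Integrable (fun ω => inner ℝ (s ω) (m ω)) ρ.P := hi1
  have hi2' : Integrable (fun ω => inner ℝ (Δ ω) (m ω)) ρ.P := hi2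
  -- expansion of the square
  have hexp : γ.meanSqDist ρ (k + 1) = γ.meanSqDist ρ k + ∫ ω, ‖Δ ω‖ ^ 2 ∂ρ.P
      + ∫ ω, ‖Y ω‖ ^ 2 ∂ρ.P + ∫ ω, (2 * inner ℝ (s ω) (J ω) - 2 * inner ℝ (s ω) (m ω)
        - 2 * inner ℝ (Δ ω) (m ω)) ∂ρ.P := by
    have h1 : ∀ ω, ‖ρ.X ω (γ.τ (k + 1)) - γ.position ρ (k + 1) ω‖ ^ 2
        = ‖s ω‖ ^ 2 + ‖Δ ω‖ ^ 2 + ‖Y ω‖ ^ 2 + (2 * inner ℝ (s ω) (Δ ω)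
          - 2 * inner ℝ (s ω) (Y ω) - 2 * inner ℝ (Δ ω) (Y ω)) := by
      intro ω
      have h2 : ρ.X ω (γ.τ (k + 1)) - γ.position ρ (k + 1) ω = (s ω + Δ ω) - Y ω := by
        simp only [hs, hΔ, hY]; abel
      rw [h2, norm_sub_sq_real, norm_add_sq_real, inner_add_left]
      ring
    have i1 := integrable_norm_sq hs2
    have i2 := integrable_norm_sq hΔ2
    have i3 := integrable_norm_sq hY2
    have i4 := (integrable_inner_of_memLp hs2 hΔ2).const_mul 2
    have i5 := (integrable_inner_of_memLp hs2 hY2).const_mul 2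
    have i6 := (integrable_inner_of_memLp hΔ2 hY2).const_mul 2
    have i7 := (integrable_inner_of_memLp hs2 hJ2).const_mul 2
    have i12 : Integrable (fun ω => ‖s ω‖ ^ 2 + ‖Δ ω‖ ^ 2) ρ.P := i1.add i2
    have i123 : Integrable (fun ω => ‖s ω‖ ^ 2 + ‖Δ ω‖ ^ 2 + ‖Y ω‖ ^ 2) ρ.P := i12.add i3
    have i45 : Integrable (fun ω => 2 * inner ℝ (s ω) (Δ ω) - 2 * inner ℝ (s ω) (Y ω)) ρ.P :=
      i4.sub i5
    have i456 : Integrable (fun ω => 2 * inner ℝ (s ω) (Δ ω) - 2 * inner ℝ (s ω) (Y ω)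
      - 2 * inner ℝ (Δ ω) (Y ω)) ρ.P := i45.sub i6
    have i78 : Integrable (fun ω => 2 * inner ℝ (s ω) (J ω) - 2 * inner ℝ (s ω) (m ω)) ρ.P :=
      i7.sub (hi1'.const_mul 2)
    unfold meanSqDist
    simp_rw [h1]
    rw [integral_add i123 i456, integral_add i12 i3, integral_add i1 i2, integral_sub i45 i6,
      integral_sub i4 i5, integral_sub i78 (hi2'.const_mul 2), integral_sub i7 (hi1'.const_mul 2)]
    simp only [integral_const_mul]
    rw [hX, he1', he2']
  -- pathwise estimate
  have hpath : ∫ ω, (2 * inner ℝ (s ω) (J ω) - 2 * inner ℝ (s ω) (m ω)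
        - 2 * inner ℝ (Δ ω) (m ω)) ∂ρ.P
      ≤ ∫ ω, (δ * ((2 * k₀ + 1 + (2 * K₁ + 2 + 2 * K₂) * a)) * ‖s ω‖ ^ 2
        + δ * (κ₀ + (5 + 2 * K₂) * a) + δ * (M₁₂ ^ 2 / a) * ‖Δ ω‖ ^ 2
        + 2 * (K₁ / a) * I ω) ∂ρ.P := by
    refine integral_mono_ae ((((integrable_inner_of_memLp hs2 hJ2).const_mul 2).sub
      (hi1'.const_mul 2)).sub (hi2'.const_mul 2))
      (((((integrable_norm_sq hs2).const_mul _).add (integrable_const _)).add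
        ((integrable_norm_sq hΔ2).const_mul _)).add (hIi.const_mul _)) ?_
    filter_upwards [hDP.ae_integrable_drift, hDP.ae_integrable_sq_sub (γ.τ k)] with ω h1 h2
    have h3 : inner ℝ (s ω) (J ω) - inner ℝ (s ω) (m ω)
        ≤ δ * (k₀ * ‖s ω‖ ^ 2 + ‖s ω‖ * √κ₀ + a + K₁ * a * ‖s ω‖ ^ 2
          + ‖s ω‖ * (2 * a + 2 * K₂ * a)) + K₁ / a * I ω :=
      γ.inner_drift_sub_inner_mean_le ρ hL h0 ha hγ hk ω h1 h2
    have h4 : 2 * (‖s ω‖ * √κ₀) ≤ ‖s ω‖ ^ 2 + κ₀ := by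
      nlinarith [sq_nonneg (‖s ω‖ - √κ₀), Real.sq_sqrt hκ₀]
    have h5 : 2 * (‖s ω‖ * (2 * a + 2 * K₂ * a)) ≤ (2 * a + 2 * K₂ * a) * (‖s ω‖ ^ 2 + 1) := by
      have : 0 ≤ 2 * a + 2 * K₂ * a := by positivity
      nlinarith [mul_nonneg this (sq_nonneg (‖s ω‖ - 1))]
    have hmn : ‖m ω‖ ≤ M₁₂ * δ := hG.norm_mean_le _
    have h6 : -(2 * inner ℝ (Δ ω) (m ω)) ≤ δ * (a + M₁₂ ^ 2 * ‖Δ ω‖ ^ 2 / a) := by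
      have h7 := (abs_le.1 (abs_real_inner_le_norm (Δ ω) (m ω))).1
      have h8 := mul_le_mul_of_nonneg_left hmn (norm_nonneg (Δ ω))
      have h9 := mul_le_mul_of_nonneg_left
        (two_mul_le_mul_sq_add (x := 1) (y := M₁₂ * ‖Δ ω‖) ha) hδ
      rw [mul_pow] at h9
      have h9' : ‖Δ ω‖ * (M₁₂ * δ) = δ * (1 * (M₁₂ * ‖Δ ω‖)) := by ring
      linarith
    have h10 := mul_le_mul_of_nonneg_left h4 hδ
    have h11 := mul_le_mul_of_nonneg_left h5 hδ
    have h12 : δ * (M₁₂ ^ 2 / a) * ‖Δ ω‖ ^ 2 = δ * (M₁₂ ^ 2 * ‖Δ ω‖ ^ 2 / a) := by ring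
    rw [h12]
    linarith
  have hlin : ∀ c₁ c₂ c₃ c₄ : ℝ,
      ∫ ω, (c₁ * ‖s ω‖ ^ 2 + c₂ + c₃ * ‖Δ ω‖ ^ 2 + c₄ * I ω) ∂ρ.P
        = c₁ * ∫ ω, ‖s ω‖ ^ 2 ∂ρ.P + c₂ + c₃ * ∫ ω, ‖Δ ω‖ ^ 2 ∂ρ.P + c₄ * ∫ ω, I ω ∂ρ.P := by
    intro c₁ c₂ c₃ c₄
    have j1 : Integrable (fun ω => c₁ * ‖s ω‖ ^ 2) ρ.P := (integrable_norm_sq hs2).const_mul _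
    have j2 : Integrable (fun ω => c₁ * ‖s ω‖ ^ 2 + c₂) ρ.P := j1.add (integrable_const _)
    have j3 : Integrable (fun ω => c₃ * ‖Δ ω‖ ^ 2) ρ.P := (integrable_norm_sq hΔ2).const_mul _
    have j4 : Integrable (fun ω => c₁ * ‖s ω‖ ^ 2 + c₂ + c₃ * ‖Δ ω‖ ^ 2) ρ.P := j2.add j3
    rw [integral_add j4 (hIi.const_mul _), integral_add j2 j3,
      integral_add j1 (integrable_const _), integral_const]
    simp only [integral_const_mul, probReal_univ, one_smul]
  rw [hlin] at hpath
  have hsd : ∫ ω, ‖s ω‖ ^ 2 ∂ρ.P = γ.meanSqDist ρ k := rfl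
  have he0 : 0 ≤ γ.meanSqDist ρ k := integral_nonneg fun _ => by positivity
  rw [hsd] at hpath
  have hρ₁ : 2 * M₀₁ * δ + 4 * M₁₁ ^ 2 * δ ^ 2 ≤ a ^ 2 := hγ.mesh₁ k hk
  have hρ₂ : 2 * M₀₂ * δ + 4 * M₁₂ ^ 2 * δ ^ 2 ≤ a ^ 2 := hγ.mesh₂ k hk
  have hΔle : ∫ ω, ‖Δ ω‖ ^ 2 ∂ρ.P ≤ a ^ 2 := (hDP.integral_sq_sub_le hle).trans hρ₁
  have hIle : ∫ ω, I ω ∂ρ.P ≤ δ * a ^ 2 :=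
    (hDP.integral_integral_sq_sub_le hle).trans (mul_le_mul_of_nonneg_left hρ₁ hδ)
  have hΔle' : ∫ ω, ‖Δ ω‖ ^ 2 ∂ρ.P ≤ δ * (M₀₁ + a) + M₁₁ ^ 2 / a * (δ * a ^ 2) :=
    (hDP.integral_sq_sub_le_integral hle ha).trans
      (add_le_add_right (mul_le_mul_of_nonneg_left hIle (by positivity)) _)
  have hYle : ∫ ω, ‖Y ω‖ ^ 2 ∂ρ.P ≤ δ * (M₀₂ + a) + M₁₂ ^ 2 / a * (δ * a ^ 2) := by
    refine γ.integral_sq_position_sub ρ hk hG fun q => (hG.integral_sq_le_add q a ha).trans ?_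
    exact add_le_add_right (mul_le_mul_of_nonneg_left (mul_le_mul_of_nonneg_left hρ₂ hδ)
      (by positivity)) _
  have h1 : M₁₁ ^ 2 / a * (δ * a ^ 2) = δ * (M₁₁ ^ 2 * a) := by field_simp
  have h2 : M₁₂ ^ 2 / a * (δ * a ^ 2) = δ * (M₁₂ ^ 2 * a) := by field_simp
  have h3 : δ * (M₁₂ ^ 2 / a) * ∫ ω, ‖Δ ω‖ ^ 2 ∂ρ.P ≤ δ * (M₁₂ ^ 2 * a) := by
    refine (mul_le_mul_of_nonneg_left hΔle (by positivity)).trans_eq ?_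
    field_simp
  have h4 : 2 * (K₁ / a) * ∫ ω, I ω ∂ρ.P ≤ δ * (2 * K₁ * a) := by
    refine (mul_le_mul_of_nonneg_left hIle (by positivity)).trans_eq ?_
    field_simp
  rw [h1] at hΔle'
  rw [h2] at hYle
  -- In `2 + 2 k₀`, one unit comes from Young's inequality for `‖s‖ √κ₀`; the other absorbs these
  -- error coefficients of `‖s‖²`.
  have h5 : (2 * K₁ + 2 + 2 * K₂) * a ≤ 1 := by
    refine le_trans (mul_le_mul_of_nonneg_right ?_ ha.le) hε1
    linarith [sq_nonneg M₁₁, sq_nonneg M₁₂]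
  have h6 : δ * (2 * k₀ + 1 + (2 * K₁ + 2 + 2 * K₂) * a) * γ.meanSqDist ρ k
      ≤ δ * (2 * k₀ + 1 + 1) * γ.meanSqDist ρ k := by gcongr
  have h7 := mul_le_mul_of_nonneg_left hε hδ
  rw [hexp]
  linarith

end GuideData

end StochGame

/-! ### Aimed guide data on fine partitions -/

namespace StochGame

variable {d : ℕ} {t₀ T : ℝ} {U V : Type*}

namespace Generator

theorem Regular.bound_Sig_nonneg [TopologicalSpace U] [TopologicalSpace V] [Nonempty U]
    [Nonempty V] {L : Generator d U V} {M₀ M₁ : ℝ} {K : ℝ≥0} (hL : L.Regular T M₀ M₁ K)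
    (hT : 0 ≤ T) : 0 ≤ M₀ :=
  (abs_nonneg _).trans (hL.bound_Sig 0 (left_mem_Icc.2 hT) 0 (Classical.arbitrary U)
    (Classical.arbitrary V))

theorem Regular.eventually_norm_b_sub_le [TopologicalSpace U] [TopologicalSpace V]
    {L : Generator d U V} {M₀ M₁ : ℝ} {K : ℝ≥0} (hL : L.Regular T M₀ M₁ K) {a : ℝ} (ha : 0 < a) :
    ∀ᶠ h in 𝓝 (0 : ℝ), ∀ t ∈ Icc 0 T, ∀ s ∈ Icc 0 T, t - s = h → ∀ x u v,
      ‖L.b t x u v - L.b s x u v‖ ≤ a := by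
  obtain ⟨α, -, hα, hb⟩ := hL.time_modulus
  have h1 := hα.eventually_lt_const (show (0 : ℝ) < a ^ 2 by positivity)
  rw [eventually_nhdsWithin_iff] at h1
  filter_upwards [h1] with h hh t ht s hs hts x u v
  -- The modulus `α` tends to `0` only off the origin, so `α 0` carries no information.
  by_cases h0 : h = 0
  · rw [sub_eq_zero.1 (hts.trans h0), sub_self, norm_zero]
    exact ha.le
  · refine (pow_le_pow_iff_left₀ (norm_nonneg _) ha.le two_ne_zero).1
      ((hb t ht s hs x u v).trans ?_)
    rw [hts]
    exact (hh h0).le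

end Generator

theorem kappa_nonneg (L₁ L₂ : Generator d U V) (T : ℝ) : 0 ≤ kappa L₁ L₂ T := by
  refine Real.sSup_nonneg ?_
  rintro _ ⟨t, -, x, u, v, rfl⟩
  positivity

theorem eventually_step_bound_le (M₀ M₁ : ℝ) {a : ℝ} (ha : 0 < a) :
    ∀ᶠ h in 𝓝 (0 : ℝ), 2 * M₀ * h + 4 * M₁ ^ 2 * h ^ 2 ≤ a ^ 2 := by
  have h1 : Tendsto (fun h : ℝ => 2 * M₀ * h + 4 * M₁ ^ 2 * h ^ 2) (𝓝 0)
      (𝓝 (2 * M₀ * 0 + 4 * M₁ ^ 2 * 0 ^ 2)) :=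
    Continuous.tendsto (by fun_prop) 0
  simp only [mul_zero, ne_eq, OfNat.ofNat_ne_zero, not_false_eq_true, zero_pow, add_zero] at h1
  filter_upwards [h1.eventually_lt_const (show (0 : ℝ) < a ^ 2 by positivity)] with h hh
  exact hh.le

variable [MeasurableSpace U] [MeasurableSpace V] [TopologicalSpace U] [TopologicalSpace V]
  [Nonempty U] [Nonempty V]

/-- A single stability step to time `T`, where `c = g`, and the displacement bound for that step.
This supplies the upper bound needed for integrability along the guide. -/
theorem VStable.le_add {L : Generator d U V}
    {D : Set (E d → ℝ)} {c : ℝ → E d → ℝ} {g : E d → ℝ} {M₀ M₁ : ℝ} {K R : ℝ≥0}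
    (hc : VStable.{w} L D g T c) (hL : L.Regular T M₀ M₁ K) (hD : IsTestClass L T D)
    (hg : LipschitzWith R g) {t : ℝ} (ht : t ∈ Icc 0 T) (ξ : E d) :
    c t ξ ≤ g ξ + R * (1 + (2 * M₀ * T + 4 * M₁ ^ 2 * T ^ 2)) := by
  have hM := hL.bound_Sig_nonneg (ht.1.trans ht.2)
  have hT := ht.1.trans ht.2
  rcases ht.2.eq_or_lt with h | h
  · rw [h, hc.terminal]
    exact le_add_of_nonneg_right (by positivity)
  · obtain ⟨Q, hQ⟩ := hc.exists_guideStep hL hD ht.1 h le_rfl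
    have h1 := hQ.le_integral (ξ, Classical.arbitrary U)
    simp only [hc.terminal] at h1
    have h2 := (abs_le.1 (hQ.abs_integral_lipschitz_sub_le hg (ξ, Classical.arbitrary U)).2).2
    have h3 : (R : ℝ) * (1 + (2 * M₀ * (T - t) + 4 * M₁ ^ 2 * (T - t) ^ 2))
        ≤ R * (1 + (2 * M₀ * T + 4 * M₁ ^ 2 * T ^ 2)) := by
      have h4 : T - t ≤ T := sub_le_self _ ht.1
      have h5 : 0 ≤ T - t := sub_nonneg.2 ht.2
      gcongr
    simp only at h1 h2
    linarith

open Classical in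
/-- For every accuracy there are guide data on a sufficiently fine uniform partition. -/
theorem GuideData.exists_isAimed {L₁ L₂ : Generator d U V} {D : Set (E d → ℝ)} {c : ℝ → E d → ℝ}
    {g : E d → ℝ} {M₀₁ M₁₁ M₀₂ M₁₂ : ℝ} {K₁ K₂ : ℝ≥0} (hL₁ : L₁.Regular T M₀₁ M₁₁ K₁)
    (hL₂ : L₂.Regular T M₀₂ M₁₂ K₂) (hIsaacs : L₁.Isaacs T ∨ L₂.Isaacs T)
    (hc : VStable.{w} L₂ D g T c) (hD : IsTestClass L₂ T D) (h0 : 0 ≤ t₀) (hT : t₀ < T) (x₀ : E d)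
    {a : ℝ} (ha : 0 < a) :
    ∃ (γ : GuideData d t₀ T U V) (n : ℕ), γ.x₀ = x₀ ∧ (γ.τ 0 : ℝ) = t₀ ∧ (γ.τ n : ℝ) = T ∧
      γ.IsAimed n L₁ L₂ c M₀₁ M₁₁ M₀₂ M₁₂ K₂ (if L₁.Isaacs T then (K₁ : ℝ) else (K₂ : ℝ))
        (kappa L₁ L₂ T) a := by
  obtain ⟨δ₀, hδ₀, hsmall⟩ := Metric.eventually_nhds_iff.1
    (((hL₁.eventually_norm_b_sub_le ha).and (hL₂.eventually_norm_b_sub_le ha)).and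
      ((eventually_step_bound_le M₀₁ M₁₁ ha).and (eventually_step_bound_le M₀₂ M₁₂ ha)))
  obtain ⟨N, hN⟩ := exists_nat_gt ((T - t₀) / δ₀)
  have hN0 : (0 : ℝ) < N := (div_pos (sub_pos.2 hT) hδ₀).trans hN
  set δ := (T - t₀) / N with hδ
  have hδpos : 0 < δ := div_pos (sub_pos.2 hT) hN0
  have hδlt : δ < δ₀ := by
    rw [hδ, div_lt_iff₀ hN0]
    rwa [div_lt_iff₀ hδ₀, mul_comm] at hN
  have hNδ : t₀ + N * δ = T := by
    rw [hδ]
    field_simp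
    ring
  set τ : ℕ → Icc t₀ T := fun k => ⟨min T (t₀ + k * δ), le_min hT.le (by
    have : 0 ≤ (k : ℝ) * δ := by positivity
    linarith), min_le_left _ _⟩ with hτ
  have hτk : ∀ k ≤ N, (τ k : ℝ) = t₀ + k * δ := by
    intro k hk
    refine min_eq_right ?_
    rw [← hNδ]
    gcongr
  have hτδ : ∀ k < N, (τ (k + 1) : ℝ) - τ k = δ := by
    intro k hk
    rw [hτk k hk.le, hτk (k + 1) hk]
    push_cast
    ring
  have hτ0T : ∀ k, (τ k : ℝ) ∈ Icc 0 T := fun k => ⟨h0.trans (τ k).2.1, (τ k).2.2⟩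
  -- Ceiling minus one gives index `k` on `Ioc (τ k) (τ (k + 1))`, right endpoint included; at `s =
  -- t₀` truncated subtraction gives `0`.
  set κ : Icc t₀ T → ℕ := fun s => ⌈((s : ℝ) - t₀) / δ⌉₊ - 1 with hκ
  have hτκ : ∀ s, τ (κ s) ≤ s := by
    intro s
    refine (min_le_right T (t₀ + κ s * δ)).trans ?_
    rcases Nat.eq_zero_or_pos ⌈((s : ℝ) - t₀) / δ⌉₊ with h | h
    · simp only [hκ, h]
      simpa using s.2.1
    · have h1 : κ s < ⌈((s : ℝ) - t₀) / δ⌉₊ := Nat.sub_lt h one_pos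
      rw [Nat.lt_ceil, lt_div_iff₀ hδpos] at h1
      linarith
  have hQ : ∀ k, ∃ Q : Kernel (E d × U) (E d), IsMarkovKernel Q ∧
      (k < N → GuideStep L₂ c M₀₂ M₁₂ K₂ (τ k) (τ (k + 1)) Q) := by
    intro k
    by_cases hk : k < N
    · obtain ⟨Q, hQ⟩ := hc.exists_guideStep hL₂ hD (hτ0T k).1
        (sub_pos.1 ((hτδ k hk).symm ▸ hδpos)) (hτ0T (k + 1)).2
      exact ⟨Q, hQ.isMarkov, fun _ => hQ⟩
    · exact ⟨Kernel.deterministic Prod.fst measurable_fst, inferInstance, fun h => absurd h hk⟩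
  choose Q hQm hQ using hQ
  choose f hf hfe using fun k => exists_extremal_shift hL₁ hL₂ hIsaacs (hτ0T k) ha
  have hdist : ∀ k < N, ∀ σ ∈ Icc (τ k : ℝ) (τ (k + 1)), σ ∈ Icc 0 T ∧ dist (σ - τ k) 0 < δ₀ := by
    intro k hk σ hσ
    refine ⟨⟨(hτ0T k).1.trans hσ.1, hσ.2.trans (hτ0T (k + 1)).2⟩, ?_⟩
    rw [Real.dist_0_eq_abs, abs_of_nonneg (sub_nonneg.2 hσ.1)]
    linarith [hτδ k hk, hσ.2]
  have hδs := hsmall (y := δ) (by rwa [Real.dist_0_eq_abs, abs_of_pos hδpos])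
  refine ⟨⟨τ, ?_, κ, ?_, hτκ, f, hf, Q, hQm, x₀⟩, N, rfl, ?_, ?_, ?_⟩
  · intro j k hjk
    have : t₀ + (j : ℝ) * δ ≤ t₀ + k * δ := by gcongr
    exact min_le_min_left T this
  · exact (measurable_from_nat (f := fun m : ℕ => m - 1)).comp
      (Nat.measurable_ceil.comp ((measurable_subtype_coe.sub_const t₀).div_const δ))
  · simpa using hτk 0 (Nat.zero_le N)
  · exact (hτk N le_rfl).trans hNδ
  · refine ⟨fun k hk => hQ k hk, fun k _ => hfe k, ?_, ?_, ?_, ?_, ?_⟩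
    · intro k hk s hs
      have h1 : (τ k : ℝ) < s := hs.1
      have h2 : (s : ℝ) ≤ τ (k + 1) := hs.2
      rw [hτk k hk.le] at h1
      rw [hτk (k + 1) hk] at h2
      have h3 : ⌈((s : ℝ) - t₀) / δ⌉₊ = k + 1 := by
        rw [Nat.ceil_eq_iff (Nat.succ_ne_zero k), div_le_iff₀ hδpos, lt_div_iff₀ hδpos]
        constructor
        · push_cast
          linarith
        · linarith
      simp only [hκ, h3, Nat.add_sub_cancel]
    · intro k hk σ hσ x u v
      obtain ⟨h1, h2⟩ := hdist k hk σ hσ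
      exact (hsmall h2).1.1 σ h1 _ (hτ0T k) rfl x u v
    · intro k hk σ hσ x u v
      obtain ⟨h1, h2⟩ := hdist k hk σ hσ
      exact (hsmall h2).1.2 σ h1 _ (hτ0T k) rfl x u v
    · intro k hk
      simp only [hτδ k hk]
      exact hδs.2.1
    · intro k hk
      simp only [hτδ k hk]
      exact hδs.2.2

end StochGame

/-! ### Discrete Gronwall estimate and the guaranteed payoff -/

namespace StochGame

theorem LipschitzWith.integrable_comp_of_memLp {d : ℕ} {Ω : Type*} {m : MeasurableSpace Ω}
    {P : Measure Ω} [IsFiniteMeasure P] {g : E d → ℝ} {R : ℝ≥0} (hg : LipschitzWith R g)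
    {Z : Ω → E d} (hZ : MemLp Z 2 P) : Integrable (fun ω => g (Z ω)) P := by
  have hn := (hZ.integrable one_le_two).norm
  refine ((hn.const_mul (R : ℝ)).add (integrable_const |g 0|)).mono'
    (hg.continuous.comp_aestronglyMeasurable hZ.1) (ae_of_all _ fun ω => ?_)
  have h1 : ‖g (Z ω) - g 0‖ ≤ R * ‖Z ω‖ := by
    simpa [dist_eq_norm] using hg.dist_le_mul (Z ω) 0
  have h2 := norm_sub_norm_le (g (Z ω)) (g 0)
  simp only [Pi.add_apply, ← Real.norm_eq_abs]
  linarith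

/-- At the final time every strategy yields the terminal payoff. -/
theorem le_lowerValue_self {d : ℕ} {T : ℝ} {U V : Type*} [MeasurableSpace U] [MeasurableSpace V]
    [Nonempty U] [Nonempty V] {D : Set (E d → ℝ)} (x₀ : E d) (g : E d → ℝ) (L : Generator d U V) :
    ((g x₀ : ℝ) : EReal) ≤ lowerValue.{w} L D g (le_refl T) x₀ := by
  let γ : GuideData d T T U V :=
    { τ := fun _ => ⟨T, left_mem_Icc.2 le_rfl⟩
      τ_mono := monotone_const
      κ := fun _ => 0
      measurable_κ := measurable_const
      τ_κ_le := fun s => s.2.1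
      f := fun _ _ => (Classical.arbitrary U, Classical.arbitrary V)
      measurable_f := fun _ => measurable_const
      Q := fun _ => Kernel.deterministic Prod.fst measurable_fst
      isMarkov_Q := fun _ => inferInstance
      x₀ := x₀ }
  refine le_iSup_of_le (γ.strategy.{w} 0) (le_iInf fun 𝔲 => le_iInf fun ρ => ?_)
  have : ρ.payoff g = g x₀ := by
    have := ρ.isProb
    have h1 : ρ.payoff g = ∫ _, g x₀ ∂ρ.P := by
      refine integral_congr_ae ?_
      filter_upwards [ρ.initial] with ω hω
      rw [hω]
    rw [h1]
    simp
  rw [this]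

variable {d : ℕ} {t₀ T : ℝ} {U V : Type*} [MeasurableSpace U] [MeasurableSpace V]
  [Nonempty V]
  {L₁ L₂ : Generator d U V} {D : Set (E d → ℝ)}
  {c : ℝ → E d → ℝ} {M₀₁ M₁₁ M₀₂ M₁₂ : ℝ} {K₁ K₂ : ℝ≥0} {k₀ κ₀ a : ℝ}

namespace GuideData

variable (γ : GuideData d t₀ T U V) {ht₀ : t₀ ≤ T}
  {x₀ : E d} {𝔲 : Strategy.{w} d t₀ T U} {n : ℕ}
  (ρ : Realization L₁ D ht₀ x₀ 𝔲 (γ.strategy.{w} n))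

theorem meanSqDist_zero (hτ : (γ.τ 0 : ℝ) = t₀) (hx : γ.x₀ = x₀) : γ.meanSqDist ρ 0 = 0 := by
  refine integral_eq_zero_of_ae ?_
  have h0 : γ.τ 0 = ⟨t₀, left_mem_Icc.2 ht₀⟩ := Subtype.ext hτ
  filter_upwards [ρ.initial, γ.position_zero ρ] with ω h1 h2
  rw [h0, h1, h2, hx]
  simp

variable [TopologicalSpace U] [TopologicalSpace V] [Nonempty U]

/-- With `β = 2 + 2 k₀`, the profile `r e^{βr}` is stable under the recursion: `(1 + βδ) r e^{βr} +
δ ≤ (r + δ) e^{β(r + δ)}`, from `1 + βδ ≤ e^{βδ}` and `1 ≤ e^{β(r + δ)}`. -/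
theorem meanSqDist_le (hL : L₁.Regular T M₀₁ M₁₁ K₁) (hD : IsTestClass L₁ T D)
    (h0 : 0 ≤ t₀) (ha : 0 < a) (hk₀ : 0 ≤ k₀) (hκ₀ : 0 ≤ κ₀)
    (hγ : γ.IsAimed n L₁ L₂ c M₀₁ M₁₁ M₀₂ M₁₂ K₂ k₀ κ₀ a) {ε : ℝ}
    (hε1 : (7 + 2 * K₁ + 2 * K₂ + M₁₁ ^ 2 + 2 * M₁₂ ^ 2) * a ≤ 1)
    (hε : (7 + 2 * K₁ + 2 * K₂ + M₁₁ ^ 2 + 2 * M₁₂ ^ 2) * a ≤ ε)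
    (hA : 0 ≤ κ₀ + M₀₁ + M₀₂ + ε) (hτ : (γ.τ 0 : ℝ) = t₀) (hx : γ.x₀ = x₀)
    {k : ℕ} (hk : k ≤ n) :
    γ.meanSqDist ρ k ≤ (κ₀ + M₀₁ + M₀₂ + ε) *
      (((γ.τ k : ℝ) - t₀) * Real.exp ((2 + 2 * k₀) * ((γ.τ k : ℝ) - t₀))) := by
  induction k with
  | zero => simp [γ.meanSqDist_zero ρ hτ hx, hτ]
  | succ k ih =>
    refine (γ.meanSqDist_succ_le ρ hL hD h0 ha hκ₀ hγ hε1 hε hk).trans ?_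
    have ih := ih (by omega)
    have hr : 0 ≤ (γ.τ k : ℝ) - t₀ := sub_nonneg.2 (γ.τ k).2.1
    have hδ : 0 ≤ (γ.τ (k + 1) : ℝ) - γ.τ k := sub_nonneg.2 (γ.τ_mono (Nat.le_succ k))
    have hsum : (γ.τ (k + 1) : ℝ) - t₀ = ((γ.τ k : ℝ) - t₀) + ((γ.τ (k + 1) : ℝ) - γ.τ k) := by
      ring
    rw [hsum]
    generalize (γ.τ (k + 1) : ℝ) - γ.τ k = δ at *
    generalize (γ.τ k : ℝ) - t₀ = r at *
    generalize κ₀ + M₀₁ + M₀₂ + ε = A at *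
    have h1 : (1 + (2 + 2 * k₀) * δ) * γ.meanSqDist ρ k
        ≤ Real.exp ((2 + 2 * k₀) * δ) * (A * (r * Real.exp ((2 + 2 * k₀) * r))) := by
      refine mul_le_mul ?_ ih (integral_nonneg fun _ => by positivity) (Real.exp_pos _).le
      linarith [Real.add_one_le_exp ((2 + 2 * k₀) * δ)]
    have h2 : A * δ * 1 ≤ A * δ * Real.exp ((2 + 2 * k₀) * (r + δ)) :=
      mul_le_mul_of_nonneg_left (Real.one_le_exp (by positivity)) (by positivity)
    rw [mul_add, Real.exp_add] at h2 ⊢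
    linarith

/-- The payoff guaranteed by the strategy that follows aimed guide data. -/
theorem le_payoff (hL : L₁.Regular T M₀₁ M₁₁ K₁) (hD : IsTestClass L₁ T D)
    (h0 : 0 ≤ t₀) (ha : 0 < a) (hk₀ : 0 ≤ k₀) (hκ₀ : 0 ≤ κ₀)
    (hγ : γ.IsAimed n L₁ L₂ c M₀₁ M₁₁ M₀₂ M₁₂ K₂ k₀ κ₀ a) {ε : ℝ}
    (hε1 : (7 + 2 * K₁ + 2 * K₂ + M₁₁ ^ 2 + 2 * M₁₂ ^ 2) * a ≤ 1)
    (hε : (7 + 2 * K₁ + 2 * K₂ + M₁₁ ^ 2 + 2 * M₁₂ ^ 2) * a ≤ ε)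
    (hA : 0 < κ₀ + M₀₁ + M₀₂ + ε) (hτ : (γ.τ 0 : ℝ) = t₀) (hx : γ.x₀ = x₀)
    (hτn : (γ.τ n : ℝ) = T) (hT : 0 < T) {g : E d → ℝ} {R : ℝ≥0} (hg : LipschitzWith R g)
    (hc : ∀ k ≤ n, Measurable (c (γ.τ k))) {B : ℝ} (hB : ∀ k ≤ n, ∀ ξ, c (γ.τ k) ξ ≤ g ξ + B)
    (hn : ∀ ξ, c T ξ = g ξ) :
    c t₀ x₀ - R * √(T * Real.exp ((2 + 2 * k₀) * T)) * √(κ₀ + M₀₁ + M₀₂ + ε) ≤ ρ.payoff g := by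
  have hDP := ρ.driftProcess_path hL hD h0
  have hX2 := hDP.memLp_two (γ.τ n)
  have hy2 := γ.memLp_position ρ hγ.guideStep le_rfl
  have hguide : c t₀ x₀ ≤ ∫ ω, g (γ.position ρ n ω) ∂ρ.P := by
    have := γ.le_integral_terminal ρ hγ.guideStep hg hc hB (by rw [hτn]; exact hn)
    rwa [hτ, hx] at this
  have hXi := LipschitzWith.integrable_comp_of_memLp hg hX2
  have hyi := LipschitzWith.integrable_comp_of_memLp hg hy2
  have hpay : ρ.payoff g = ∫ ω, g (ρ.X ω (γ.τ n)) ∂ρ.P := by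
    have : γ.τ n = ⟨T, right_mem_Icc.2 ht₀⟩ := Subtype.ext hτn
    rw [this]
    rfl
  have hms : γ.meanSqDist ρ n ≤ T * Real.exp ((2 + 2 * k₀) * T) * (κ₀ + M₀₁ + M₀₂ + ε) := by
    refine (γ.meanSqDist_le ρ hL hD h0 ha hk₀ hκ₀ hγ hε1 hε hA.le hτ hx le_rfl).trans ?_
    rw [hτn, mul_comm]
    have h1 : T - t₀ ≤ T := sub_le_self _ h0
    gcongr
  -- `r` is the target root-mean-square distance. The inequality `x ≤ r/2 + x²/(2r)` takes the place
  -- of Cauchy–Schwarz; `hA` makes `r` positive.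
  set r := √(T * Real.exp ((2 + 2 * k₀) * T)) * √(κ₀ + M₀₁ + M₀₂ + ε) with hr
  have hrpos : 0 < r := by positivity
  have hr2 : r ^ 2 = T * Real.exp ((2 + 2 * k₀) * T) * (κ₀ + M₀₁ + M₀₂ + ε) := by
    rw [hr, mul_pow, Real.sq_sqrt (by positivity), Real.sq_sqrt hA.le]
  have hs2 : Integrable (fun ω => ‖ρ.X ω (γ.τ n) - γ.position ρ n ω‖ ^ 2) ρ.P :=
    integrable_norm_sq (hX2.sub hy2)
  have hle : ∫ ω, g (γ.position ρ n ω) ∂ρ.P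
      ≤ ∫ ω, (g (ρ.X ω (γ.τ n)) + (R * (r / 2)
        + R / (2 * r) * ‖ρ.X ω (γ.τ n) - γ.position ρ n ω‖ ^ 2)) ∂ρ.P := by
    refine integral_mono hyi (hXi.add ((integrable_const _).add (hs2.const_mul _))) fun ω => ?_
    have h1 : |g (γ.position ρ n ω) - g (ρ.X ω (γ.τ n))|
        ≤ R * ‖ρ.X ω (γ.τ n) - γ.position ρ n ω‖ := by
      rw [norm_sub_rev]
      simpa [dist_eq_norm] using hg.dist_le_mul (γ.position ρ n ω) (ρ.X ω (γ.τ n))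
    have h2 := mul_le_mul_of_nonneg_left (two_mul_le_mul_sq_add (x := 1)
      (y := ‖ρ.X ω (γ.τ n) - γ.position ρ n ω‖) hrpos) (one_half_pos (α := ℝ)).le
    have h3 := mul_le_mul_of_nonneg_left h2 R.coe_nonneg
    have h4 : (R : ℝ) / (2 * r) * ‖ρ.X ω (γ.τ n) - γ.position ρ n ω‖ ^ 2
        = R * (1 / 2 * (‖ρ.X ω (γ.τ n) - γ.position ρ n ω‖ ^ 2 / r)) := by
      field_simp
    have h5 := (abs_le.1 h1).2
    rw [h4]
    linarith
  have hlin : ∫ ω, (g (ρ.X ω (γ.τ n)) + (R * (r / 2)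
        + R / (2 * r) * ‖ρ.X ω (γ.τ n) - γ.position ρ n ω‖ ^ 2)) ∂ρ.P
      = ρ.payoff g + (R * (r / 2) + R / (2 * r) * γ.meanSqDist ρ n) := by
    have j1 : Integrable (fun ω => R * (r / 2)
        + R / (2 * r) * ‖ρ.X ω (γ.τ n) - γ.position ρ n ω‖ ^ 2) ρ.P :=
      (integrable_const _).add (hs2.const_mul _)
    rw [integral_add hXi j1, integral_add (integrable_const _) (hs2.const_mul _), integral_const,
      integral_const_mul, hpay]
    simp only [probReal_univ, one_smul]
    rfl
  have hfin : (R : ℝ) / (2 * r) * γ.meanSqDist ρ n ≤ R * (r / 2) := by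
    have h1 : (R : ℝ) / (2 * r) * γ.meanSqDist ρ n ≤ R / (2 * r) * r ^ 2 := by
      rw [hr2]
      exact mul_le_mul_of_nonneg_left hms (by positivity)
    refine h1.trans_eq ?_
    field_simp
  have : (R : ℝ) * √(T * Real.exp ((2 + 2 * k₀) * T)) * √(κ₀ + M₀₁ + M₀₂ + ε) = R * r := by
    rw [hr, mul_assoc]
  rw [this]
  linarith

end GuideData

end StochGame

/-! ### Passage to the limit -/

namespace StochGame

variable {d : ℕ} {t₀ T : ℝ} {U V : Type*} [MeasurableSpace U] [MeasurableSpace V]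
  [TopologicalSpace U] [TopologicalSpace V] [Nonempty U] [Nonempty V]
  {L₁ L₂ : Generator d U V} {D₁ D₂ : Set (E d → ℝ)}
  {c : ℝ → E d → ℝ} {g : E d → ℝ} {M₀₁ M₁₁ M₀₂ M₁₂ : ℝ} {K₁ K₂ R : ℝ≥0}

/-- The guide data are fixed before the opponent's strategy and the realization, so one strategy of
the second player serves against all of them. -/
theorem VStable.sub_le_lowerValue (hL₁ : L₁.Regular T M₀₁ M₁₁ K₁) (hL₂ : L₂.Regular T M₀₂ M₁₂ K₂)
    (hIsaacs : L₁.Isaacs T ∨ L₂.Isaacs T) (hD₁ : IsTestClass L₁ T D₁)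
    (hD₂ : IsTestClass L₂ T D₂) (hg : LipschitzWith R g) (hc : VStable.{w} L₂ D₂ g T c)
    (h0 : 0 ≤ t₀) (hT : t₀ < T) (x₀ : E d) {ε : ℝ} (hε : 0 < ε) :
    ((c t₀ x₀ - R * CConst L₁ T K₁ K₂ * √(Theta L₁ L₂ T M₀₁ M₀₂ + ε) : ℝ) : EReal)
      ≤ lowerValue.{w} L₁ D₁ g hT.le x₀ := by
  classical
  have hT0 : 0 < T := h0.trans_lt hT
  have hM₁ := hL₁.bound_Sig_nonneg hT0.le
  have hM₂ := hL₂.bound_Sig_nonneg hT0.le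
  have hκ := kappa_nonneg L₁ L₂ T
  set C₀ : ℝ := 7 + 2 * K₁ + 2 * K₂ + M₁₁ ^ 2 + 2 * M₁₂ ^ 2 with hC₀
  have hC₀pos : 0 < C₀ := by positivity
  have hmin : 0 < min 1 ε := lt_min one_pos hε
  -- The bound by `1` permits the absorption into `β`; the bound by `ε` controls the error added to
  -- `Θ`.
  have ha : 0 < min 1 ε / C₀ := div_pos hmin hC₀pos
  have hCa : C₀ * (min 1 ε / C₀) = min 1 ε := by field_simp
  obtain ⟨γ, n, hx, hτ, hτn, hγ⟩ :=
    GuideData.exists_isAimed hL₁ hL₂ hIsaacs hc hD₂ h0 hT x₀ ha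
  have hτ0T : ∀ k, (γ.τ k : ℝ) ∈ Icc 0 T := fun k => ⟨h0.trans (γ.τ k).2.1, (γ.τ k).2.2⟩
  refine le_iSup_of_le (γ.strategy.{w} n) (le_iInf fun 𝔲 => le_iInf fun ρ => ?_)
  rw [EReal.coe_le_coe_iff]
  have hk₀ : 0 ≤ (if L₁.Isaacs T then (K₁ : ℝ) else (K₂ : ℝ)) := by
    split_ifs <;> positivity
  exact γ.le_payoff ρ hL₁ hD₁ h0 ha hk₀ hκ (by convert hγ) (hCa.trans_le (min_le_left _ _))
    (hCa.trans_le (min_le_right _ _)) (by positivity) hτ hx hτn hT0 hg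
    (fun k _ => hc.measurable _ (hτ0T k)) (fun k _ ξ => hc.le_add hL₂ hD₂ hg (hτ0T k) ξ) hc.terminal

end StochGame

theorem mainTheorem3 {d : ℕ}
    {U : Type*} [MetricSpace U] [CompactSpace U] [Nonempty U] [MeasurableSpace U] [BorelSpace U]
    {V : Type*} [MetricSpace V] [CompactSpace V] [Nonempty V] [MeasurableSpace V] [BorelSpace V]
    (T : ℝ) (L₁ L₂ : Generator d U V) (M₀₁ M₁₁ M₀₂ M₁₂ : ℝ) (K₁ K₂ : ℝ≥0)
    (hL₁ : L₁.Regular T M₀₁ M₁₁ K₁) (hL₂ : L₂.Regular T M₀₂ M₁₂ K₂)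
    (hIsaacs : L₁.Isaacs T ∨ L₂.Isaacs T)
    (D₁ D₂ : Set (E d → ℝ)) (hD₁ : IsTestClass L₁ T D₁) (hD₂ : IsTestClass L₂ T D₂)
    (g : E d → ℝ) (R : ℝ≥0) (hg : LipschitzWith R g)
    (c : ℝ → E d → ℝ) (hc : VStable.{w} L₂ D₂ g T c)
    (t₀ : ℝ) (ht₀ : t₀ ∈ Icc 0 T) (x₀ : E d) :
    ((c t₀ x₀ - R * CConst L₁ T K₁ K₂ * √(Theta L₁ L₂ T M₀₁ M₀₂) : ℝ) : EReal)
      ≤ lowerValue.{w} L₁ D₁ g ht₀.2 x₀ := by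
  -- At `t₀ = T` there is no interval to partition, and every realization pays `g x₀` because the
  -- motion starts at `x₀` a.s.
  rcases ht₀.2.eq_or_lt with rfl | hT
  · refine le_trans ?_ (le_lowerValue_self x₀ g L₁)
    rw [EReal.coe_le_coe_iff, hc.terminal]
    exact sub_le_self _ (by unfold CConst; positivity)
  -- The strategies depend on `ε`, but the lower value is already a supremum over strategies, so
  -- only the left side moves as `ε → 0`.
  · have hlim : Tendsto (fun ε : ℝ => ((c t₀ x₀ - R * CConst L₁ T K₁ K₂
        * √(Theta L₁ L₂ T M₀₁ M₀₂ + ε) : ℝ) : EReal)) (𝓝[>] 0)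
        (𝓝 ((c t₀ x₀ - R * CConst L₁ T K₁ K₂ * √(Theta L₁ L₂ T M₀₁ M₀₂ + 0) : ℝ) : EReal)) := by
      refine Tendsto.mono_left (Continuous.tendsto ?_ 0) nhdsWithin_le_nhds
      exact continuous_coe_real_ereal.comp (by fun_prop)
    rw [add_zero] at hlim
    refine le_of_tendsto hlim ?_
    filter_upwards [self_mem_nhdsWithin] with ε hε
    exact hc.sub_le_lowerValue hL₁ hL₂ hIsaacs hD₁ hD₂ hg ht₀.1 hT x₀ hε
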